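/- **Setting.** Let $M,N\ge 1$ be integers, let $\lambda_S,\lambda_R\ge 0$ and $\mu>0$. Write $\vec v=(v_1,\dots,v_M)\in\mathbb R^M$ for the velocities of a system of $M$ particles, $\vec w=(w_1,\dots,w_N)\in\mathbb R^N$ for the velocities of a reservoir of $N$ particles, and $\Gamma_n(\vec u)=\prod_{i=1}^n e^{-\pi u_i^2}$ for the Maxwellian on $\mathbb R^n$ at inverse temperature $\beta=2\pi$. For two of the $M+N$ particles $a\neq b$, with velocities $x_a,x_b$, define on $L^1(\mathbb R^{M+N})$ $$R_{a,b}[f](x)=\frac1{2\pi}\int_0^{2\pi} f(\dots,x_a\cos\theta+x_b\sin\theta,\dots,-x_a\sin\theta+x_b\cos\theta,\dots)\,d\theta$$ (only the entries $a$ and $b$ are changed); denote it by $R^S_{i,j}$ for two system particles, by $R^R_{i,j}$ for two reservoir particles, and by $R^I_{i,j}$ if $a$ is the $i$-th system particle and $b$ the $j$-th reservoir particle. Moreover, for $1\le j\le M$ let $$B_j[f](\vec v,\vec w)=\int_{\mathbb R}du\,\frac1{2\pi}\int_0^{2\pi}d\theta\; e^{-\pi(-v_j\sin\theta+u\cos\theta)^2}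 f(v_1,\dots,v_j\cos\theta+u\sin\theta,\dots,v_M,\vec w).$$ Define the bounded operators on $L^1(\mathbb R^{M+N})$ $$\mathcal L_S=\frac{\lambda_S}{M-1}\sum_{1\le i<j\le M}(R^S_{i,j}-I),\qquad \mathcal L_R=\frac{\lambda_R}{N-1}\sum_{1\le i<j\le N}(R^R_{i,j}-I),$$ (read as $0$ if $M=1$, respectively $N=1$), and $$\mathcal L=\mathcal L_S+\mathcal L_R+\frac{\mu}{N}\sum_{i=1}^M\sum_{j=1}^N(R^I_{i,j}-I),\qquad \widetilde{\mathcal L}=\mathcal L_S+\mu\sum_{j=1}^M(B_j-I);$$ $e^{t\mathcal L}$ is the evolution of the system in contact with the finite reservoir and $e^{t\widetilde{\mathcal L}}$ that of the system in contact with a Maxwellian thermostat. For $f,g\in L^1(\mathbb R^n)$ let $$d_2(f,g)=\sup_{\xi\in\mathbb R^n,\ \xi\ne0}\frac{|\widehat f(\xi)-\widehat g(\xi)|}{|\xi|^2}\in[0,\infty],\qquad \widehat f(\xi)=\int_{\mathbb R^n}e^{-2\pi i\,\xi\cdot x}f(x)\,dx,$$ be the Gabetta–Toscani–Wennberg (GTW)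 distance. **Theorem.** Let $l_0$ be a probability density on $\mathbb R^M$ that is invariant under permutations of its variables and satisfies, for all $i$, $$\int v_i\,l_0(\vec v)\,d\vec v=0,\qquad \int v_i^2\,l_0(\vec v)\,d\vec v<\infty,\qquad \int v_i^4\,l_0(\vec v)\,d\vec v=E_4<\infty ,$$ and let $f_0(\vec v,\vec w)=l_0(\vec v)\,\Gamma_N(\vec w)$. Then $d_2(l_0,\Gamma_M)<\infty$, and for every $t>0$ $$d_2\left(e^{t\widetilde{\mathcal L}}f_0,\;e^{t\mathcal L}f_0\right)\le\frac{KM}{N}\left(1-e^{-\mu t/4}\right)\sqrt{d_2(l_0,\Gamma_M)\,\bigl(F_4+d_2(l_0,\Gamma_M)\bigr)},$$ where $F_4=48\pi^4(E_4+1)$ and $K=16\sqrt2$. -/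

import Mathlib

open MeasureTheory Real Set
open scoped FourierTransform ENNReal

noncomputable section

namespace KacReservoir

/-- Velocity space of particles labelled by `ι`, with the Euclidean norm and Lebesgue measure. -/
abbrev Vel (ι : Type*) := EuclideanSpace ℝ ι

/-- The one-particle Maxwellian at inverse temperature `β = 2π`, that is
`√(β / 2π) * exp (-β w² / 2) = exp (-π w²)`. -/
def gauss (w : ℝ) : ℝ := Real.exp (-π * w ^ 2)

/-- The Maxwellian `Γ` of independent particles labelled by `ι`, at `β = 2π`. -/
def maxwellian {ι : Type*} [Fintype ι] (x : Vel ι) : ℝ := ∏ i, gauss (x i)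

/-! ### Collisions of two particles -/

/-- Velocities after particles `a` and `b` have collided with scattering angle `θ`. -/
def collide {ι : Type*} [DecidableEq ι] (a b : ι) (θ : ℝ) (x : Vel ι) : Vel ι :=
  WithLp.toLp 2 (Function.update
    (Function.update (fun i => x i) a (x a * Real.cos θ + x b * Real.sin θ))
    b (-x a * Real.sin θ + x b * Real.cos θ))

/-- `R_{a,b}[f](x)`: the mean of `f` over all outcomes of a collision between `a` and `b`. -/
def collisionMean {ι : Type*} [DecidableEq ι] (a b : ι) (f : Vel ι → ℝ) (x : Vel ι) : ℝ :=
  (2 * π)⁻¹ * ∫ θ in (0 : ℝ)..2 * π, f (collide a b θ x)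

/-! ### Collisions with the thermostat -/

/-- The velocity vector with its `j`-th entry replaced by the velocity of `j` after a collision
with a thermostat particle of velocity `w`. -/
def collideBath {ι : Type*} [DecidableEq ι] (j : ι) (θ w : ℝ) (x : Vel ι) : Vel ι :=
  WithLp.toLp 2 (Function.update (fun i => x i) j (x j * Real.cos θ + w * Real.sin θ))

/-- `B_j[f](x)`: the action of the Maxwellian thermostat on particle `j`. -/
def thermostatMean {ι : Type*} [DecidableEq ι] (j : ι) (f : Vel ι → ℝ) (x : Vel ι) : ℝ :=
  ∫ w : ℝ, (2 * π)⁻¹ * ∫ θ in (0 : ℝ)..2 * π,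
    gauss (-x j * Real.sin θ + w * Real.cos θ) * f (collideBath j θ w x)

/-! ### Both means are bounded linear operators on `L¹` -/

/-- A map `T` on functions that agrees, on integrable functions and up to null sets, with
`f ↦ ∫ K f (y, ·) dρ(y)` for a linear contractive `K`, as a bounded operator on `L¹`: the class of
`f` is sent to the class of `T f`. -/
def toL1Op {X Y : Type*} [MeasurableSpace X] [MeasurableSpace Y] {μ : Measure X} [SFinite μ]
    {ρ : Measure Y} [SFinite ρ] (T : (X → ℝ) → X → ℝ) (K : (X → ℝ) → Y × X → ℝ)
    (hT : ∀ f, Integrable f μ → T f =ᵐ[μ] fun x => ∫ y, K f (y, x) ∂ρ)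
    (hint : ∀ f, Integrable f μ → Integrable (K f) (ρ.prod μ))
    (hcongr : ∀ f g, f =ᵐ[μ] g → K f =ᵐ[ρ.prod μ] K g)
    (hadd : ∀ f g, K (f + g) = K f + K g)
    (hsmul : ∀ (c : ℝ) f, K (c • f) = c • K f)
    (hbound : ∀ f, Integrable f μ → ∫ p, ‖K f p‖ ∂(ρ.prod μ) = ∫ x, ‖f x‖ ∂μ) :
    (X →₁[μ] ℝ) →L[ℝ] (X →₁[μ] ℝ) :=
  have hTint : ∀ f, Integrable f μ → Integrable (T f) μ := fun f hf =>
    (hint f hf).integral_prod_right.congr (hT f hf).symm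
  have hTcongr : ∀ f g, Integrable f μ → f =ᵐ[μ] g → T f =ᵐ[μ] T g := fun f g hf hfg => by
    have h := Measure.ae_ae_of_ae_prod
      (Measure.measurePreserving_swap.quasiMeasurePreserving.ae (hcongr f g hfg))
    filter_upwards [hT f hf, hT g (hf.congr hfg), h] with x h1 h2 h3
    rw [h1, h2]
    exact integral_congr_ae h3
  LinearMap.mkContinuous
    { toFun := fun f => (hTint f (L1.integrable_coeFn f)).toL1 (T f)
      map_add' := fun f g => by
        have hf := L1.integrable_coeFn f
        have hg := L1.integrable_coeFn g
        rw [← Integrable.toL1_add, Integrable.toL1_eq_toL1_iff]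
        refine (hTcongr _ _ (L1.integrable_coeFn (f + g)) (Lp.coeFn_add f g)).trans ?_
        filter_upwards [hT _ hf, hT _ hg, hT _ (hf.add hg), (hint _ hf).prod_left_ae,
          (hint _ hg).prod_left_ae] with x h1 h2 h3 h4 h5
        rw [h3, Pi.add_apply, h1, h2, ← integral_add h4 h5, hadd]
        rfl
      map_smul' := fun c f => by
        have hf := L1.integrable_coeFn f
        rw [RingHom.id_apply, ← Integrable.toL1_smul, Integrable.toL1_eq_toL1_iff]
        refine (hTcongr _ _ (L1.integrable_coeFn (c • f)) (Lp.coeFn_smul c f)).trans ?_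
        filter_upwards [hT _ hf, hT _ (hf.smul c)] with x h1 h2
        rw [h2]
        change _ = c • T f x
        rw [h1, ← integral_smul, hsmul]
        rfl }
    1 (fun f => by
      have hf := L1.integrable_coeFn f
      rw [one_mul, LinearMap.coe_mk, AddHom.coe_mk, L1.norm_eq_integral_norm,
        L1.norm_eq_integral_norm, ← hbound f hf, integral_prod_symm _ (hint f hf).norm]
      refine integral_mono_ae (L1.integrable_coeFn _).norm
        (hint f hf).norm.integral_prod_right ?_
      filter_upwards [(hTint f hf).coeFn_toL1, hT f hf] with x h1 h2
      rw [h1, h2]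
      exact norm_integral_le_integral_norm _)

lemma coeFn_toL1Op {X Y : Type*} [MeasurableSpace X] [MeasurableSpace Y] {μ : Measure X} [SFinite μ]
    {ρ : Measure Y} [SFinite ρ] (T : (X → ℝ) → X → ℝ) (K : (X → ℝ) → Y × X → ℝ)
    (hT : ∀ f, Integrable f μ → T f =ᵐ[μ] fun x => ∫ y, K f (y, x) ∂ρ)
    (hint : ∀ f, Integrable f μ → Integrable (K f) (ρ.prod μ))
    (hcongr : ∀ f g, f =ᵐ[μ] g → K f =ᵐ[ρ.prod μ] K g)
    (hadd : ∀ f g, K (f + g) = K f + K g)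
    (hsmul : ∀ (c : ℝ) f, K (c • f) = c • K f)
    (hbound : ∀ f, Integrable f μ → ∫ p, ‖K f p‖ ∂(ρ.prod μ) = ∫ x, ‖f x‖ ∂μ)
    (f : X →₁[μ] ℝ) : toL1Op T K hT hint hcongr hadd hsmul hbound f =ᵐ[μ] T f :=
  Integrable.coeFn_toL1 ((hint f (L1.integrable_coeFn f)).integral_prod_right.congr
    (hT f (L1.integrable_coeFn f)).symm)

section MeasurePreserving

variable {ι : Type*} [Fintype ι] [DecidableEq ι]

lemma measurePreserving_of_norm {E : Type*} [NormedAddCommGroup E] [InnerProductSpace ℝ E]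
    [FiniteDimensional ℝ E] [MeasurableSpace E] [BorelSpace E] (A : E →ₗ[ℝ] E)
    (h : ∀ x, ‖A x‖ = ‖x‖) : MeasurePreserving A volume volume := by
  let B : E →ₗᵢ[ℝ] E := ⟨A, h⟩
  have := (B.toLinearIsometryEquiv rfl).measurePreserving
  simpa [B] using this

lemma sum_sq_update {v : ι → ℝ} {j : ι} {c : ℝ} :
    ∑ i, (Function.update v j c i) ^ 2 = ∑ i, v i ^ 2 - v j ^ 2 + c ^ 2 := by
  rw [← Finset.add_sum_erase _ _ (Finset.mem_univ j),
    ← Finset.add_sum_erase _ (fun i => v i ^ 2) (Finset.mem_univ j)]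
  have : ∑ i ∈ Finset.univ.erase j, (Function.update v j c i) ^ 2
      = ∑ i ∈ Finset.univ.erase j, v i ^ 2 :=
    Finset.sum_congr rfl fun i hi => by
      rw [Function.update_of_ne (Finset.ne_of_mem_erase hi)]
  rw [this, Function.update_self]
  ring

lemma measurePreserving_collide {a b : ι} (hab : a ≠ b) (θ : ℝ) :
    MeasurePreserving (collide a b θ : Vel ι → Vel ι) volume volume := by
  let A : Vel ι →ₗ[ℝ] Vel ι :=
    { toFun := collide a b θ
      map_add' := fun x y => by
        ext i
        by_cases hb : i = b
        · subst hb; simp [collide]; ring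
        · by_cases ha : i = a
          · subst ha; simp [collide, hb]; ring
          · simp [collide, ha, hb]
      map_smul' := fun c x => by
        ext i
        by_cases hb : i = b
        · subst hb; simp [collide]; ring
        · by_cases ha : i = a
          · subst ha; simp [collide, hb]; ring
          · simp [collide, ha, hb] }
  refine measurePreserving_of_norm A fun x => ?_
  rw [EuclideanSpace.norm_eq, EuclideanSpace.norm_eq]
  congr 1
  simp only [Real.norm_eq_abs, sq_abs]
  change ∑ i, (Function.update _ b _ i) ^ 2 = _
  rw [sum_sq_update, sum_sq_update, Function.update_of_ne hab.symm]
  linear_combination (x a ^ 2 + x b ^ 2) * Real.sin_sq_add_cos_sq θ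

/-- A collision between particle `j` and a thermostat particle, as a map of both velocities. -/
def bathRotation (j : ι) (θ : ℝ) (p : Vel ι × ℝ) : Vel ι × ℝ :=
  (collideBath j θ p.2 p.1, -p.1 j * Real.sin θ + p.2 * Real.cos θ)

lemma measurePreserving_bathRotation (j : ι) (θ : ℝ) :
    MeasurePreserving (bathRotation j θ : Vel ι × ℝ → Vel ι × ℝ) volume volume := by
  let A : WithLp 2 (Vel ι × ℝ) →ₗ[ℝ] WithLp 2 (Vel ι × ℝ) :=
    { toFun := fun p => WithLp.toLp 2 (bathRotation j θ (WithLp.ofLp p))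
      map_add' := fun x y => by
        refine congrArg (WithLp.toLp 2) (Prod.ext ?_ ?_)
        · ext i
          by_cases hj : i = j
          · subst hj; simp [bathRotation, collideBath]; ring
          · simp [bathRotation, collideBath, hj]
        · simp [bathRotation]; ring
      map_smul' := fun c x => by
        refine congrArg (WithLp.toLp 2) (Prod.ext ?_ ?_)
        · ext i
          by_cases hj : i = j
          · subst hj; simp [bathRotation, collideBath]; ring
          · simp [bathRotation, collideBath, hj]
        · simp [bathRotation]; ring }
  have hA := measurePreserving_of_norm A fun x => by
    have h2 : ‖A x‖ ^ 2 = ‖x‖ ^ 2 := by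
      rw [WithLp.prod_norm_sq_eq_of_L2, WithLp.prod_norm_sq_eq_of_L2,
        EuclideanSpace.norm_sq_eq, EuclideanSpace.norm_sq_eq]
      simp only [Real.norm_eq_abs, sq_abs]
      change ∑ i, (Function.update (fun i => x.fst i) j
          (x.fst j * Real.cos θ + x.snd * Real.sin θ) i) ^ 2
        + (-x.fst j * Real.sin θ + x.snd * Real.cos θ) ^ 2 = _
      rw [sum_sq_update]
      linear_combination (x.fst j ^ 2 + x.snd ^ 2) * Real.sin_sq_add_cos_sq θ
    exact (sq_eq_sq₀ (norm_nonneg _) (norm_nonneg _)).1 h2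
  exact (WithLp.volume_preserving_ofLp (Vel ι) ℝ).comp
    (hA.comp (WithLp.volume_preserving_toLp (Vel ι) ℝ))

lemma measurePreserving_angle_collide {a b : ι} (hab : a ≠ b) (ρ : Measure ℝ) [SFinite ρ] :
    MeasurePreserving (fun p : ℝ × Vel ι => (p.1, collide a b p.1 p.2))
      (ρ.prod volume) (ρ.prod volume) := by
  refine (MeasurePreserving.id ρ).skew_product (g := fun θ x => collide a b θ x) ?_
    (Filter.Eventually.of_forall fun θ => (measurePreserving_collide hab θ).map_eq)
  refine (WithLp.measurable_toLp 2 _).comp (measurable_pi_lambda _ fun i => ?_)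
  by_cases hb : i = b
  · subst hb
    simp only [Function.update_self]
    fun_prop
  · by_cases ha : i = a
    · subst ha
      simp only [Function.update_of_ne hb, Function.update_self]
      fun_prop
    · simp only [Function.update_of_ne hb, Function.update_of_ne ha]
      fun_prop

lemma measurePreserving_angle_bath (j : ι) (ρ : Measure ℝ) [SFinite ρ] :
    MeasurePreserving (fun p : ℝ × (Vel ι × ℝ) => (p.1, bathRotation j p.1 p.2))
      (ρ.prod volume) (ρ.prod volume) := by
  refine (MeasurePreserving.id ρ).skew_product (g := fun θ x => bathRotation j θ x) ?_
    (Filter.Eventually.of_forall fun θ => (measurePreserving_bathRotation j θ).map_eq)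
  refine Measurable.prodMk ?_ (by fun_prop)
  refine (WithLp.measurable_toLp 2 _).comp (measurable_pi_lambda _ fun i => ?_)
  by_cases hj : i = j
  · subst hj
    simp only [Function.update_self]
    fun_prop
  · simp only [Function.update_of_ne hj]
    fun_prop

end MeasurePreserving

section Operators

variable {ι : Type*} [Fintype ι] [DecidableEq ι]

lemma gauss_nonneg (w : ℝ) : 0 ≤ gauss w := (Real.exp_pos _).le

lemma integrable_gauss : Integrable gauss := integrable_exp_neg_mul_sq Real.pi_pos

lemma integral_gauss : ∫ w, gauss w = 1 := by
  have h := integral_gaussian π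
  rwa [div_self Real.pi_ne_zero, Real.sqrt_one] at h

/-- The collision operator `R_{a,b}` on `L¹`: the class of `f` is sent to the class of
`collisionMean a b f`. -/
def collisionOp (a b : ι) (hab : a ≠ b) :
    (Vel ι →₁[volume] ℝ) →L[ℝ] (Vel ι →₁[volume] ℝ) :=
  toL1Op (ρ := volume.restrict (Ioc 0 (2 * π))) (collisionMean a b)
    (fun f p => (2 * π)⁻¹ * f (collide a b p.1 p.2))
    (fun f _ => Filter.Eventually.of_forall fun x => by
      simp only [collisionMean]
      rw [intervalIntegral.integral_of_le Real.two_pi_pos.le, integral_const_mul])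
    (fun f hf => ((measurePreserving_angle_collide hab _).integrable_comp_of_integrable
      (g := fun p : ℝ × Vel ι => f p.2) (hf.comp_snd _)).const_mul _)
    (fun f g hfg => by
      have h : (fun p : ℝ × Vel ι => f p.2) =ᵐ[(volume.restrict (Ioc 0 (2 * π))).prod volume]
          fun p => g p.2 := Measure.quasiMeasurePreserving_snd.ae_eq_comp hfg
      filter_upwards [(measurePreserving_angle_collide hab _).quasiMeasurePreserving.ae_eq_comp h]
        with p hp
      simp only [Function.comp] at hp
      rw [hp])
    (fun f g => by ext p; simp [mul_add])
    (fun c f => by ext p; simp only [Pi.smul_apply, smul_eq_mul]; ring)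
    (fun f hf => by
      have hmp := measurePreserving_angle_collide hab (volume.restrict (Ioc 0 (2 * π)))
      have hi : Integrable (fun p : ℝ × Vel ι => ‖f p.2‖)
          ((volume.restrict (Ioc 0 (2 * π))).prod volume) := hf.norm.comp_snd _
      have h1 : ∫ p, ‖f (collide a b p.1 p.2)‖ ∂((volume.restrict (Ioc 0 (2 * π))).prod volume)
          = ∫ p : ℝ × Vel ι, ‖f p.2‖ ∂((volume.restrict (Ioc 0 (2 * π))).prod volume) := by
        conv_rhs => rw [← hmp.map_eq]
        rw [integral_map hmp.aemeasurable (by rw [hmp.map_eq]; exact hi.1)]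
      simp only [norm_mul]
      rw [integral_const_mul, h1, integral_prod _ hi]
      simp only [integral_const, smul_eq_mul, measureReal_restrict_apply_univ,
        Real.volume_real_Ioc_of_le Real.two_pi_pos.le, sub_zero, norm_inv, Real.norm_eq_abs,
        abs_of_pos Real.two_pi_pos]
      rw [← mul_assoc, inv_mul_cancel₀ Real.two_pi_pos.ne', one_mul])

/-- Reordering of (scattering angle, thermostat velocity, velocities), followed by a collision. -/
def bathMap (j : ι) (p : (ℝ × ℝ) × Vel ι) : ℝ × (Vel ι × ℝ) :=
  (p.1.1, bathRotation j p.1.1 (p.2, p.1.2))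

lemma measurePreserving_bathMap (j : ι) (ρ : Measure ℝ) [SFinite ρ] :
    MeasurePreserving (bathMap j : (ℝ × ℝ) × Vel ι → ℝ × (Vel ι × ℝ))
      ((ρ.prod volume).prod volume) (ρ.prod volume) := by
  have h1 : MeasurePreserving (MeasurableEquiv.prodAssoc : (ℝ × ℝ) × Vel ι ≃ᵐ ℝ × (ℝ × Vel ι))
      ((ρ.prod volume).prod volume) (ρ.prod (volume.prod volume)) :=
    measurePreserving_prodAssoc ρ volume volume
  have h2 : MeasurePreserving (Prod.map id Prod.swap : ℝ × (ℝ × Vel ι) → ℝ × (Vel ι × ℝ))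
      (ρ.prod (volume.prod volume)) (ρ.prod (volume.prod volume)) :=
    (MeasurePreserving.id ρ).prod Measure.measurePreserving_swap
  exact (measurePreserving_angle_bath j ρ).comp (h2.comp h1)

lemma integrable_bath {ι : Type*} [Fintype ι] {ρ : Measure ℝ} [IsFiniteMeasure ρ] {f : Vel ι → ℝ}
    (hf : Integrable f) :
    Integrable (fun p : ℝ × (Vel ι × ℝ) => gauss p.2.2 * f p.2.1) (ρ.prod volume) := by
  have h : Integrable (fun q : Vel ι × ℝ => gauss q.2 * f q.1) := by
    have h' := hf.mul_prod integrable_gauss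
    simp only [mul_comm] at h' ⊢
    exact h'
  exact h.comp_snd ρ

lemma integrable_bathKernel (j : ι) (f : Vel ι → ℝ) (hf : Integrable f) :
    Integrable (fun p : (ℝ × ℝ) × Vel ι =>
      (2 * π)⁻¹ * (gauss (bathMap j p).2.2 * f (bathMap j p).2.1))
      (((volume.restrict (Ioc 0 (2 * π))).prod volume).prod volume) :=
  ((measurePreserving_bathMap j _).integrable_comp_of_integrable
    (g := fun p : ℝ × (Vel ι × ℝ) => gauss p.2.2 * f p.2.1)
    (integrable_bath hf)).const_mul _

/-- The thermostat operator `B_j` on `L¹`: the class of `f` is sent to the class of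
`thermostatMean j f`. -/
def thermostatOp (j : ι) : (Vel ι →₁[volume] ℝ) →L[ℝ] (Vel ι →₁[volume] ℝ) :=
  toL1Op (ρ := (volume.restrict (Ioc 0 (2 * π))).prod volume) (thermostatMean j)
    (fun f p => (2 * π)⁻¹ * (gauss (bathMap j p).2.2 * f (bathMap j p).2.1))
    (fun f hf => by
      filter_upwards [(integrable_bathKernel j f hf).prod_left_ae] with x hx
      rw [integral_prod_symm _ hx]
      simp only [thermostatMean]
      congr 1
      ext w
      rw [intervalIntegral.integral_of_le Real.two_pi_pos.le, ← integral_const_mul]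
      rfl)
    (integrable_bathKernel j)
    (fun f g hfg => by
      have h : (fun p : ℝ × (Vel ι × ℝ) => f p.2.1)
          =ᵐ[(volume.restrict (Ioc 0 (2 * π))).prod volume] fun p => g p.2.1 :=
        (Measure.quasiMeasurePreserving_fst.comp
          Measure.quasiMeasurePreserving_snd).ae_eq_comp hfg
      filter_upwards [(measurePreserving_bathMap j _).quasiMeasurePreserving.ae_eq_comp h]
        with p hp
      simp only [Function.comp] at hp
      rw [hp])
    (fun f g => by ext p; simp [mul_add])
    (fun c f => by ext p; simp only [Pi.smul_apply, smul_eq_mul]; ring)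
    (fun f hf => by
      have hmp := measurePreserving_bathMap j (volume.restrict (Ioc 0 (2 * π))) (ι := ι)
      have hi := (integrable_bath (ρ := volume.restrict (Ioc 0 (2 * π))) hf).norm
      have h1 : ∫ p, ‖gauss (bathMap j p).2.2 * f (bathMap j p).2.1‖
            ∂(((volume.restrict (Ioc 0 (2 * π))).prod volume).prod volume)
          = ∫ p : ℝ × (Vel ι × ℝ), ‖gauss p.2.2 * f p.2.1‖
            ∂((volume.restrict (Ioc 0 (2 * π))).prod volume) := by
        conv_rhs => rw [← hmp.map_eq]
        rw [integral_map hmp.aemeasurable (by rw [hmp.map_eq]; exact hi.1)]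
      have h2 : ∫ q : Vel ι × ℝ, ‖gauss q.2 * f q.1‖ = ∫ x, ‖f x‖ := by
        have : ∀ q : Vel ι × ℝ, ‖gauss q.2 * f q.1‖ = ‖f q.1‖ * gauss q.2 := fun q => by
          rw [norm_mul, Real.norm_of_nonneg (gauss_nonneg _), mul_comm]
        simp_rw [this]
        refine (integral_prod_mul (fun x : Vel ι => ‖f x‖) gauss).trans ?_
        rw [integral_gauss, mul_one]
      have h3 : ∀ p, ‖(2 * π)⁻¹ * (gauss (bathMap j p).2.2 * f (bathMap j p).2.1)‖
          = (2 * π)⁻¹ * ‖gauss (bathMap j p).2.2 * f (bathMap j p).2.1‖ := fun p => by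
        rw [norm_mul, norm_inv, Real.norm_of_nonneg Real.two_pi_pos.le]
      simp_rw [h3]
      rw [integral_const_mul, h1, integral_prod _ hi]
      simp only [h2, integral_const, smul_eq_mul, measureReal_restrict_apply_univ,
        Real.volume_real_Ioc_of_le Real.two_pi_pos.le, sub_zero]
      rw [← mul_assoc, inv_mul_cancel₀ Real.two_pi_pos.ne', one_mul])

lemma coeFn_collisionOp (a b : ι) (hab : a ≠ b) (f : Vel ι →₁[volume] ℝ) :
    collisionOp a b hab f =ᵐ[volume] collisionMean a b f :=
  coeFn_toL1Op (ρ := volume.restrict (Ioc 0 (2 * π))) _ _ _ _ _ _ _ _ f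

lemma coeFn_thermostatOp (j : ι) (f : Vel ι →₁[volume] ℝ) :
    thermostatOp j f =ᵐ[volume] thermostatMean j f :=
  coeFn_toL1Op (ρ := (volume.restrict (Ioc 0 (2 * π))).prod (volume : Measure ℝ)) _ _ _ _ _ _ _ _ f

end Operators

/-! ### Generators and evolutions

The `M` particles of the system carry the labels `Sum.inl i`, the `N` particles of the reservoir
the labels `Sum.inr j`. -/

/-- States (`L¹` functions of all `M + N` velocities). -/
abbrev State (M N : ℕ) := Vel (Fin M ⊕ Fin N) →₁[volume] ℝ

/-- `L_S`: Kac collisions inside the system. -/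
def genS (M N : ℕ) (lamS : ℝ) : State M N →L[ℝ] State M N :=
  (lamS / ((M : ℝ) - 1)) • ∑ p : {p : Fin M × Fin M // p.1 < p.2},
    (collisionOp (Sum.inl p.1.1) (Sum.inl p.1.2) (Sum.inl_injective.ne p.2.ne) - 1)

/-- `L_R`: Kac collisions inside the reservoir. -/
def genR (M N : ℕ) (lamR : ℝ) : State M N →L[ℝ] State M N :=
  (lamR / ((N : ℝ) - 1)) • ∑ p : {p : Fin N × Fin N // p.1 < p.2},
    (collisionOp (Sum.inr p.1.1) (Sum.inr p.1.2) (Sum.inr_injective.ne p.2.ne) - 1)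

/-- `L_I`: collisions between system and reservoir. -/
def genI (M N : ℕ) (mu : ℝ) : State M N →L[ℝ] State M N :=
  (mu / (N : ℝ)) • ∑ i : Fin M, ∑ j : Fin N,
    (collisionOp (Sum.inl i) (Sum.inr j) Sum.inl_ne_inr - 1)

/-- `L_T`: collisions between the system and the Maxwellian thermostat. -/
def genT (M N : ℕ) (mu : ℝ) : State M N →L[ℝ] State M N :=
  mu • ∑ i : Fin M, (thermostatOp (Sum.inl i) - 1)

/-- Generator of the system in contact with the finite reservoir. -/
def genFinite (M N : ℕ) (lamS lamR mu : ℝ) : State M N →L[ℝ] State M N :=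
  genS M N lamS + genR M N lamR + genI M N mu

/-- Generator of the system in contact with the thermostat (the reservoir velocities are left
alone). -/
def genThermostat (M N : ℕ) (lamS mu : ℝ) : State M N →L[ℝ] State M N :=
  genS M N lamS + genT M N mu

/-- System velocities. -/
def sysPart {M N : ℕ} (x : Vel (Fin M ⊕ Fin N)) : Vel (Fin M) :=
  WithLp.toLp 2 fun i => x (Sum.inl i)

/-- Reservoir velocities. -/
def resPart {M N : ℕ} (x : Vel (Fin M ⊕ Fin N)) : Vel (Fin N) :=
  WithLp.toLp 2 fun j => x (Sum.inr j)

lemma integrable_maxwellian {ι : Type*} [Fintype ι] :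
    Integrable (maxwellian : Vel ι → ℝ) := by
  have h : Integrable (fun x : ι → ℝ => ∏ i, gauss (x i)) :=
    Integrable.fintype_prod fun _ => integrable_gauss
  exact (PiLp.volume_preserving_ofLp ι).integrable_comp_of_integrable h

lemma measurePreserving_split (M N : ℕ) :
    MeasurePreserving (fun x : Vel (Fin M ⊕ Fin N) => (sysPart x, resPart x)) volume volume := by
  have h1 := PiLp.volume_preserving_ofLp (Fin M ⊕ Fin N)
  have h2 := volume_measurePreserving_sumPiEquivProdPi (fun _ : Fin M ⊕ Fin N => ℝ)
  have h3 := (PiLp.volume_preserving_toLp (Fin M)).prod (PiLp.volume_preserving_toLp (Fin N))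
  exact h3.comp (h2.comp h1)

lemma integrable_initial {M N : ℕ} {l : Vel (Fin M) → ℝ} (hl : Integrable l) :
    Integrable (fun x : Vel (Fin M ⊕ Fin N) => l (sysPart x) * maxwellian (resPart x)) :=
  (measurePreserving_split M N).integrable_comp_of_integrable
    (g := fun p : Vel (Fin M) × Vel (Fin N) => l p.1 * maxwellian p.2)
    (hl.mul_prod integrable_maxwellian)

/-- The initial state `f₀(v, w) = l(v) Γ_N(w)`. -/
def initialState {M : ℕ} (N : ℕ) {l : Vel (Fin M) → ℝ} (hl : Integrable l) : State M N :=
  (integrable_initial hl).toL1 _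

/-- The state at time `t` of the system in contact with the finite reservoir. -/
def finiteEvolution {M N : ℕ} (lamS lamR mu t : ℝ) (f : State M N) : State M N :=
  NormedSpace.exp (t • genFinite M N lamS lamR mu) f

/-- The state at time `t` of the system in contact with the thermostat. -/
def thermostatEvolution {M N : ℕ} (lamS mu t : ℝ) (f : State M N) : State M N :=
  NormedSpace.exp (t • genThermostat M N lamS mu) f

/-! ### The Gabetta-Toscani-Wennberg distance -/

/-- `d₂(f, g) = sup_{ξ ≠ 0} |f̂(ξ) - ĝ(ξ)| / |ξ|²` in `[0, ∞]`, where
`f̂(ξ) = ∫ exp (-2πi⟨ξ, v⟩) f(v) dv`. -/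
def gtwDist {ι : Type*} [Fintype ι] (f g : Vel ι → ℝ) : ℝ≥0∞ :=
  ⨆ (ξ : Vel ι) (_ : ξ ≠ 0),
    ENNReal.ofReal (‖𝓕 (fun v => (f v : ℂ)) ξ - 𝓕 (fun v => (g v : ℂ)) ξ‖ / ‖ξ‖ ^ 2)

end KacReservoir

end

open KacReservoir

/-!
By Duhamel's formula the Fourier transform of `e^{tL̃} f₀ - e^{tL} f₀` at `ζ` is the integral over
`s ∈ [0, t]` of that of `e^{(t-s)L} (L̃ - L) e^{sL̃} f₀`. Collisions act on Fourier transforms by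
averaging over rotations of `ζ`, so `e^{(t-s)L}` does not increase bounds of the form `C‖ζ‖²`, and
it remains to estimate `(L̃ - L) e^{sL̃} f₀`.

The thermostated evolution leaves the reservoir Maxwellian and independent of the system, contracts
the deviation of the system from equilibrium by `e^{-μs/2}` in `d₂`, and propagates the moments of
order four. The Fourier transform of the deviation, as a function `κ` of a single system frequency,
therefore grows at most quadratically with a small factor `D` and has a fourth derivative of order
`L`. Interpolation gives a second derivative of order `√(D L)`, whence the square root in the
theorem and the rate `μ/4`.

At a system frequency `x` and a reservoir frequency `y`, the thermostat and a collision yield the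
averages of `κ ⊗ gauss` over the circles of radii `|x|` and `√(x² + y²)`, the former multiplied by
`gauss y`. Averaging discards the odd part of `κ`, which makes the difference of order `√(D L)`
times `y²` plus a multiple of `1 - gauss y`. Weighted with the Maxwellian of the other reservoir
particles, these errors sum over the reservoir to a bound independent of `N`, because
`∑ⱼ (1 - pⱼ) ∏_{k ≠ j} pₖ ≤ 1` for probabilities `pⱼ`; so the factor `1/N` of the coupling survives.
-/

noncomputable section

namespace KacReservoir

/-! ### Extended seminorms along one-parameter semigroups -/

section LscSeminorm

variable {E : Type*} [NormedAddCommGroup E] [NormedSpace ℝ E]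

/-- A lower semicontinuous seminorm with values in `[0, ∞]`. Suprema of weighted Fourier
coefficients and moments are of this kind; they are infinite for most states in `L¹`. -/
structure LscSeminorm (E : Type*) [NormedAddCommGroup E] [NormedSpace ℝ E] where
  /-- The underlying function. -/
  toFun : E → ℝ≥0∞
  add_le' : ∀ x y, toFun (x + y) ≤ toFun x + toFun y
  smul_le' : ∀ (c : ℝ) x, toFun (c • x) ≤ ‖c‖ₑ * toFun x
  lowerSemicontinuous' : LowerSemicontinuous toFun

namespace LscSeminorm

instance : CoeFun (LscSeminorm E) fun _ => E → ℝ≥0∞ := ⟨LscSeminorm.toFun⟩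

variable (p : LscSeminorm E) {P Q A B : E →L[ℝ] E} {q r ω ν : ℝ}

lemma add_le (x y : E) : p (x + y) ≤ p x + p y := p.add_le' x y

lemma smul_le {c : ℝ} (hc : 0 ≤ c) (x : E) : p (c • x) ≤ ENNReal.ofReal c * p x :=
  (p.smul_le' c x).trans_eq (by rw [Real.enorm_of_nonneg hc])

lemma sum_le {α : Type*} (s : Finset α) (u : α → E) : p (∑ i ∈ s, u i) ≤ ∑ i ∈ s, p (u i) := by
  classical
  induction s using Finset.induction_on with
  | empty => simpa using p.smul_le le_rfl 0
  | insert i s hi ih =>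
    rw [Finset.sum_insert hi, Finset.sum_insert hi]
    exact (p.add_le _ _).trans (by gcongr)

/-- `Q` enlarges the seminorm by a factor of at most `q`. -/
def OpLe (Q : E →L[ℝ] E) (q : ℝ) : Prop := ∀ x, p (Q x) ≤ ENNReal.ofReal q * p x

variable {p}

lemma OpLe.of_forall_le_ofReal (hq : 0 < q)
    (h : ∀ x C, 0 ≤ C → p x ≤ ENNReal.ofReal C → p (Q x) ≤ ENNReal.ofReal (q * C)) :
    p.OpLe Q q := by
  intro x
  rcases eq_or_ne (p x) ⊤ with hx | hx
  · rw [hx, ENNReal.mul_top (by simpa using hq)]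
    exact le_top
  · have hle := h x (p x).toReal ENNReal.toReal_nonneg (ENNReal.ofReal_toReal hx).ge
    rwa [ENNReal.ofReal_mul hq.le, ENNReal.ofReal_toReal hx] at hle

lemma OpLe.add (hq : 0 ≤ q) (hr : 0 ≤ r) (hP : p.OpLe P q) (hQ : p.OpLe Q r) :
    p.OpLe (P + Q) (q + r) := fun x => by
  rw [ENNReal.ofReal_add hq hr, add_mul]
  exact (p.add_le _ _).trans (add_le_add (hP x) (hQ x))

lemma OpLe.smul {c : ℝ} (hc : 0 ≤ c) (hQ : p.OpLe Q q) : p.OpLe (c • Q) (c * q) := fun x => by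
  rw [ENNReal.ofReal_mul hc, mul_assoc]
  exact (p.smul_le hc (Q x)).trans (by gcongr; exact hQ x)

lemma OpLe.sum {α : Type*} {s : Finset α} {T : α → E →L[ℝ] E}
    (hT : ∀ i ∈ s, p.OpLe (T i) 1) : p.OpLe (∑ i ∈ s, T i) s.card := fun x => by
  rw [sum_apply]
  refine (p.sum_le s _).trans ((Finset.sum_le_card_nsmul s _ (p x) fun i hi => ?_).trans_eq ?_)
  · simpa using hT i hi x
  · simp

lemma OpLe.pow (hq : 0 ≤ q) (hQ : p.OpLe Q q) (n : ℕ) : p.OpLe (Q ^ n) (q ^ n) := by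
  induction n with
  | zero => intro x; simp
  | succ n ih =>
    intro x
    rw [pow_succ', pow_succ', ENNReal.ofReal_mul hq, mul_assoc]
    exact (hQ _).trans (by gcongr; exact ih x)

lemma OpLe.exp [CompleteSpace E] (hq : 0 ≤ q) (hQ : p.OpLe Q q) :
    p.OpLe (NormedSpace.exp Q) (Real.exp q) := by
  intro x
  have hsum : HasSum (fun n : ℕ => (n.factorial : ℝ)⁻¹ • (Q ^ n) x) (NormedSpace.exp Q x) := by
    simpa using (NormedSpace.exp_series_hasSum_exp' (𝕂 := ℝ) Q).mapL
      (ContinuousLinearMap.apply ℝ E x)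
  refine (p.lowerSemicontinuous'.isClosed_preimage _).mem_of_tendsto hsum.tendsto_sum_nat
    (Filter.Eventually.of_forall fun n => ?_)
  calc p (∑ k ∈ Finset.range n, (k.factorial : ℝ)⁻¹ • (Q ^ k) x)
      ≤ ∑ k ∈ Finset.range n, ENNReal.ofReal (q ^ k / k.factorial) * p x := by
        refine (p.sum_le _ _).trans (Finset.sum_le_sum fun k _ => ?_)
        rw [div_eq_inv_mul]
        exact (hQ.pow hq k).smul (by positivity) x
    _ = ENNReal.ofReal (∑ k ∈ Finset.range n, q ^ k / k.factorial) * p x := by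
        rw [ENNReal.ofReal_sum_of_nonneg fun k _ => by positivity, Finset.sum_mul]
    _ ≤ ENNReal.ofReal (Real.exp q) * p x := by
        gcongr
        exact Real.sum_le_exp_of_nonneg hq n

variable (p)

/-- The generator `A` lets the seminorm grow at a rate of at most `ω`, in the strong sense that
`A` is an operator `A + c` of bound `c + ω` minus a multiple `c` of the identity. This is how the
generators `∑ (P i - 1)` of jump processes arise. -/
def GrowthLe (A : E →L[ℝ] E) (ω : ℝ) : Prop := ∃ c, 0 ≤ c + ω ∧ p.OpLe (A + c • 1) (c + ω)

variable {p}

lemma OpLe.growthLe_sum_sub_one {α : Type*} [Fintype α] {T : α → E →L[ℝ] E} (hq : 0 ≤ q)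
    (hT : p.OpLe (∑ i, T i) q) : p.GrowthLe (∑ i, (T i - 1)) (q - Fintype.card α) := by
  refine ⟨Fintype.card α, by linarith, ?_⟩
  have hcard : ∑ i, (T i - 1) + (Fintype.card α : ℝ) • (1 : E →L[ℝ] E) = ∑ i, T i := by
    rw [Finset.sum_sub_distrib, Finset.sum_const, Finset.card_univ, Nat.cast_smul_eq_nsmul,
      sub_add_cancel]
  rwa [hcard, add_sub_cancel]

lemma growthLe_sum_sub_one {α : Type*} [Fintype α] {T : α → E →L[ℝ] E}
    (hT : ∀ i, p.OpLe (T i) 1) : p.GrowthLe (∑ i, (T i - 1)) 0 := by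
  have hsum : p.OpLe (∑ i, T i) (Fintype.card α) := OpLe.sum fun i _ => hT i
  simpa using hsum.growthLe_sum_sub_one (Nat.cast_nonneg _)

lemma GrowthLe.add (hA : p.GrowthLe A ω) (hB : p.GrowthLe B ν) : p.GrowthLe (A + B) (ω + ν) := by
  obtain ⟨a, ha, hA⟩ := hA
  obtain ⟨b, hb, hB⟩ := hB
  refine ⟨a + b, by linarith, ?_⟩
  rw [show A + B + (a + b) • (1 : E →L[ℝ] E) = (A + a • 1) + (B + b • 1) by module,
    show a + b + (ω + ν) = (a + ω) + (b + ν) by ring]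
  exact hA.add ha hb hB

lemma GrowthLe.smul {c : ℝ} (hc : 0 ≤ c) (hA : p.GrowthLe A ω) : p.GrowthLe (c • A) (c * ω) := by
  obtain ⟨a, ha, hA⟩ := hA
  refine ⟨c * a, by rw [← mul_add]; positivity, ?_⟩
  rw [mul_smul, ← smul_add, ← mul_add]
  exact hA.smul hc

lemma GrowthLe.exp_smul [CompleteSpace E] {t : ℝ} (ht : 0 ≤ t) (hA : p.GrowthLe A ω) :
    p.OpLe (NormedSpace.exp (t • A)) (Real.exp (t * ω)) := by
  obtain ⟨c, hc, hQ⟩ := hA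
  let _ : NormedAlgebra ℚ (E →L[ℝ] E) := NormedAlgebra.restrictScalars ℚ ℝ (E →L[ℝ] E)
  have hsplit : t • A = algebraMap ℝ (E →L[ℝ] E) (-(t * c)) + t • (A + c • 1) := by
    rw [Algebra.algebraMap_eq_smul_one]
    module
  have hexp : NormedSpace.exp (t • A)
      = Real.exp (-(t * c)) • NormedSpace.exp (t • (A + c • 1)) := by
    rw [hsplit, NormedSpace.exp_add_of_commute (Algebra.commutes _ _),
      ← NormedSpace.algebraMap_exp_comm, ← Real.exp_eq_exp_ℝ,
      Algebra.algebraMap_eq_smul_one, smul_mul_assoc, one_mul]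
  have hrate : Real.exp (t * ω) = Real.exp (-(t * c)) * Real.exp (t * (c + ω)) := by
    rw [← Real.exp_add]
    ring_nf
  rw [hexp, hrate]
  exact ((hQ.smul ht).exp (mul_nonneg ht hc)).smul (Real.exp_pos _).le

end LscSeminorm

/-- The seminorm `sup_i |ψ i x| / w i` of a family of continuous linear maps. With the conventions
`0 / 0 = 0` and `a / 0 = ∞`, it is at most `C` exactly if `|ψ i x| ≤ C w i` for all `i`. -/
def functionalSeminorm {F : Type*} [NormedAddCommGroup F] [NormedSpace ℝ F] {α : Type*}
    (ψ : α → E →L[ℝ] F) (w : α → ℝ) : LscSeminorm E where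
  toFun x := ⨆ i, ‖ψ i x‖ₑ / ENNReal.ofReal (w i)
  add_le' x y := iSup_le fun i => by
    refine le_trans ?_ (add_le_add (le_iSup (fun i => ‖ψ i x‖ₑ / ENNReal.ofReal (w i)) i)
      (le_iSup (fun i => ‖ψ i y‖ₑ / ENNReal.ofReal (w i)) i))
    rw [map_add, ← ENNReal.add_div]
    gcongr
    exact enorm_add_le _ _
  smul_le' c x := iSup_le fun i => by
    rw [map_smul, enorm_smul, mul_div_assoc]
    gcongr
    exact le_iSup (fun i => ‖ψ i x‖ₑ / ENNReal.ofReal (w i)) i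
  lowerSemicontinuous' := by
    refine lowerSemicontinuous_iSup fun i => lowerSemicontinuous_iff_isClosed_preimage.2 fun C => ?_
    rcases eq_or_ne C ⊤ with rfl | hC
    · simp
    · have hclosed : IsClosed {x | ‖ψ i x‖ₑ ≤ C * ENNReal.ofReal (w i)} :=
        isClosed_le (by fun_prop) continuous_const
      convert hclosed using 1
      ext x
      exact ENNReal.div_le_iff_le_mul (.inr hC) (.inl ENNReal.ofReal_ne_top)

lemma functionalSeminorm_le_ofReal_iff {F : Type*} [NormedAddCommGroup F] [NormedSpace ℝ F]
    {α : Type*} {ψ : α → E →L[ℝ] F} {w : α → ℝ} (hw : ∀ i, 0 ≤ w i) {x : E} {C : ℝ} (hC : 0 ≤ C) :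
    functionalSeminorm ψ w x ≤ ENNReal.ofReal C ↔ ∀ i, ‖ψ i x‖ ≤ C * w i := by
  refine iSup_le_iff.trans (forall_congr' fun i => ?_)
  rw [ENNReal.div_le_iff_le_mul (.inr ENNReal.ofReal_ne_top) (.inl ENNReal.ofReal_ne_top),
    ← ENNReal.ofReal_mul hC, ← ofReal_norm,
    ENNReal.ofReal_le_ofReal_iff (mul_nonneg hC (hw i))]

end LscSeminorm

section WeightSeminorm

variable {X : Type*} [MeasurableSpace X] {μ : Measure X}

lemma aemeasurable_ofReal_mul_enorm {W : X → ℝ} (hW : Measurable W) (f : X →₁[μ] ℝ) :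
    AEMeasurable (fun x => ENNReal.ofReal (W x) * ‖f x‖ₑ) μ :=
  hW.ennreal_ofReal.aemeasurable.mul (Lp.aestronglyMeasurable f).enorm

lemma lowerSemicontinuous_lintegral_ofReal_mul_enorm {W : X → ℝ} (hW : Measurable W) :
    LowerSemicontinuous fun f : X →₁[μ] ℝ => ∫⁻ x, ENNReal.ofReal (W x) * ‖f x‖ₑ ∂μ := by
  refine lowerSemicontinuous_iff_isClosed_preimage.2 fun C => IsSeqClosed.isClosed ?_
  intro u f hu hf
  obtain ⟨ns, -, hns⟩ := (tendstoInMeasure_of_tendsto_Lp hf).exists_seq_tendsto_ae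
  have hlim : ∀ᵐ x ∂μ, ENNReal.ofReal (W x) * ‖f x‖ₑ
      = Filter.liminf (fun n => ENNReal.ofReal (W x) * ‖u (ns n) x‖ₑ) Filter.atTop := by
    filter_upwards [hns] with x hx
    exact (ENNReal.Tendsto.const_mul hx.enorm (Or.inr ENNReal.ofReal_ne_top)).liminf_eq.symm
  rw [mem_preimage, lintegral_congr_ae hlim]
  refine (lintegral_liminf_le' fun n => aemeasurable_ofReal_mul_enorm hW _).trans ?_
  refine Filter.liminf_le_of_le (by isBoundedDefault) fun b hb => ?_
  obtain ⟨n, hn⟩ := hb.exists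
  exact hn.trans (hu (ns n))

/-- The seminorm `sup_i ∫ W i |f|` on `L¹` of a family of weights. Negative values of the weights
count as zero. -/
def weightSeminorm (μ : Measure X) {α : Type*} (W : α → X → ℝ) (hW : ∀ i, Measurable (W i)) :
    LscSeminorm (X →₁[μ] ℝ) where
  toFun f := ⨆ i, ∫⁻ x, ENNReal.ofReal (W i x) * ‖f x‖ₑ ∂μ
  add_le' f g := iSup_le fun i => by
    refine le_trans ?_ (add_le_add
      (le_iSup (fun i => ∫⁻ x, ENNReal.ofReal (W i x) * ‖f x‖ₑ ∂μ) i)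
      (le_iSup (fun i => ∫⁻ x, ENNReal.ofReal (W i x) * ‖g x‖ₑ ∂μ) i))
    rw [← lintegral_add_left' (aemeasurable_ofReal_mul_enorm (hW i) f)]
    refine lintegral_mono_ae ?_
    filter_upwards [Lp.coeFn_add f g] with x hx
    rw [hx, Pi.add_apply, ← mul_add]
    gcongr
    exact enorm_add_le _ _
  smul_le' c f := iSup_le fun i => by
    refine le_trans (le_of_eq ?_) (mul_le_mul_right
      (le_iSup (fun i => ∫⁻ x, ENNReal.ofReal (W i x) * ‖f x‖ₑ ∂μ) i) _)
    rw [← lintegral_const_mul'' _ (aemeasurable_ofReal_mul_enorm (hW i) f)]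
    refine lintegral_congr_ae ?_
    filter_upwards [Lp.coeFn_smul c f] with x hx
    rw [hx, Pi.smul_apply, enorm_smul]
    exact mul_left_comm _ _ _
  lowerSemicontinuous' :=
    lowerSemicontinuous_iSup fun i => lowerSemicontinuous_lintegral_ofReal_mul_enorm (hW i)

lemma weightSeminorm_le_iff {α : Type*} {W : α → X → ℝ} {hW : ∀ i, Measurable (W i)}
    {f : X →₁[μ] ℝ} {C : ℝ≥0∞} :
    weightSeminorm μ W hW f ≤ C ↔ ∀ i, ∫⁻ x, ENNReal.ofReal (W i x) * ‖f x‖ₑ ∂μ ≤ C :=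
  iSup_le_iff

lemma lintegral_le_weightSeminorm_of_mem_convexHull {α : Type*} {W : α → X → ℝ}
    (hW : ∀ i, Measurable (W i)) {V : X → ℝ} (hV : V ∈ convexHull ℝ (range W)) (f : X →₁[μ] ℝ) :
    ∫⁻ x, ENNReal.ofReal (V x) * ‖f x‖ₑ ∂μ ≤ weightSeminorm μ W hW f := by
  let s : Set (X → ℝ) := {V | Measurable V ∧
    ∫⁻ x, ENNReal.ofReal (V x) * ‖f x‖ₑ ∂μ ≤ weightSeminorm μ W hW f}
  have hs : Convex ℝ s := by
    rintro V ⟨hV, hV_le⟩ U ⟨hU, hU_le⟩ a b ha hb hab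
    refine ⟨(hV.const_smul a).add (hU.const_smul b), ?_⟩
    calc ∫⁻ x, ENNReal.ofReal (a * V x + b * U x) * ‖f x‖ₑ ∂μ
        ≤ ∫⁻ x, ENNReal.ofReal a * (ENNReal.ofReal (V x) * ‖f x‖ₑ)
            + ENNReal.ofReal b * (ENNReal.ofReal (U x) * ‖f x‖ₑ) ∂μ := by
          refine lintegral_mono fun x => ?_
          rw [← mul_assoc, ← mul_assoc, ← add_mul, ← ENNReal.ofReal_mul ha,
            ← ENNReal.ofReal_mul hb]
          gcongr
          exact ENNReal.ofReal_add_le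
      _ = ENNReal.ofReal a * ∫⁻ x, ENNReal.ofReal (V x) * ‖f x‖ₑ ∂μ
            + ENNReal.ofReal b * ∫⁻ x, ENNReal.ofReal (U x) * ‖f x‖ₑ ∂μ := by
          rw [lintegral_add_left' ((aemeasurable_ofReal_mul_enorm hV f).const_mul _),
            lintegral_const_mul'' _ (aemeasurable_ofReal_mul_enorm hV f),
            lintegral_const_mul'' _ (aemeasurable_ofReal_mul_enorm hU f)]
      _ ≤ ENNReal.ofReal a * weightSeminorm μ W hW f
            + ENNReal.ofReal b * weightSeminorm μ W hW f := by gcongr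
      _ = weightSeminorm μ W hW f := by
          rw [← add_mul, ← ENNReal.ofReal_add ha hb, hab, ENNReal.ofReal_one, one_mul]
  have hrange : range W ⊆ s := range_subset_iff.2 fun i =>
    ⟨hW i, weightSeminorm_le_iff.1 le_rfl i⟩
  exact (convexHull_min hrange hs hV).2

end WeightSeminorm

/-! ### Duhamel's formula -/

section Duhamel

variable {E : Type*} [NormedAddCommGroup E] [NormedSpace ℝ E] [CompleteSpace E]

lemma hasDerivAt_exp_sub_smul_mul_exp_smul (A B : E →L[ℝ] E) (t s : ℝ) :
    HasDerivAt (fun s : ℝ => NormedSpace.exp ((t - s) • B) * NormedSpace.exp (s • A))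
      (NormedSpace.exp ((t - s) • B) * (A - B) * NormedSpace.exp (s • A)) s := by
  have hA : HasDerivAt (fun s : ℝ => NormedSpace.exp (s • A)) (A * NormedSpace.exp (s • A)) s :=
    hasDerivAt_exp_smul_const' A s
  have hB : HasDerivAt (fun s : ℝ => NormedSpace.exp ((t - s) • B))
      ((-1 : ℝ) • (NormedSpace.exp ((t - s) • B) * B)) s :=
    (hasDerivAt_exp_smul_const B (t - s)).scomp s ((hasDerivAt_id s).const_sub t)
  refine (hB.mul hA).congr_deriv ?_
  rw [neg_one_smul]
  noncomm_ring

lemma hasDerivAt_const_div_mul_one_sub_exp (c : ℝ) {k : ℝ} (hk : k ≠ 0) (s : ℝ) :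
    HasDerivAt (fun s => c / k * (1 - Real.exp (-k * s))) (c * Real.exp (-k * s)) s := by
  have hexp : HasDerivAt (fun s => Real.exp (-k * s)) (Real.exp (-k * s) * (-k * 1)) s :=
    ((hasDerivAt_id s).const_mul (-k)).exp
  refine ((hexp.const_sub 1).const_mul (c / k)).congr_deriv ?_
  field_simp

lemma norm_exp_smul_sub_exp_smul_le {F : Type*} [NormedAddCommGroup F] [NormedSpace ℝ F]
    (A B : E →L[ℝ] E) (χ : E →L[ℝ] F) (x : E) {c k t : ℝ} (ht : 0 ≤ t) (hk : k ≠ 0)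
    (h : ∀ s ∈ Ico 0 t, ‖χ (NormedSpace.exp ((t - s) • B)
      (A (NormedSpace.exp (s • A) x) - B (NormedSpace.exp (s • A) x)))‖ ≤ c * Real.exp (-k * s)) :
    ‖χ (NormedSpace.exp (t • A) x) - χ (NormedSpace.exp (t • B) x)‖
      ≤ c / k * (1 - Real.exp (-k * t)) := by
  let U : ℝ → E →L[ℝ] E := fun s => NormedSpace.exp ((t - s) • B) * NormedSpace.exp (s • A)
  let V : ℝ → F := fun s => χ (U s x) - χ (U 0 x)
  have hV : ∀ s, HasDerivAt V (χ (NormedSpace.exp ((t - s) • B)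
      (A (NormedSpace.exp (s • A) x) - B (NormedSpace.exp (s • A) x)))) s := fun s =>
    (χ.hasFDerivAt.comp_hasDerivAt s ((ContinuousLinearMap.apply ℝ E x).hasFDerivAt.comp_hasDerivAt
      s (hasDerivAt_exp_sub_smul_mul_exp_smul A B t s))).sub_const _
  have hbound := image_norm_le_of_norm_deriv_right_le_deriv_boundary (f := V) (a := 0) (b := t)
    (fun s _ => (hV s).continuousAt.continuousWithinAt) (fun s _ => (hV s).hasDerivWithinAt)
    (by simp [V]) (hasDerivAt_const_div_mul_one_sub_exp c hk) h (right_mem_Icc.2 ht)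
  simpa [V, U] using hbound

end Duhamel

/-! ### The one-particle Maxwellian -/

lemma continuous_gauss : Continuous gauss := by
  unfold gauss
  fun_prop

lemma continuous_ofReal_gauss_comp {g : ℝ → ℝ} (hg : Continuous g) :
    Continuous fun θ => (gauss (g θ) : ℂ) :=
  Complex.continuous_ofReal.comp (continuous_gauss.comp hg)

lemma hasDerivAt_gauss (x : ℝ) : HasDerivAt gauss (-2 * π * x * gauss x) x := by
  refine (((hasDerivAt_id x).pow 2).const_mul (-π)).exp.congr_deriv ?_
  simp only [gauss, id, Pi.pow_apply, Nat.cast_ofNat, Nat.add_one_sub_one, pow_one, mul_one]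
  ring

lemma gauss_neg (x : ℝ) : gauss (-x) = gauss x := by
  rw [gauss, neg_sq, gauss]

lemma gauss_le_one (x : ℝ) : gauss x ≤ 1 :=
  Real.exp_le_one_iff.2 (by nlinarith [Real.pi_pos, sq_nonneg x])

lemma norm_ofReal_gauss (x : ℝ) : ‖(gauss x : ℂ)‖ = gauss x := by
  rw [Complex.norm_real, Real.norm_of_nonneg (gauss_nonneg x)]

lemma gauss_le_inv_one_add (y : ℝ) : gauss y ≤ (1 + π * y ^ 2)⁻¹ := by
  rw [gauss, neg_mul, Real.exp_neg]
  exact inv_anti₀ (by positivity) (by linarith [Real.add_one_le_exp (π * y ^ 2)])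

lemma gauss_le_half {y : ℝ} (hy : 1 ≤ π * y ^ 2) : gauss y ≤ 1 / 2 := by
  refine (gauss_le_inv_one_add y).trans ?_
  rw [one_div]
  exact inv_anti₀ two_pos (by linarith)

lemma mul_sq_le_two_mul_one_sub_gauss {y : ℝ} (hy : π * y ^ 2 ≤ 1) :
    π * y ^ 2 ≤ 2 * (1 - gauss y) := by
  have hnonneg : 0 ≤ π * y ^ 2 := by positivity
  have hinv : (1 + π * y ^ 2)⁻¹ ≤ 1 - π * y ^ 2 / 2 := by
    rw [inv_le_iff_one_le_mul₀ (by linarith)]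
    nlinarith
  linarith [gauss_le_inv_one_add y]

lemma integrable_pow_mul_gauss (k : ℕ) : Integrable fun w : ℝ => w ^ k * gauss w := by
  have hk : (-1 : ℝ) < k := neg_one_lt_zero.trans_le k.cast_nonneg
  simpa only [gauss, Real.rpow_natCast] using integrable_rpow_mul_exp_neg_mul_sq Real.pi_pos hk

/-- Integration by parts. -/
lemma integral_pow_succ_mul_gauss (k : ℕ) :
    2 * π * ∫ w : ℝ, w ^ (k + 1) * gauss w = k * ∫ w : ℝ, w ^ (k - 1) * gauss w := by
  have hderiv : ∀ w : ℝ, HasDerivAt (fun w => w ^ k * gauss w)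
      (k * (w ^ (k - 1) * gauss w) - 2 * π * (w ^ (k + 1) * gauss w)) w := fun w =>
    ((hasDerivAt_pow k w).mul (hasDerivAt_gauss w)).congr_deriv (by ring)
  have hlow := (integrable_pow_mul_gauss (k - 1)).const_mul (k : ℝ)
  have hhigh := (integrable_pow_mul_gauss (k + 1)).const_mul (2 * π)
  have hzero := integral_eq_zero_of_hasDerivAt_of_integrable hderiv (hlow.sub hhigh)
    (integrable_pow_mul_gauss k)
  rw [integral_sub hlow hhigh, integral_const_mul, integral_const_mul] at hzero
  linarith

lemma integral_id_mul_gauss : ∫ w : ℝ, w * gauss w = 0 := by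
  simpa [Real.pi_ne_zero] using integral_pow_succ_mul_gauss 0

lemma integral_sq_mul_gauss : ∫ w : ℝ, w ^ 2 * gauss w = (2 * π)⁻¹ :=
  eq_inv_of_mul_eq_one_right (by simpa [integral_gauss] using integral_pow_succ_mul_gauss 1)

lemma integral_cube_mul_gauss : ∫ w : ℝ, w ^ 3 * gauss w = 0 := by
  simpa [Real.pi_ne_zero, integral_id_mul_gauss] using integral_pow_succ_mul_gauss 2

lemma integral_fourth_mul_gauss : ∫ w : ℝ, w ^ 4 * gauss w = 3 * (2 * π)⁻¹ ^ 2 := by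
  have hstep : 2 * π * ∫ w : ℝ, w ^ 4 * gauss w = 3 * (2 * π)⁻¹ := by
    simpa [integral_sq_mul_gauss] using integral_pow_succ_mul_gauss 3
  rw [sq, mul_left_comm, ← hstep, inv_mul_cancel_left₀ Real.two_pi_pos.ne']

/-! ### Averages over the scattering angle -/

section AngleMean

variable {E : Type*} [NormedAddCommGroup E] [NormedSpace ℝ E]

/-- The mean of a function over the scattering angle. -/
def angleMean (F : ℝ → E) : E := (2 * π)⁻¹ • ∫ θ in (0 : ℝ)..2 * π, F θ

lemma angleMean_const [CompleteSpace E] (c : E) : angleMean (fun _ => c) = c := by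
  rw [angleMean, intervalIntegral.integral_const, sub_zero, inv_smul_smul₀ Real.two_pi_pos.ne']

lemma angleMean_add {F G : ℝ → E} (hF : Continuous F) (hG : Continuous G) :
    angleMean (fun θ => F θ + G θ) = angleMean F + angleMean G := by
  rw [angleMean, intervalIntegral.integral_add (hF.intervalIntegrable _ _)
    (hG.intervalIntegrable _ _), smul_add, angleMean, angleMean]

lemma angleMean_sub {F G : ℝ → E} (hF : Continuous F) (hG : Continuous G) :
    angleMean (fun θ => F θ - G θ) = angleMean F - angleMean G := by
  rw [angleMean, intervalIntegral.integral_sub (hF.intervalIntegrable _ _)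
    (hG.intervalIntegrable _ _), smul_sub, angleMean, angleMean]

lemma angleMean_const_mul {𝕜 : Type*} [RCLike 𝕜] (c : 𝕜) (F : ℝ → 𝕜) :
    angleMean (fun θ => c * F θ) = c * angleMean F := by
  rw [angleMean, intervalIntegral.integral_const_mul, angleMean, mul_smul_comm]

lemma angleMean_mul_const {𝕜 : Type*} [RCLike 𝕜] (F : ℝ → 𝕜) (c : 𝕜) :
    angleMean (fun θ => F θ * c) = angleMean F * c := by
  rw [angleMean, intervalIntegral.integral_mul_const, angleMean, smul_mul_assoc]

lemma norm_angleMean_le_angleMean {F : ℝ → E} {B : ℝ → ℝ} (hB : Continuous B)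
    (hFB : ∀ θ, ‖F θ‖ ≤ B θ) : ‖angleMean F‖ ≤ angleMean B := by
  rw [angleMean, norm_smul, Real.norm_of_nonneg (inv_nonneg.2 Real.two_pi_pos.le), angleMean,
    smul_eq_mul]
  gcongr
  exact intervalIntegral.norm_integral_le_of_norm_le Real.two_pi_pos.le
    (Filter.Eventually.of_forall fun θ _ => hFB θ) (hB.intervalIntegrable _ _)

lemma norm_angleMean_le {F : ℝ → E} {C : ℝ} (hF : ∀ θ, ‖F θ‖ ≤ C) : ‖angleMean F‖ ≤ C :=
  (norm_angleMean_le_angleMean continuous_const hF).trans_eq (angleMean_const C)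

lemma angleMean_comp_add_right {F : ℝ → E} (hF : Function.Periodic F (2 * π)) (φ : ℝ) :
    angleMean (fun θ => F (θ + φ)) = angleMean F := by
  rw [angleMean, angleMean, intervalIntegral.integral_comp_add_right, zero_add,
    add_comm (2 * π), hF.intervalIntegral_add_eq φ 0, zero_add]

lemma angleMean_eq_of_hasDerivAt {F f : ℝ → ℝ} (hf : Continuous f)
    (hF : ∀ θ, HasDerivAt F (f θ) θ) : angleMean f = (F (2 * π) - F 0) / (2 * π) := by
  rw [angleMean, intervalIntegral.integral_eq_sub_of_hasDerivAt (fun θ _ => hF θ)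
    (hf.intervalIntegrable _ _), smul_eq_mul, inv_mul_eq_div]

lemma angleMean_quadratic (α β γ : ℝ) :
    angleMean (fun θ => α * Real.cos θ ^ 2 + β * (Real.cos θ * Real.sin θ) + γ * Real.sin θ ^ 2)
      = (α + γ) / 2 := by
  have hderiv : ∀ θ : ℝ, HasDerivAt (fun θ => α * (θ / 2 + Real.sin θ * Real.cos θ / 2)
      + β * (Real.sin θ ^ 2 / 2) + γ * (θ / 2 - Real.sin θ * Real.cos θ / 2))
      (α * Real.cos θ ^ 2 + β * (Real.cos θ * Real.sin θ) + γ * Real.sin θ ^ 2) θ := fun θ => by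
    have hsin := Real.hasDerivAt_sin θ
    have hcos := Real.hasDerivAt_cos θ
    have hid := hasDerivAt_id θ
    refine ((((hid.div_const 2).add ((hsin.mul hcos).div_const 2)).const_mul α).add
      (((hsin.pow 2).div_const 2).const_mul β) |>.add
      (((hid.div_const 2).sub ((hsin.mul hcos).div_const 2)).const_mul γ)).congr_deriv ?_
    simp only [Nat.cast_ofNat, Nat.add_one_sub_one, pow_one]
    linear_combination (-γ / 2 - α / 2) * Real.sin_sq_add_cos_sq θ
  rw [angleMean_eq_of_hasDerivAt (by fun_prop) hderiv]
  simp only [Real.sin_two_pi, Real.cos_two_pi, Real.sin_zero, Real.cos_zero]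
  field_simp
  ring

lemma hasDerivAt_quartic_primitive (α β γ δ ε θ : ℝ) :
    HasDerivAt (fun θ =>
      α * (3 / 8 * θ + 3 / 8 * (Real.sin θ * Real.cos θ) + 1 / 4 * (Real.sin θ * Real.cos θ ^ 3))
      + β * (-1 / 4 * Real.cos θ ^ 4)
      + γ * (1 / 8 * θ - 1 / 8 * (Real.sin θ * Real.cos θ ^ 3 - Real.sin θ ^ 3 * Real.cos θ))
      + δ * (1 / 4 * Real.sin θ ^ 4)
      + ε * (3 / 8 * θ - 3 / 8 * (Real.sin θ * Real.cos θ)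
        - 1 / 4 * (Real.sin θ ^ 3 * Real.cos θ)))
      (α * Real.cos θ ^ 4 + β * (Real.cos θ ^ 3 * Real.sin θ)
      + γ * (Real.cos θ ^ 2 * Real.sin θ ^ 2) + δ * (Real.cos θ * Real.sin θ ^ 3)
      + ε * Real.sin θ ^ 4) θ := by
  have hsin := Real.hasDerivAt_sin θ
  have hcos := Real.hasDerivAt_cos θ
  have hid := hasDerivAt_id θ
  refine (((((((hid.const_mul (3 / 8)).add ((hsin.mul hcos).const_mul (3 / 8))).add
    ((hsin.mul (hcos.pow 3)).const_mul (1 / 4))).const_mul α).add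
    (((hcos.pow 4).const_mul (-1 / 4)).const_mul β)).add
    (((hid.const_mul (1 / 8)).sub (((hsin.mul (hcos.pow 3)).sub
      ((hsin.pow 3).mul hcos)).const_mul (1 / 8))).const_mul γ)).add
    (((hsin.pow 4).const_mul (1 / 4)).const_mul δ) |>.add
    ((((hid.const_mul (3 / 8)).sub ((hsin.mul hcos).const_mul (3 / 8))).sub
    (((hsin.pow 3).mul hcos).const_mul (1 / 4))).const_mul ε)).congr_deriv ?_
  have hsq : Real.sin θ ^ 2 = 1 - Real.cos θ ^ 2 := Real.sin_sq θ
  have hfourth : Real.sin θ ^ 4 = (1 - Real.cos θ ^ 2) ^ 2 := by rw [← hsq]; ring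
  simp only [Nat.cast_ofNat, Nat.add_one_sub_one, Pi.pow_apply]
  ring_nf
  simp only [hsq, hfourth]
  ring

lemma angleMean_quartic (α β γ δ ε : ℝ) :
    angleMean (fun θ => α * Real.cos θ ^ 4 + β * (Real.cos θ ^ 3 * Real.sin θ)
      + γ * (Real.cos θ ^ 2 * Real.sin θ ^ 2) + δ * (Real.cos θ * Real.sin θ ^ 3)
      + ε * Real.sin θ ^ 4) = (3 * α + γ + 3 * ε) / 8 := by
  rw [angleMean_eq_of_hasDerivAt (by fun_prop) (hasDerivAt_quartic_primitive α β γ δ ε)]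
  simp only [Real.sin_two_pi, Real.cos_two_pi, Real.sin_zero, Real.cos_zero]
  field_simp
  ring

end AngleMean

/-! ### Oscillatory integrals -/

section Oscillatory

variable {X : Type*}

/-- The `k`-th derivative in `z` of `exp (-2πi z a) F`. -/
def oscIntegrand (a : X → ℝ) (F : X → ℂ) (k : ℕ) (z : ℝ) (x : X) : ℂ :=
  ((-2 * π * a x : ℝ) * Complex.I) ^ k *
    Complex.exp ((z : ℂ) * ((-2 * π * a x : ℝ) * Complex.I)) * F x

/-- The `k`-th derivative in `z` of `∫ exp (-2πi z a) F`. -/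
def oscIntegral [MeasurableSpace X] (μ : Measure X) (a : X → ℝ) (F : X → ℂ) (k : ℕ) (z : ℝ) : ℂ :=
  ∫ x, oscIntegrand a F k z x ∂μ

lemma norm_exp_ofReal_mul_ofReal_mul_I (z b : ℝ) :
    ‖Complex.exp ((z : ℂ) * ((b : ℂ) * Complex.I))‖ = 1 := by
  rw [← mul_assoc, ← Complex.ofReal_mul, Complex.norm_exp_ofReal_mul_I]

lemma norm_oscIntegrand (a : X → ℝ) (F : X → ℂ) (k : ℕ) (z : ℝ) (x : X) :
    ‖oscIntegrand a F k z x‖ = (2 * π) ^ k * (|a x| ^ k * ‖F x‖) := by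
  rw [oscIntegrand, norm_mul, norm_mul, norm_pow, norm_exp_ofReal_mul_ofReal_mul_I, norm_mul,
    Complex.norm_I, Complex.norm_real, Real.norm_eq_abs, abs_mul, abs_mul, abs_neg, abs_two,
    abs_of_pos Real.pi_pos]
  ring

lemma hasDerivAt_oscIntegrand (a : X → ℝ) (F : X → ℂ) (k : ℕ) (z : ℝ) (x : X) :
    HasDerivAt (fun z => oscIntegrand a F k z x) (oscIntegrand a F (k + 1) z x) z := by
  have hphase : HasDerivAt (fun z : ℝ => (z : ℂ) * ((-2 * π * a x : ℝ) * Complex.I))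
      (1 * ((-2 * π * a x : ℝ) * Complex.I)) z :=
    (Complex.ofRealCLM.hasDerivAt (x := z)).mul_const _
  refine ((hphase.cexp.const_mul (((-2 * π * a x : ℝ) * Complex.I) ^ k)).mul_const
    (F x)).congr_deriv ?_
  rw [oscIntegrand]
  ring

lemma abs_two_mul_cos_sub_two_add_sq_le (u : ℝ) : |2 * Real.cos u - 2 + u ^ 2| ≤ u ^ 4 := by
  rw [abs_of_nonneg (by linarith [Real.one_sub_sq_div_two_le_cos (x := u)])]
  rcases le_total |u| 1 with hu | hu
  · have hcos := (abs_le.1 (Real.cos_bound hu)).2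
    rw [Even.pow_abs (by decide)] at hcos
    have : 0 ≤ u ^ 4 := by positivity
    linarith
  · have hsq : 1 ≤ u ^ 2 := one_le_sq_iff_one_le_abs u |>.2 hu
    nlinarith [Real.cos_le_one u]

lemma second_difference_exp (b z h : ℝ) :
    Complex.exp (((z + h : ℝ) : ℂ) * (b * Complex.I))
      + Complex.exp (((z - h : ℝ) : ℂ) * (b * Complex.I))
      - 2 * Complex.exp ((z : ℂ) * (b * Complex.I))
      - h ^ 2 * ((b * Complex.I) ^ 2 * Complex.exp ((z : ℂ) * (b * Complex.I)))
      = ((2 * Real.cos (h * b) - 2 + (h * b) ^ 2 : ℝ) : ℂ) *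
        Complex.exp ((z : ℂ) * (b * Complex.I)) := by
  have hadd : Complex.exp (((z + h : ℝ) : ℂ) * (b * Complex.I))
      = Complex.exp ((z : ℂ) * (b * Complex.I)) * Complex.exp ((h * b : ℂ) * Complex.I) := by
    rw [← Complex.exp_add]; push_cast; ring_nf
  have hsub : Complex.exp (((z - h : ℝ) : ℂ) * (b * Complex.I))
      = Complex.exp ((z : ℂ) * (b * Complex.I)) * Complex.exp (-(h * b : ℂ) * Complex.I) := by
    rw [← Complex.exp_add]; push_cast; ring_nf
  rw [hadd, hsub]
  push_cast
  rw [Complex.two_cos]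
  linear_combination (-(h : ℂ) ^ 2 * b ^ 2 * Complex.exp ((z : ℂ) * (b * Complex.I)))
    * Complex.I_sq

lemma norm_second_difference_oscIntegrand_le (a : X → ℝ) (F : X → ℂ) (z h : ℝ) (x : X) :
    ‖oscIntegrand a F 0 (z + h) x + oscIntegrand a F 0 (z - h) x - 2 * oscIntegrand a F 0 z x
      - h ^ 2 * oscIntegrand a F 2 z x‖ ≤ (2 * π) ^ 4 * (|a x| ^ 4 * ‖F x‖) * h ^ 4 := by
  set b : ℝ := -2 * π * a x with hb
  have hfactor : oscIntegrand a F 0 (z + h) x + oscIntegrand a F 0 (z - h) x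
      - 2 * oscIntegrand a F 0 z x - h ^ 2 * oscIntegrand a F 2 z x
      = ((2 * Real.cos (h * b) - 2 + (h * b) ^ 2 : ℝ) : ℂ) *
        Complex.exp ((z : ℂ) * (b * Complex.I)) * F x := by
    rw [← second_difference_exp]
    simp only [oscIntegrand, ← hb]
    ring
  rw [hfactor, norm_mul, norm_mul, norm_exp_ofReal_mul_ofReal_mul_I, mul_one, Complex.norm_real,
    Real.norm_eq_abs]
  calc |2 * Real.cos (h * b) - 2 + (h * b) ^ 2| * ‖F x‖ ≤ (h * b) ^ 4 * ‖F x‖ := by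
        gcongr
        exact abs_two_mul_cos_sub_two_add_sq_le _
    _ = (2 * π) ^ 4 * (|a x| ^ 4 * ‖F x‖) * h ^ 4 := by
        rw [Even.pow_abs (by decide), hb]
        ring

variable [MeasurableSpace X] {μ : Measure X} {a : X → ℝ} {F : X → ℂ}

lemma aestronglyMeasurable_oscIntegrand (ha : Measurable a) (hF : AEStronglyMeasurable F μ)
    (k : ℕ) (z : ℝ) : AEStronglyMeasurable (oscIntegrand a F k z) μ := by
  refine AEStronglyMeasurable.mul (Measurable.aestronglyMeasurable ?_) hF
  fun_prop

lemma integrable_oscIntegrand (ha : Measurable a) (hF : AEStronglyMeasurable F μ) {k : ℕ}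
    (hk : Integrable (fun x => |a x| ^ k * ‖F x‖) μ) (z : ℝ) :
    Integrable (oscIntegrand a F k z) μ :=
  (hk.const_mul ((2 * π) ^ k)).mono' (aestronglyMeasurable_oscIntegrand ha hF k z)
    (Filter.Eventually.of_forall fun x => (norm_oscIntegrand a F k z x).le)

lemma hasDerivAt_oscIntegral (ha : Measurable a) (hF : AEStronglyMeasurable F μ) {k : ℕ}
    (hk : Integrable (fun x => |a x| ^ k * ‖F x‖) μ)
    (hk' : Integrable (fun x => |a x| ^ (k + 1) * ‖F x‖) μ) (z : ℝ) :
    HasDerivAt (oscIntegral μ a F k) (oscIntegral μ a F (k + 1) z) z :=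
  (hasDerivAt_integral_of_dominated_loc_of_deriv_le (s := Set.univ)
    (bound := fun x => (2 * π) ^ (k + 1) * (|a x| ^ (k + 1) * ‖F x‖)) Filter.univ_mem
    (Filter.Eventually.of_forall fun z => aestronglyMeasurable_oscIntegrand ha hF k z)
    (integrable_oscIntegrand ha hF hk z) (aestronglyMeasurable_oscIntegrand ha hF (k + 1) z)
    (Filter.Eventually.of_forall fun x z _ => (norm_oscIntegrand a F (k + 1) z x).le)
    (hk'.const_mul _)
    (Filter.Eventually.of_forall fun x z _ => hasDerivAt_oscIntegrand a F k z x)).2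

lemma norm_second_difference_oscIntegral_le (ha : Measurable a) (hF : Integrable F μ)
    (hsq : Integrable (fun x => |a x| ^ 2 * ‖F x‖) μ)
    (hfourth : Integrable (fun x => |a x| ^ 4 * ‖F x‖) μ) (z h : ℝ) :
    ‖oscIntegral μ a F 0 (z + h) + oscIntegral μ a F 0 (z - h) - 2 * oscIntegral μ a F 0 z
      - h ^ 2 * oscIntegral μ a F 2 z‖ ≤ (2 * π) ^ 4 * (∫ x, |a x| ^ 4 * ‖F x‖ ∂μ) * h ^ 4 := by
  have hint : ∀ z, Integrable (oscIntegrand a F 0 z) μ := fun z =>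
    integrable_oscIntegrand ha hF.1 (by simpa using hF.norm) z
  have hint₂ : Integrable (oscIntegrand a F 2 z) μ := integrable_oscIntegrand ha hF.1 hsq z
  have hsum : Integrable (fun x => oscIntegrand a F 0 (z + h) x + oscIntegrand a F 0 (z - h) x) μ :=
    (hint _).add (hint _)
  have hdiff : Integrable (fun x => oscIntegrand a F 0 (z + h) x + oscIntegrand a F 0 (z - h) x
      - 2 * oscIntegrand a F 0 z x) μ := hsum.sub ((hint z).const_mul 2)
  simp only [oscIntegral]
  rw [← integral_add (hint _) (hint _), ← integral_const_mul, ← integral_sub hsum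
    ((hint z).const_mul 2), ← integral_const_mul, ← integral_sub hdiff (hint₂.const_mul _),
    ← integral_const_mul, ← integral_mul_const]
  exact norm_integral_le_of_norm_le ((hfourth.const_mul _).mul_const _)
    (Filter.Eventually.of_forall (norm_second_difference_oscIntegrand_le a F z h))

end Oscillatory

/-! ### Interpolation and radial averages -/

lemma le_sqrt_mul_of_forall_mul_le {c q D F L : ℝ} (hD : 0 ≤ D) (hF : 0 ≤ F)
    (hL : F + D ≤ L) (h : ∀ t : ℝ, 0 < t → t * c ≤ D * (q + 2 * t) + F * t ^ 2) :
    c ≤ √(D * L) * (q + 3) := by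
  rcases hD.eq_or_lt with rfl | hD
  · suffices hc : c ≤ 0 by simpa only [zero_mul, Real.sqrt_zero] using hc
    refine le_of_forall_pos_le_add fun ε hε => ?_
    have ht : 0 < ε / (F + 1) := by positivity
    have hle := h _ ht
    rw [zero_mul, zero_add, sq, mul_left_comm] at hle
    calc c ≤ F * (ε / (F + 1)) := le_of_mul_le_mul_left hle ht
      _ ≤ 0 + ε := by
        rw [zero_add, mul_div_assoc', div_le_iff₀ (by positivity)]
        nlinarith
  · have hLpos : 0 < L := by linarith
    -- The terms `D * q` and `F * t ^ 2` balance at this value of `t`.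
    set t := √(D / L)
    have ht : 0 < t := Real.sqrt_pos.2 (by positivity)
    have hD_eq : D = t ^ 2 * L := by
      rw [Real.sq_sqrt (by positivity)]
      field_simp
    have hsqrt : √(D * L) = t * L := by
      rw [hD_eq, mul_assoc, ← sq, ← mul_pow, Real.sqrt_sq (by positivity)]
    have ht_le : t ≤ 1 := Real.sqrt_le_one.2 ((div_le_one hLpos).2 (by linarith))
    have hle : t * c ≤ t * (t * L * (q + 3)) := by
      calc t * c ≤ D * (q + 2 * t) + F * t ^ 2 := h t ht
        _ = t * (t * L * q + 2 * (t * L) * t + F * t) := by rw [hD_eq]; ring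
        _ ≤ t * (t * L * q + 2 * (t * L) * 1 + L * t) := by gcongr; linarith
        _ = t * (t * L * (q + 3)) := by ring
    rw [hsqrt]
    exact le_of_mul_le_mul_left hle ht

lemma norm_le_of_second_difference {κ κ₂ : ℝ → ℂ} {D F L ρ : ℝ} (hD : 0 ≤ D) (hF : 0 ≤ F)
    (hL : F + D ≤ L) (hκ : ∀ z, ‖κ z‖ ≤ D * (ρ + z ^ 2))
    (hκ₂ : ∀ z h : ℝ, ‖κ (z + h) + κ (z - h) - 2 * κ z - h ^ 2 * κ₂ z‖ ≤ F * h ^ 4) (z : ℝ) :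
    ‖κ₂ z‖ ≤ √(D * L) * (4 * (ρ + z ^ 2) + 3) := by
  refine le_sqrt_mul_of_forall_mul_le hD hF hL fun t ht => ?_
  set h := √t
  have hsq : h ^ 2 = t := Real.sq_sqrt ht.le
  have hfour : h ^ 4 = t ^ 2 := by rw [← hsq]; ring
  have hdiff : ‖κ (z + h) + κ (z - h) - 2 * κ z‖ ≤ D * (4 * (ρ + z ^ 2) + 2 * t) := by
    calc ‖κ (z + h) + κ (z - h) - 2 * κ z‖ ≤ ‖κ (z + h)‖ + ‖κ (z - h)‖ + ‖2 * κ z‖ :=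
          (norm_sub_le _ _).trans (by gcongr; exact norm_add_le _ _)
      _ ≤ D * (ρ + (z + h) ^ 2) + D * (ρ + (z - h) ^ 2) + 2 * (D * (ρ + z ^ 2)) := by
          rw [norm_mul, Complex.norm_two]
          gcongr <;> apply hκ
      _ = D * (4 * (ρ + z ^ 2) + 2 * t) := by rw [← hsq]; ring
  calc t * ‖κ₂ z‖ = ‖(h ^ 2 : ℂ) * κ₂ z‖ := by
        rw [norm_mul, norm_pow, Complex.norm_real, Real.norm_eq_abs, sq_abs, hsq]
    _ ≤ ‖κ (z + h) + κ (z - h) - 2 * κ z‖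
          + ‖κ (z + h) + κ (z - h) - 2 * κ z - h ^ 2 * κ₂ z‖ := by
        refine (congrArg norm ?_).trans_le (norm_sub_le _ _)
        ring
    _ ≤ D * (4 * (ρ + z ^ 2) + 2 * t) + F * t ^ 2 := by
        rw [← hfour]
        exact add_le_add hdiff (hκ₂ z h)

/-- `κ` and its second derivative grow at most quadratically, at scale `G` and offset `ρ`. This is
what the comparison of the two heat baths needs from the Fourier transform of a state as a function
of a single frequency; the form of the second bound is that of
`KacReservoir.norm_le_of_second_difference`. -/
structure QuadraticGrowth (κ : ℝ → ℂ) (G ρ : ℝ) : Prop where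
  scale_nonneg : 0 ≤ G
  offset_nonneg : 0 ≤ ρ
  differentiable : Differentiable ℝ κ
  differentiable_deriv : Differentiable ℝ (deriv κ)
  norm_le : ∀ z, ‖κ z‖ ≤ G * (ρ + z ^ 2)
  norm_deriv_deriv_le : ∀ z, ‖deriv (deriv κ) z‖ ≤ G * (4 * (ρ + z ^ 2) + 3)

/-- The restriction of `κ ⊗ gauss` to the line through the origin in direction `(c, s)`. -/
def alongRay (κ : ℝ → ℂ) (c s r : ℝ) : ℂ := κ (r * c) * gauss (r * s)

/-- The part of `κ` that survives averaging over all scattering angles. -/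
def evenPart (κ : ℝ → ℂ) (z : ℝ) : ℂ := (κ z + κ (-z)) / 2

lemma evenPart_neg (κ : ℝ → ℂ) (z : ℝ) : evenPart κ (-z) = evenPart κ z := by
  rw [evenPart, evenPart, neg_neg, add_comm]

lemma norm_evenPart_le {κ : ℝ → ℂ} {z C : ℝ} (hpos : ‖κ z‖ ≤ C) (hneg : ‖κ (-z)‖ ≤ C) :
    ‖evenPart κ z‖ ≤ C := by
  rw [evenPart, norm_div, Complex.norm_two, div_le_iff₀ two_pos]
  linarith [norm_add_le_of_le hpos hneg]

lemma continuous_evenPart {κ : ℝ → ℂ} (hκ : Continuous κ) : Continuous (evenPart κ) := by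
  unfold evenPart
  fun_prop

lemma deriv_evenPart {κ : ℝ → ℂ} (hκ : Differentiable ℝ κ) (z : ℝ) :
    deriv (evenPart κ) z = (deriv κ z - deriv κ (-z)) / 2 := by
  have hneg : HasDerivAt (fun z => κ (-z)) ((-1 : ℝ) • deriv κ (-z)) z :=
    (hκ (-z)).hasDerivAt.scomp z (hasDerivAt_neg z)
  rw [neg_one_smul] at hneg
  rw [sub_eq_add_neg]
  exact (((hκ z).hasDerivAt.add hneg).div_const 2).deriv

lemma deriv_deriv_evenPart {κ : ℝ → ℂ} (hκ : Differentiable ℝ κ)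
    (hκ' : Differentiable ℝ (deriv κ)) (z : ℝ) :
    deriv (deriv (evenPart κ)) z = evenPart (deriv (deriv κ)) z := by
  have hneg : HasDerivAt (fun z => deriv κ (-z)) ((-1 : ℝ) • deriv (deriv κ) (-z)) z :=
    (hκ' (-z)).hasDerivAt.scomp z (hasDerivAt_neg z)
  rw [neg_one_smul] at hneg
  rw [funext (deriv_evenPart hκ), evenPart, ← sub_neg_eq_add]
  exact (((hκ' z).hasDerivAt.sub hneg).div_const 2).deriv

lemma continuous_alongRay {κ : ℝ → ℂ} (hκ : Continuous κ) (r : ℝ) :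
    Continuous fun θ => alongRay κ (Real.cos θ) (Real.sin θ) r :=
  (hκ.comp (by fun_prop)).mul (continuous_ofReal_gauss_comp (by fun_prop))

lemma alongRay_neg {κ : ℝ → ℂ} (hκ : ∀ z, κ (-z) = κ z) (c s r : ℝ) :
    alongRay κ c s (-r) = alongRay κ c s r := by
  simp only [alongRay, neg_mul, hκ, gauss_neg]

lemma hasDerivAt_alongRay {κ : ℝ → ℂ} (hκ : Differentiable ℝ κ) (c s r : ℝ) :
    HasDerivAt (alongRay κ c s) (c * deriv κ (r * c) * gauss (r * s)
      + κ (r * c) * ((-2 * π * (r * s) * gauss (r * s) * s : ℝ) : ℂ)) r := by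
  have hsignal : HasDerivAt (fun r : ℝ => κ (r * c)) ((1 * c) • deriv κ (r * c)) r :=
    (hκ (r * c)).hasDerivAt.scomp r ((hasDerivAt_id r).mul_const c)
  have hgauss : HasDerivAt (gauss ∘ fun r : ℝ => r * s)
      (-2 * π * (r * s) * gauss (r * s) * (1 * s)) r :=
    (hasDerivAt_gauss (r * s)).comp r ((hasDerivAt_id r).mul_const s)
  refine (hsignal.mul hgauss.ofReal_comp).congr_deriv ?_
  rw [one_mul, one_mul, Complex.real_smul, Function.comp_apply]

namespace QuadraticGrowth

variable {κ : ℝ → ℂ} {G ρ : ℝ}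

lemma norm_deriv_le (hκ : QuadraticGrowth κ G ρ) (hzero : deriv κ 0 = 0) {z R : ℝ}
    (hz : z ^ 2 ≤ R ^ 2) : ‖deriv κ z‖ ≤ G * (4 * (ρ + R ^ 2) + 3) * |z| := by
  have hle := (convex_segment (0 : ℝ) z).norm_image_sub_le_of_norm_deriv_le
    (C := G * (4 * (ρ + R ^ 2) + 3)) (fun y _ => hκ.differentiable_deriv y) (fun y hy => ?_)
    (left_mem_segment ℝ 0 z) (right_mem_segment ℝ 0 z)
  · simpa only [hzero, sub_zero, Real.norm_eq_abs] using hle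
  · obtain ⟨t, u, ht, hu, htu, rfl⟩ := hy
    have hsq : (t • 0 + u • z) ^ 2 ≤ R ^ 2 := by
      have hu_le : u ^ 2 ≤ 1 := pow_le_one₀ hu (by linarith)
      simp only [smul_eq_mul, mul_zero, zero_add, mul_pow]
      exact (mul_le_of_le_one_left (sq_nonneg z) hu_le).trans hz
    have hG := hκ.scale_nonneg
    exact (hκ.norm_deriv_deriv_le _).trans (by gcongr)

lemma norm_alongRay_le (hκ : QuadraticGrowth κ G ρ) {c s : ℝ} (hcs : c ^ 2 + s ^ 2 = 1)
    (r : ℝ) : ‖alongRay κ c s r‖ ≤ G * (ρ + r ^ 2) := by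
  have hG := hκ.scale_nonneg
  have hle : (r * c) ^ 2 ≤ r ^ 2 := by
    rw [mul_pow]
    exact mul_le_of_le_one_right (sq_nonneg r) (by linarith [sq_nonneg s])
  calc ‖alongRay κ c s r‖ = ‖κ (r * c)‖ * gauss (r * s) := by
        rw [alongRay, norm_mul, norm_ofReal_gauss]
    _ ≤ ‖κ (r * c)‖ := mul_le_of_le_one_right (norm_nonneg _) (gauss_le_one _)
    _ ≤ G * (ρ + r ^ 2) := (hκ.norm_le _).trans (by gcongr)

lemma norm_deriv_alongRay_le (hκ : QuadraticGrowth κ G ρ) (hzero : deriv κ 0 = 0) {c s : ℝ}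
    (hcs : c ^ 2 + s ^ 2 = 1) {r R : ℝ} (hr : 0 ≤ r) (hrR : r ≤ R) :
    ‖c * deriv κ (r * c) * gauss (r * s)
        + κ (r * c) * ((-2 * π * (r * s) * gauss (r * s) * s : ℝ) : ℂ)‖
      ≤ G * ((2 + π) * (ρ + R ^ 2) + 3 / 2) * (2 * r) := by
  have hG := hκ.scale_nonneg
  have hρ := hκ.offset_nonneg
  have hc : |c| * |c| ≤ 1 := by rw [abs_mul_abs_self]; nlinarith [sq_nonneg s]
  have hs : s ^ 2 ≤ 1 := by nlinarith [sq_nonneg c]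
  have hsq : (r * c) ^ 2 ≤ R ^ 2 := by
    rw [mul_pow]
    exact (mul_le_of_le_one_right (sq_nonneg r) (by nlinarith [sq_nonneg s])).trans (by gcongr)
  have hsignal : ‖(c : ℂ) * deriv κ (r * c) * gauss (r * s)‖
      ≤ G * (4 * (ρ + R ^ 2) + 3) * r := by
    calc ‖(c : ℂ) * deriv κ (r * c) * gauss (r * s)‖
        = |c| * ‖deriv κ (r * c)‖ * gauss (r * s) := by
          rw [norm_mul, norm_mul, Complex.norm_real, Real.norm_eq_abs, norm_ofReal_gauss]
      _ ≤ |c| * (G * (4 * (ρ + R ^ 2) + 3) * |r * c|) * 1 := by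
          gcongr
          exacts [gauss_nonneg _, hκ.norm_deriv_le hzero hsq, gauss_le_one _]
      _ = G * (4 * (ρ + R ^ 2) + 3) * r * (|c| * |c|) := by
          rw [abs_mul, abs_of_nonneg hr]
          ring
      _ ≤ G * (4 * (ρ + R ^ 2) + 3) * r := mul_le_of_le_one_right (by positivity) hc
  have hgauss : ‖κ (r * c) * ((-2 * π * (r * s) * gauss (r * s) * s : ℝ) : ℂ)‖
      ≤ G * (ρ + R ^ 2) * (2 * π * r) := by
    have hdecay : |-2 * π * (r * s) * gauss (r * s) * s| ≤ 2 * π * r := by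
      rw [show -2 * π * (r * s) * gauss (r * s) * s
        = -(2 * π * r * (s ^ 2 * gauss (r * s))) by ring, abs_neg,
        abs_of_nonneg (mul_nonneg (by positivity) (mul_nonneg (sq_nonneg s) (gauss_nonneg _)))]
      exact mul_le_of_le_one_right (by positivity)
        (mul_le_one₀ hs (gauss_nonneg _) (gauss_le_one _))
    rw [norm_mul, Complex.norm_real, Real.norm_eq_abs]
    gcongr
    exact (hκ.norm_le _).trans (by gcongr)
  linarith [norm_add_le_of_le hsignal hgauss]

lemma norm_alongRay_sub_le (hκ : QuadraticGrowth κ G ρ) (hzero : deriv κ 0 = 0) {c s : ℝ}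
    (hcs : c ^ 2 + s ^ 2 = 1) {r₀ r₁ : ℝ} (hr₀ : 0 ≤ r₀) (hr : r₀ ≤ r₁) :
    ‖alongRay κ c s r₁ - alongRay κ c s r₀‖
      ≤ G * ((2 + π) * (ρ + r₁ ^ 2) + 3 / 2) * (r₁ ^ 2 - r₀ ^ 2) := by
  have hderiv : ∀ r, HasDerivAt (fun r => alongRay κ c s r - alongRay κ c s r₀) _ r := fun r =>
    (hasDerivAt_alongRay hκ.differentiable c s r).sub_const _
  have hbound : ∀ r : ℝ,
      HasDerivAt (fun r => G * ((2 + π) * (ρ + r₁ ^ 2) + 3 / 2) * (r ^ 2 - r₀ ^ 2))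
        (G * ((2 + π) * (ρ + r₁ ^ 2) + 3 / 2) * (2 * r)) r := fun r =>
    (((hasDerivAt_pow 2 r).sub_const _).const_mul _).congr_deriv (by norm_num)
  exact image_norm_le_of_norm_deriv_right_le_deriv_boundary
    (fun r _ => (hderiv r).continuousAt.continuousWithinAt)
    (fun r _ => (hderiv r).hasDerivWithinAt) (by simp) hbound
    (fun r hr => hκ.norm_deriv_alongRay_le hzero hcs (hr₀.trans hr.1) hr.2.le)
    (right_mem_Icc.2 hr)

lemma norm_alongRay_mul_gauss_sub_le_of_le_one (hκ : QuadraticGrowth κ G ρ)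
    (heven : ∀ z, κ (-z) = κ z) (hzero : deriv κ 0 = 0) {c s : ℝ} (hcs : c ^ 2 + s ^ 2 = 1)
    (x : ℝ) {y : ℝ} (hy : π * y ^ 2 ≤ 1) :
    ‖alongRay κ c s x * gauss y - alongRay κ c s (√(x ^ 2 + y ^ 2))‖
      ≤ 5 * G * ((1 - gauss y) * (ρ + x ^ 2) + y ^ 2) := by
  set r := √(x ^ 2 + y ^ 2)
  have hr : r ^ 2 = x ^ 2 + y ^ 2 := Real.sq_sqrt (by positivity)
  have habs : alongRay κ c s |x| = alongRay κ c s x := by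
    rcases abs_choice x with h | h <;> rw [h]
    exact alongRay_neg heven c s x
  have hincrement := hκ.norm_alongRay_sub_le hzero hcs (abs_nonneg x)
    (Real.abs_le_sqrt (by linarith [sq_nonneg y]) : |x| ≤ r)
  rw [habs, sq_abs, hr, add_sub_cancel_left] at hincrement
  have hdamping : ‖((1 - gauss y : ℝ) : ℂ) * alongRay κ c s x‖
      ≤ (1 - gauss y) * (G * (ρ + x ^ 2)) := by
    have hg : 0 ≤ 1 - gauss y := sub_nonneg.2 (gauss_le_one y)
    rw [norm_mul, Complex.norm_real, Real.norm_of_nonneg hg]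
    exact mul_le_mul_of_nonneg_left (hκ.norm_alongRay_le hcs x) hg
  have harith : ((2 + π) * (ρ + (x ^ 2 + y ^ 2)) + 3 / 2) * y ^ 2
      ≤ 4 * (1 - gauss y) * (ρ + x ^ 2) + 4 * y ^ 2 := by
    have hsmall := mul_sq_le_two_mul_one_sub_gauss hy
    have hpos : 0 ≤ ρ + x ^ 2 := add_nonneg hκ.offset_nonneg (sq_nonneg x)
    have hquad : (2 + π) * y ^ 2 ≤ 4 * (1 - gauss y) := by
      nlinarith [Real.pi_gt_three, sq_nonneg y]
    have hquart : (2 + π) * y ^ 2 ≤ 2 := by nlinarith [Real.pi_gt_three, sq_nonneg y]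
    nlinarith [mul_le_mul_of_nonneg_right hquad hpos,
      mul_le_mul_of_nonneg_right hquart (sq_nonneg y)]
  calc ‖alongRay κ c s x * gauss y - alongRay κ c s r‖
      = ‖((1 - gauss y : ℝ) : ℂ) * alongRay κ c s x
          + (alongRay κ c s r - alongRay κ c s x)‖ := by
        rw [← norm_neg]
        push_cast
        ring_nf
    _ ≤ (1 - gauss y) * (G * (ρ + x ^ 2))
          + G * ((2 + π) * (ρ + (x ^ 2 + y ^ 2)) + 3 / 2) * y ^ 2 :=
        norm_add_le_of_le hdamping hincrement
    _ ≤ 5 * G * ((1 - gauss y) * (ρ + x ^ 2) + y ^ 2) := by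
        nlinarith [mul_le_mul_of_nonneg_left harith hκ.scale_nonneg,
          mul_nonneg hκ.scale_nonneg (sq_nonneg y)]

lemma norm_alongRay_mul_gauss_sub_le_of_one_le (hκ : QuadraticGrowth κ G ρ) {c s : ℝ}
    (hcs : c ^ 2 + s ^ 2 = 1) (x : ℝ) {y : ℝ} (hy : 1 ≤ π * y ^ 2) :
    ‖alongRay κ c s x * gauss y - alongRay κ c s (√(x ^ 2 + y ^ 2))‖
      ≤ 5 * G * ((1 - gauss y) * (ρ + x ^ 2) + y ^ 2) := by
  have hG := hκ.scale_nonneg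
  have hGX : 0 ≤ G * (ρ + x ^ 2) := mul_nonneg hG (add_nonneg hκ.offset_nonneg (sq_nonneg x))
  have hhalf : gauss y ≤ 1 / 2 := gauss_le_half hy
  have hr := hκ.norm_alongRay_le hcs √(x ^ 2 + y ^ 2)
  rw [Real.sq_sqrt (by positivity)] at hr
  calc ‖alongRay κ c s x * gauss y - alongRay κ c s (√(x ^ 2 + y ^ 2))‖
      ≤ G * (ρ + x ^ 2) * gauss y + G * (ρ + (x ^ 2 + y ^ 2)) := by
        refine norm_sub_le_of_le ?_ hr
        rw [norm_mul, norm_ofReal_gauss]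
        exact mul_le_mul_of_nonneg_right (hκ.norm_alongRay_le hcs x) (gauss_nonneg y)
    _ ≤ 5 * G * ((1 - gauss y) * (ρ + x ^ 2) + y ^ 2) := by
        nlinarith [mul_nonneg hG (sq_nonneg y), mul_nonneg hGX (sub_nonneg.2 hhalf)]

lemma norm_alongRay_mul_gauss_sub_le (hκ : QuadraticGrowth κ G ρ)
    (heven : ∀ z, κ (-z) = κ z) (hzero : deriv κ 0 = 0) {c s : ℝ} (hcs : c ^ 2 + s ^ 2 = 1)
    (x y : ℝ) :
    ‖alongRay κ c s x * gauss y - alongRay κ c s (√(x ^ 2 + y ^ 2))‖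
      ≤ 5 * G * ((1 - gauss y) * (ρ + x ^ 2) + y ^ 2) :=
  (le_total (π * y ^ 2) 1).elim
    (hκ.norm_alongRay_mul_gauss_sub_le_of_le_one heven hzero hcs x)
    (hκ.norm_alongRay_mul_gauss_sub_le_of_one_le hcs x)

protected lemma evenPart (hκ : QuadraticGrowth κ G ρ) : QuadraticGrowth (evenPart κ) G ρ where
  scale_nonneg := hκ.scale_nonneg
  offset_nonneg := hκ.offset_nonneg
  differentiable := (hκ.differentiable.add (hκ.differentiable.comp differentiable_neg)).div_const 2
  differentiable_deriv := by
    rw [funext (deriv_evenPart hκ.differentiable)]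
    exact (hκ.differentiable_deriv.sub
      (hκ.differentiable_deriv.comp differentiable_neg)).div_const 2
  norm_le z := norm_evenPart_le (hκ.norm_le z) (by simpa only [neg_sq] using hκ.norm_le (-z))
  norm_deriv_deriv_le z := by
    rw [deriv_deriv_evenPart hκ.differentiable hκ.differentiable_deriv]
    exact norm_evenPart_le (hκ.norm_deriv_deriv_le z)
      (by simpa only [neg_sq] using hκ.norm_deriv_deriv_le (-z))

end QuadraticGrowth

lemma exists_polar (x y : ℝ) :
    ∃ φ : ℝ, x = √(x ^ 2 + y ^ 2) * Real.cos φ ∧ y = √(x ^ 2 + y ^ 2) * Real.sin φ := by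
  rw [← Complex.norm_eq_sqrt_sq_add_sq ⟨x, y⟩]
  exact ⟨Complex.arg ⟨x, y⟩, (Complex.norm_mul_cos_arg ⟨x, y⟩).symm,
    (Complex.norm_mul_sin_arg ⟨x, y⟩).symm⟩

lemma periodic_alongRay (κ : ℝ → ℂ) (r : ℝ) :
    Function.Periodic (fun θ => alongRay κ (Real.cos θ) (Real.sin θ) r) (2 * π) := fun θ => by
  simp only [Real.cos_add_two_pi, Real.sin_add_two_pi]

lemma angleMean_rotate (κ : ℝ → ℂ) (x y : ℝ) :
    angleMean (fun θ => κ (x * Real.cos θ + y * Real.sin θ)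
      * gauss (-x * Real.sin θ + y * Real.cos θ))
      = angleMean fun θ => alongRay κ (Real.cos θ) (Real.sin θ) (√(x ^ 2 + y ^ 2)) := by
  obtain ⟨φ, hx, hy⟩ := exists_polar x y
  set r := √(x ^ 2 + y ^ 2)
  rw [← angleMean_comp_add_right (periodic_alongRay κ r) (-φ)]
  congr 1
  ext θ
  rw [alongRay, Real.cos_add, Real.sin_add, Real.cos_neg, Real.sin_neg, hx, hy, ← gauss_neg]
  ring_nf

lemma angleMean_alongRay_evenPart {κ : ℝ → ℂ} (hκ : Continuous κ) (r : ℝ) :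
    angleMean (fun θ => alongRay (evenPart κ) (Real.cos θ) (Real.sin θ) r)
      = angleMean fun θ => alongRay κ (Real.cos θ) (Real.sin θ) r := by
  have hshift := angleMean_comp_add_right (periodic_alongRay κ r) π
  have hsplit : ∀ θ, alongRay (evenPart κ) (Real.cos θ) (Real.sin θ) r
      = 2⁻¹ * (alongRay κ (Real.cos θ) (Real.sin θ) r
        + alongRay κ (Real.cos (θ + π)) (Real.sin (θ + π)) r) := fun θ => by
    simp only [alongRay, evenPart, Real.cos_add_pi, Real.sin_add_pi, mul_neg, gauss_neg]
    ring
  have hcont := continuous_alongRay hκ r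
  have hcont_shift : Continuous fun θ => alongRay κ (Real.cos (θ + π)) (Real.sin (θ + π)) r :=
    hcont.comp (continuous_add_const π)
  simp only [hsplit]
  rw [angleMean_const_mul, angleMean_add hcont hcont_shift, hshift]
  ring

/-- For even `κ` the two integrands are close at each angle; averaging over the angle discards the
odd part of `κ`. -/
lemma QuadraticGrowth.norm_angleMean_sub_le {κ : ℝ → ℂ} {G ρ : ℝ} (hκ : QuadraticGrowth κ G ρ)
    (x y : ℝ) :
    ‖angleMean (fun θ => κ (x * Real.cos θ) * gauss (x * Real.sin θ)) * gauss y
      - angleMean (fun θ => κ (x * Real.cos θ + y * Real.sin θ)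
        * gauss (-x * Real.sin θ + y * Real.cos θ))‖
      ≤ 5 * G * ((1 - gauss y) * (ρ + x ^ 2) + y ^ 2) := by
  have hcont := hκ.differentiable.continuous
  have hray := continuous_alongRay (continuous_evenPart hcont)
  have hdamped : Continuous fun θ =>
      alongRay (evenPart κ) (Real.cos θ) (Real.sin θ) x * (gauss y : ℂ) :=
    (hray x).mul continuous_const
  have hzero : deriv (evenPart κ) 0 = 0 := by
    rw [deriv_evenPart hκ.differentiable, neg_zero, sub_self, zero_div]
  change ‖angleMean (fun θ => alongRay κ (Real.cos θ) (Real.sin θ) x) * gauss y - _‖ ≤ _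
  rw [angleMean_rotate, ← angleMean_alongRay_evenPart hcont, ← angleMean_alongRay_evenPart hcont,
    ← angleMean_mul_const, ← angleMean_sub hdamped (hray _)]
  exact norm_angleMean_le fun θ => hκ.evenPart.norm_alongRay_mul_gauss_sub_le (evenPart_neg κ)
    hzero (Real.cos_sq_add_sin_sq θ) x y

/-- With `p i` the probabilities of independent events, the sum is the probability that exactly one
of them fails. -/
lemma sum_one_sub_mul_prod_erase_le_one {α : Type*} [DecidableEq α] (s : Finset α) {p : α → ℝ}
    (hp_nonneg : ∀ i, 0 ≤ p i) (hp_le : ∀ i, p i ≤ 1) :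
    ∑ i ∈ s, (1 - p i) * ∏ j ∈ s.erase i, p j ≤ 1 := by
  suffices h : ∑ i ∈ s, (1 - p i) * ∏ j ∈ s.erase i, p j + ∏ j ∈ s, p j ≤ 1 by
    linarith [Finset.prod_nonneg (s := s) fun i _ => hp_nonneg i]
  induction s using Finset.induction_on with
  | empty => simp
  | insert a s ha ih =>
    have hfactor : ∀ i ∈ s, (1 - p i) * ∏ j ∈ (insert a s).erase i, p j
        = p a * ((1 - p i) * ∏ j ∈ s.erase i, p j) := fun i hi => by
      have hia : a ≠ i := fun h => ha (h ▸ hi)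
      rw [Finset.erase_insert_of_ne hia, Finset.prod_insert fun h => ha (Finset.mem_of_mem_erase h)]
      ring
    have hsum : 0 ≤ ∑ i ∈ s, (1 - p i) * ∏ j ∈ s.erase i, p j := Finset.sum_nonneg fun i _ =>
      mul_nonneg (sub_nonneg.2 (hp_le i)) (Finset.prod_nonneg fun j _ => hp_nonneg j)
    rw [Finset.sum_insert ha, Finset.erase_insert ha, Finset.prod_insert ha,
      Finset.sum_congr rfl hfactor, ← Finset.mul_sum]
    linarith [mul_nonneg hsum (sub_nonneg.2 (hp_le a))]

/-! ### Duality for the collision operators -/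

section Duality

variable {X Y Z : Type*} [MeasurableSpace X] [MeasurableSpace Y] [MeasurableSpace Z]
  {μ : Measure X} [SFinite μ] {ρ : Measure Y} [SFinite ρ] {ν : Measure Z}
  {Φ : Y × X → Z} {h : X → ℝ} {k : Z → ℝ}

lemma integral_mul_of_ae_eq_integral_comp (hΦ : MeasurePreserving Φ (ρ.prod μ) ν)
    (hk : Integrable k ν) (hh : h =ᵐ[μ] fun x => ∫ y, k (Φ (y, x)) ∂ρ) {φ : X → ℂ} {ψ : Z → ℂ}
    (hφ : Measurable φ) (hφ_le : ∀ x, ‖φ x‖ ≤ 1) (hψ : AEStronglyMeasurable ψ ν)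
    (hψΦ : ∀ p, ψ (Φ p) = φ p.2) :
    ∫ x, φ x * (h x : ℂ) ∂μ = ∫ z, ψ z * (k z : ℂ) ∂ν := by
  have hmeas : AEStronglyMeasurable (fun z => ψ z * (k z : ℂ)) ν := hψ.mul hk.ofReal.1
  have hint : Integrable (fun p => φ p.2 * (k (Φ p) : ℂ)) (ρ.prod μ) :=
    (hΦ.integrable_comp_of_integrable hk).ofReal.bdd_mul
      (hφ.comp measurable_snd).aestronglyMeasurable
      (Filter.Eventually.of_forall fun p => hφ_le p.2)
  calc ∫ x, φ x * (h x : ℂ) ∂μ = ∫ x, ∫ y, φ x * (k (Φ (y, x)) : ℂ) ∂ρ ∂μ := by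
        refine integral_congr_ae ?_
        filter_upwards [hh] with x hx
        rw [hx, integral_const_mul, integral_complex_ofReal]
    _ = ∫ p, ψ (Φ p) * (k (Φ p) : ℂ) ∂(ρ.prod μ) := by
        simp only [hψΦ]
        rw [integral_prod_symm _ hint]
    _ = ∫ z, ψ z * (k z : ℂ) ∂ν := by
        rw [← hΦ.map_eq] at hmeas ⊢
        rw [integral_map hΦ.aemeasurable hmeas]

lemma lintegral_mul_le_of_ae_eq_integral_comp (hΦ : MeasurePreserving Φ (ρ.prod μ) ν)
    (hk : Integrable k ν) (hh : h =ᵐ[μ] fun x => ∫ y, k (Φ (y, x)) ∂ρ) {W : X → ℝ≥0∞}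
    {V : Z → ℝ≥0∞} (hW : Measurable W) (hV : AEMeasurable V ν) (hVΦ : ∀ p, V (Φ p) = W p.2) :
    ∫⁻ x, W x * ‖h x‖ₑ ∂μ ≤ ∫⁻ z, V z * ‖k z‖ₑ ∂ν := by
  have hkΦ := hΦ.integrable_comp_of_integrable hk
  have hmeas : AEMeasurable (fun z => V z * ‖k z‖ₑ) ν := hV.mul hk.1.enorm
  have hmeasΦ : AEMeasurable (fun p : Y × X => W p.2 * ‖k (Φ p)‖ₑ) (ρ.prod μ) :=
    (hW.comp measurable_snd).aemeasurable.mul hkΦ.1.enorm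
  calc ∫⁻ x, W x * ‖h x‖ₑ ∂μ ≤ ∫⁻ x, ∫⁻ y, W x * ‖k (Φ (y, x))‖ₑ ∂ρ ∂μ := by
        refine lintegral_mono_ae ?_
        filter_upwards [hh, hkΦ.prod_left_ae] with x hx hint
        have hx_meas : AEMeasurable (fun y => ‖k (Φ (y, x))‖ₑ) ρ := hint.1.enorm
        rw [hx, lintegral_const_mul'' _ hx_meas]
        gcongr
        exact enorm_integral_le_lintegral_enorm _
    _ = ∫⁻ p, V (Φ p) * ‖k (Φ p)‖ₑ ∂(ρ.prod μ) := by
        simp only [hVΦ]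
        rw [lintegral_prod_symm _ hmeasΦ]
    _ = ∫⁻ z, V z * ‖k z‖ₑ ∂ν := by
        rw [← hΦ.map_eq] at hmeas ⊢
        rw [lintegral_map' hmeas hΦ.aemeasurable]

end Duality

/-- Lebesgue measure on the scattering angles, of total mass `2π`. -/
abbrev angleMeasure : Measure ℝ := volume.restrict (Ioc 0 (2 * π))

lemma angleMean_eq_integral {E : Type*} [NormedAddCommGroup E] [NormedSpace ℝ E] (F : ℝ → E) :
    angleMean F = (2 * π)⁻¹ • ∫ θ, F θ ∂angleMeasure := by
  rw [angleMean, intervalIntegral.integral_of_le Real.two_pi_pos.le]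

lemma lintegral_ofReal_angleMeasure {F : ℝ → ℝ} (hF : Continuous F) (hF_nonneg : ∀ θ, 0 ≤ F θ) :
    ∫⁻ θ, ENNReal.ofReal ((2 * π)⁻¹ * F θ) ∂angleMeasure = ENNReal.ofReal (angleMean F) := by
  have hpi : (0 : ℝ) ≤ (2 * π)⁻¹ := inv_nonneg.2 Real.two_pi_pos.le
  have hint : Integrable (fun θ => (2 * π)⁻¹ * F θ) angleMeasure :=
    ((hF.intervalIntegrable 0 (2 * π)).1).const_mul _
  rw [← ofReal_integral_eq_lintegral_ofReal hint
      (Filter.Eventually.of_forall fun θ => mul_nonneg hpi (hF_nonneg θ)), integral_const_mul,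
    angleMean_eq_integral, smul_eq_mul]

section Collisions

variable {ι : Type*} [DecidableEq ι]

lemma collide_neg_collide {a b : ι} (hab : a ≠ b) (θ : ℝ) (x : Vel ι) :
    collide a b (-θ) (collide a b θ x) = x := by
  ext i
  obtain rfl | hb := eq_or_ne i b
  · simp only [collide, Real.cos_neg, Real.sin_neg, Function.update_self,
      Function.update_of_ne hab]
    linear_combination x i * Real.sin_sq_add_cos_sq θ
  obtain rfl | ha := eq_or_ne i a
  · simp only [collide, Real.cos_neg, Real.sin_neg, Function.update_self,
      Function.update_of_ne hb]
    linear_combination x i * Real.sin_sq_add_cos_sq θ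
  · simp only [collide, Function.update_of_ne hb, Function.update_of_ne ha]

lemma collideBath_neg_bathRotation (j : ι) (θ : ℝ) (p : Vel ι × ℝ) :
    collideBath j (-θ) (bathRotation j θ p).2 (bathRotation j θ p).1 = p.1 := by
  ext i
  obtain rfl | hj := eq_or_ne i j
  · simp only [collideBath, bathRotation, Real.cos_neg, Real.sin_neg, Function.update_self]
    linear_combination p.1 i * Real.sin_sq_add_cos_sq θ
  · simp only [collideBath, bathRotation, Function.update_of_ne hj]

lemma continuous_collide_neg (a b : ι) :
    Continuous fun p : ℝ × Vel ι => collide a b (-p.1) p.2 := by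
  unfold collide
  fun_prop

lemma continuous_collideBath_neg (j : ι) :
    Continuous fun p : ℝ × (Vel ι × ℝ) => collideBath j (-p.1) p.2.2 p.2.1 := by
  unfold collideBath
  fun_prop

variable [Fintype ι]

lemma collisionOp_ae_eq_integral {a b : ι} (hab : a ≠ b) (f : Vel ι →₁[volume] ℝ) :
    collisionOp a b hab f =ᵐ[volume]
      fun x => ∫ θ, (2 * π)⁻¹ * f (collide a b θ x) ∂angleMeasure := by
  filter_upwards [coeFn_collisionOp a b hab f] with x hx
  rw [hx, collisionMean, intervalIntegral.integral_of_le Real.two_pi_pos.le, integral_const_mul]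

lemma thermostatOp_ae_eq_integral (j : ι) (f : Vel ι →₁[volume] ℝ) :
    thermostatOp j f =ᵐ[volume] fun x => ∫ q, (2 * π)⁻¹ *
      (gauss (bathMap j (q, x)).2.2 * f (bathMap j (q, x)).2.1) ∂(angleMeasure.prod volume) := by
  filter_upwards [coeFn_thermostatOp j f,
    (integrable_bathKernel j f (L1.integrable_coeFn f)).prod_left_ae] with x hx hint
  rw [hx, integral_prod_symm _ hint]
  refine integral_congr_ae (Filter.Eventually.of_forall fun w => ?_)
  simp only [intervalIntegral.integral_of_le Real.two_pi_pos.le, ← integral_const_mul]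
  rfl

lemma integral_mul_collisionOp {a b : ι} (hab : a ≠ b) (f : Vel ι →₁[volume] ℝ)
    {φ : Vel ι → ℂ} (hφ : Continuous φ) (hφ_le : ∀ x, ‖φ x‖ ≤ 1) :
    ∫ x, φ x * (collisionOp a b hab f x : ℂ)
      = angleMean fun θ => ∫ y, φ (collide a b (-θ) y) * (f y : ℂ) := by
  have hf := (L1.integrable_coeFn f).comp_snd angleMeasure
  have hψ : Continuous fun p : ℝ × Vel ι => φ (collide a b (-p.1) p.2) :=
    hφ.comp (continuous_collide_neg a b)
  have hint : Integrable (fun p : ℝ × Vel ι => φ (collide a b (-p.1) p.2) * (f p.2 : ℂ))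
      (angleMeasure.prod volume) :=
    hf.ofReal.bdd_mul hψ.aestronglyMeasurable (Filter.Eventually.of_forall fun p => hφ_le _)
  rw [integral_mul_of_ae_eq_integral_comp (measurePreserving_angle_collide hab angleMeasure)
    (hf.const_mul (2 * π)⁻¹) (collisionOp_ae_eq_integral hab f) hφ.measurable hφ_le
    hψ.aestronglyMeasurable fun p => by rw [collide_neg_collide hab],
    angleMean_eq_integral, ← integral_prod _ hint, ← integral_smul]
  refine integral_congr_ae (Filter.Eventually.of_forall fun p => ?_)
  simp only [Complex.ofReal_mul, Complex.real_smul]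
  ring

lemma integral_mul_thermostatOp (j : ι) (f : Vel ι →₁[volume] ℝ)
    {φ : Vel ι → ℂ} (hφ : Continuous φ) (hφ_le : ∀ x, ‖φ x‖ ≤ 1) :
    ∫ x, φ x * (thermostatOp j f x : ℂ) = angleMean fun θ => ∫ q : Vel ι × ℝ,
      φ (collideBath j (-θ) q.2 q.1) * (gauss q.2 * f q.1 : ℝ) := by
  have hf : Integrable (fun p : ℝ × (Vel ι × ℝ) => gauss p.2.2 * f p.2.1)
      (angleMeasure.prod volume) := integrable_bath (L1.integrable_coeFn f)
  have hψ : Continuous fun p : ℝ × (Vel ι × ℝ) => φ (collideBath j (-p.1) p.2.2 p.2.1) :=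
    hφ.comp (continuous_collideBath_neg j)
  have hint : Integrable (fun p : ℝ × (Vel ι × ℝ) =>
      φ (collideBath j (-p.1) p.2.2 p.2.1) * (gauss p.2.2 * f p.2.1 : ℝ))
      (angleMeasure.prod volume) :=
    hf.ofReal.bdd_mul hψ.aestronglyMeasurable (Filter.Eventually.of_forall fun p => hφ_le _)
  rw [integral_mul_of_ae_eq_integral_comp (measurePreserving_bathMap j angleMeasure)
    (hf.const_mul (2 * π)⁻¹) (thermostatOp_ae_eq_integral j f) hφ.measurable hφ_le
    hψ.aestronglyMeasurable fun p => congrArg φ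
      (collideBath_neg_bathRotation j p.1.1 (p.2, p.1.2)),
    angleMean_eq_integral, ← integral_prod _ hint, ← integral_smul]
  refine integral_congr_ae (Filter.Eventually.of_forall fun p => ?_)
  simp only [Complex.ofReal_mul, Complex.real_smul]
  ring

lemma lintegral_mul_collisionOp_le {a b : ι} (hab : a ≠ b) (f : Vel ι →₁[volume] ℝ)
    {W V : Vel ι → ℝ} (hW : Continuous W) (hW_nonneg : ∀ x, 0 ≤ W x)
    (hV : ∀ x, angleMean (fun θ => W (collide a b (-θ) x)) ≤ V x) :
    ∫⁻ x, ENNReal.ofReal (W x) * ‖collisionOp a b hab f x‖ₑ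
      ≤ ∫⁻ x, ENNReal.ofReal (V x) * ‖f x‖ₑ := by
  have hf := (L1.integrable_coeFn f).comp_snd angleMeasure
  have hWc : Continuous fun p : ℝ × Vel ι => W (collide a b (-p.1) p.2) :=
    hW.comp (continuous_collide_neg a b)
  have hpi : (0 : ℝ) ≤ (2 * π)⁻¹ := inv_nonneg.2 Real.two_pi_pos.le
  have hmeas : AEMeasurable (fun p : ℝ × Vel ι =>
      ENNReal.ofReal ((2 * π)⁻¹ * W (collide a b (-p.1) p.2)) * ‖f p.2‖ₑ)
      (angleMeasure.prod volume) :=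
    (continuous_const.mul hWc).measurable.ennreal_ofReal.aemeasurable.mul hf.1.enorm
  calc ∫⁻ x, ENNReal.ofReal (W x) * ‖collisionOp a b hab f x‖ₑ
      ≤ ∫⁻ p : ℝ × Vel ι, ENNReal.ofReal (W (collide a b (-p.1) p.2)) * ‖(2 * π)⁻¹ * f p.2‖ₑ
          ∂(angleMeasure.prod volume) :=
        lintegral_mul_le_of_ae_eq_integral_comp (measurePreserving_angle_collide hab angleMeasure)
          (hf.const_mul _) (collisionOp_ae_eq_integral hab f) hW.measurable.ennreal_ofReal
          hWc.measurable.ennreal_ofReal.aemeasurable fun p => by rw [collide_neg_collide hab]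
    _ = ∫⁻ p : ℝ × Vel ι, ENNReal.ofReal ((2 * π)⁻¹ * W (collide a b (-p.1) p.2)) * ‖f p.2‖ₑ
          ∂(angleMeasure.prod volume) := lintegral_congr fun p => by
        rw [enorm_mul, Real.enorm_of_nonneg hpi, ENNReal.ofReal_mul hpi]
        ring
    _ ≤ ∫⁻ x, ENNReal.ofReal (V x) * ‖f x‖ₑ := by
        rw [lintegral_prod_symm _ hmeas]
        refine lintegral_mono fun x => ?_
        have hx : Continuous fun θ => W (collide a b (-θ) x) := hWc.comp (.prodMk_left x)
        have hx_meas : Measurable fun θ => ENNReal.ofReal ((2 * π)⁻¹ * W (collide a b (-θ) x)) :=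
          (hx.measurable.const_mul _).ennreal_ofReal
        simp only
        rw [lintegral_mul_const _ hx_meas, lintegral_ofReal_angleMeasure hx fun θ => hW_nonneg _]
        gcongr
        exact hV x

lemma lintegral_prod_prod_mul_le {Y Y' X : Type*} [MeasurableSpace Y] [MeasurableSpace Y']
    [MeasurableSpace X] {ρ : Measure Y} {τ : Measure Y'} {ν : Measure X} [SFinite ρ] [SFinite τ]
    [SFinite ν] {k : Y × (X × Y') → ℝ≥0∞} (hk : Measurable k) {F V : X → ℝ≥0∞}
    (hF : AEMeasurable F ν) (hV : ∀ x, ∫⁻ θ, ∫⁻ w, k (θ, (x, w)) ∂τ ∂ρ ≤ V x) :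
    ∫⁻ p, k p * F p.2.1 ∂(ρ.prod (ν.prod τ)) ≤ ∫⁻ x, V x * F x ∂ν := by
  have hF_fst : AEMeasurable (fun q : X × Y' => F q.1) (ν.prod τ) :=
    hF.comp_quasiMeasurePreserving Measure.quasiMeasurePreserving_fst
  have hF_snd : AEMeasurable (fun p : Y × (X × Y') => F p.2.1) (ρ.prod (ν.prod τ)) :=
    hF_fst.comp_quasiMeasurePreserving Measure.quasiMeasurePreserving_snd
  have hk_left : Measurable fun q : X × Y' => ∫⁻ θ, k (θ, q) ∂ρ := hk.lintegral_prod_left'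
  calc ∫⁻ p, k p * F p.2.1 ∂(ρ.prod (ν.prod τ))
      = ∫⁻ q, (∫⁻ θ, k (θ, q) ∂ρ) * F q.1 ∂(ν.prod τ) := by
        refine (lintegral_prod_symm _ (hk.aemeasurable.mul hF_snd)).trans ?_
        exact lintegral_congr fun q =>
          lintegral_mul_const (f := fun θ => k (θ, q)) (F q.1) (hk.comp measurable_prodMk_right)
    _ = ∫⁻ x, (∫⁻ w, ∫⁻ θ, k (θ, (x, w)) ∂ρ ∂τ) * F x ∂ν := by
        refine (lintegral_prod _ (hk_left.aemeasurable.mul hF_fst)).trans ?_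
        exact lintegral_congr fun x =>
          lintegral_mul_const (f := fun w => ∫⁻ θ, k (θ, (x, w)) ∂ρ) (F x)
            (hk_left.comp measurable_prodMk_left)
    _ ≤ ∫⁻ x, V x * F x ∂ν := by
        refine lintegral_mono fun x => mul_le_mul_left (le_of_eq_of_le ?_ (hV x)) _
        exact lintegral_lintegral_swap (f := fun w θ => k (θ, (x, w)))
          (hk.comp (by fun_prop : Measurable fun p : Y' × Y => (p.2, (x, p.1)))).aemeasurable

lemma lintegral_mul_thermostatOp_le {j : ι} (f : Vel ι →₁[volume] ℝ)
    {W V : Vel ι → ℝ} {U : ℝ → Vel ι → ℝ} (hW : Continuous W) (hW_nonneg : ∀ x, 0 ≤ W x)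
    (hU_integrable : ∀ θ x, Integrable fun w => W (collideBath j (-θ) w x) * gauss w)
    (hU : ∀ θ x, ∫ w, W (collideBath j (-θ) w x) * gauss w = U θ x)
    (hU_continuous : ∀ x, Continuous fun θ => U θ x) (hV : ∀ x, angleMean (fun θ => U θ x) ≤ V x) :
    ∫⁻ x, ENNReal.ofReal (W x) * ‖thermostatOp j f x‖ₑ
      ≤ ∫⁻ x, ENNReal.ofReal (V x) * ‖f x‖ₑ := by
  have hWc : Continuous fun p : ℝ × (Vel ι × ℝ) => W (collideBath j (-p.1) p.2.2 p.2.1) :=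
    hW.comp (continuous_collideBath_neg j)
  have hkernel : Continuous fun p : ℝ × (Vel ι × ℝ) =>
      (2 * π)⁻¹ * (W (collideBath j (-p.1) p.2.2 p.2.1) * gauss p.2.2) :=
    continuous_const.mul (hWc.mul (continuous_gauss.comp (by fun_prop)))
  have hpi : (0 : ℝ) ≤ (2 * π)⁻¹ := inv_nonneg.2 Real.two_pi_pos.le
  have hWg_nonneg : ∀ θ w x, 0 ≤ W (collideBath j (-θ) w x) * gauss w := fun θ w x =>
    mul_nonneg (hW_nonneg _) (gauss_nonneg _)
  have hbath : ∀ θ x, ∫⁻ w, ENNReal.ofReal ((2 * π)⁻¹ * (W (collideBath j (-θ) w x) * gauss w))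
      = ENNReal.ofReal ((2 * π)⁻¹ * U θ x) := fun θ x => by
    rw [← ofReal_integral_eq_lintegral_ofReal ((hU_integrable θ x).const_mul _)
      (Filter.Eventually.of_forall fun w => mul_nonneg hpi (hWg_nonneg θ w x)),
      integral_const_mul, hU]
  calc ∫⁻ x, ENNReal.ofReal (W x) * ‖thermostatOp j f x‖ₑ
      ≤ ∫⁻ p : ℝ × (Vel ι × ℝ), ENNReal.ofReal (W (collideBath j (-p.1) p.2.2 p.2.1)) *
          ‖(2 * π)⁻¹ * (gauss p.2.2 * f p.2.1)‖ₑ ∂(angleMeasure.prod volume) :=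
        lintegral_mul_le_of_ae_eq_integral_comp (measurePreserving_bathMap j angleMeasure)
          ((integrable_bath (L1.integrable_coeFn f)).const_mul _) (thermostatOp_ae_eq_integral j f)
          hW.measurable.ennreal_ofReal hWc.measurable.ennreal_ofReal.aemeasurable
          fun p => congrArg (fun x => ENNReal.ofReal (W x))
            (collideBath_neg_bathRotation j p.1.1 (p.2, p.1.2))
    _ = ∫⁻ p : ℝ × (Vel ι × ℝ), ENNReal.ofReal ((2 * π)⁻¹ *
          (W (collideBath j (-p.1) p.2.2 p.2.1) * gauss p.2.2)) * ‖f p.2.1‖ₑ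
          ∂(angleMeasure.prod volume) := lintegral_congr fun p => by
        rw [enorm_mul, enorm_mul, Real.enorm_of_nonneg hpi, Real.enorm_of_nonneg (gauss_nonneg _),
          ENNReal.ofReal_mul hpi, ENNReal.ofReal_mul (hW_nonneg _)]
        ring
    _ ≤ ∫⁻ x, ENNReal.ofReal (V x) * ‖f x‖ₑ := by
        refine lintegral_prod_prod_mul_le hkernel.measurable.ennreal_ofReal
          (Lp.aestronglyMeasurable f).enorm fun x => ?_
        simp only [hbath]
        rw [lintegral_ofReal_angleMeasure (hU_continuous x) fun θ => ?_]
        · exact ENNReal.ofReal_le_ofReal (hV x)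
        · rw [← hU]
          exact integral_nonneg fun w => hWg_nonneg θ w x

end Collisions

/-! ### Fourier transforms -/

section Fourier

variable {ι : Type*} [Fintype ι]

/-- The character `x ↦ exp (-2πi⟨x, ζ⟩)`, the kernel of the Fourier transform at `ζ`. -/
def planeWave (ζ x : Vel ι) : ℂ := Complex.exp (((-2 * π * inner ℝ x ζ : ℝ) : ℂ) * Complex.I)

lemma norm_planeWave (ζ x : Vel ι) : ‖planeWave ζ x‖ = 1 :=
  Complex.norm_exp_ofReal_mul_I _

lemma continuous_planeWave (ζ : Vel ι) : Continuous (planeWave ζ) := by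
  unfold planeWave
  fun_prop

lemma integrable_planeWave_mul (ζ : Vel ι) {f : Vel ι → ℝ} (hf : Integrable f) :
    Integrable fun x => planeWave ζ x * (f x : ℂ) :=
  hf.ofReal.bdd_mul (c := 1) (continuous_planeWave ζ).aestronglyMeasurable
    (Filter.Eventually.of_forall fun x => (norm_planeWave ζ x).le)

lemma fourier_eq_integral_planeWave (f : Vel ι → ℝ) (ζ : Vel ι) :
    𝓕 (fun v => (f v : ℂ)) ζ = ∫ x, planeWave ζ x * (f x : ℂ) := by
  rw [Real.fourier_eq']
  rfl

/-- The value at `ζ` of the Fourier transform, as a functional on `L¹`. -/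
def fourierAt (ζ : Vel ι) : (Vel ι →₁[volume] ℝ) →L[ℝ] ℂ :=
  LinearMap.mkContinuous
    { toFun := fun f => ∫ x, planeWave ζ x * (f x : ℂ)
      map_add' := fun f g => by
        rw [← integral_add (integrable_planeWave_mul ζ (L1.integrable_coeFn f))
          (integrable_planeWave_mul ζ (L1.integrable_coeFn g))]
        refine integral_congr_ae ?_
        filter_upwards [Lp.coeFn_add f g] with x hx
        rw [hx, Pi.add_apply, Complex.ofReal_add, mul_add]
      map_smul' := fun c f => by
        rw [RingHom.id_apply, ← integral_smul]
        refine integral_congr_ae ?_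
        filter_upwards [Lp.coeFn_smul c f] with x hx
        rw [hx, Pi.smul_apply, smul_eq_mul, Complex.ofReal_mul, Complex.real_smul, mul_left_comm] }
    1 fun f => by
      rw [one_mul, LinearMap.coe_mk, AddHom.coe_mk, L1.norm_eq_integral_norm]
      refine (norm_integral_le_integral_norm _).trans_eq
        (integral_congr_ae (.of_forall fun x => ?_))
      simp [norm_planeWave]

lemma fourierAt_apply (ζ : Vel ι) (f : Vel ι →₁[volume] ℝ) :
    fourierAt ζ f = ∫ x, planeWave ζ x * (f x : ℂ) := rfl

lemma norm_fourierAt_le (ζ : Vel ι) (f : Vel ι →₁[volume] ℝ) : ‖fourierAt ζ f‖ ≤ ‖f‖ := by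
  have hop : ‖fourierAt ζ‖ ≤ 1 := LinearMap.mkContinuous_norm_le _ zero_le_one _
  exact ((fourierAt ζ).le_of_opNorm_le hop f).trans_eq (one_mul _)

lemma fourier_coe (ζ : Vel ι) (f : Vel ι →₁[volume] ℝ) :
    𝓕 (fun v => (f v : ℂ)) ζ = fourierAt ζ f :=
  fourier_eq_integral_planeWave _ ζ

lemma continuous_fourierAt (f : Vel ι →₁[volume] ℝ) : Continuous fun ζ => fourierAt ζ f := by
  refine continuous_of_dominated (bound := fun x => ‖f x‖)
    (fun ζ => (integrable_planeWave_mul ζ (L1.integrable_coeFn f)).1)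
    (fun ζ => .of_forall fun x => by simp [norm_planeWave])
    (L1.integrable_coeFn f).norm (.of_forall fun x => ?_)
  unfold planeWave
  fun_prop

lemma maxwellian_eq_exp_norm_sq (x : Vel ι) : maxwellian x = Real.exp (-π * ‖x‖ ^ 2) := by
  simp only [maxwellian, gauss, ← Real.exp_sum, ← Finset.mul_sum, EuclideanSpace.norm_sq_eq,
    Real.norm_eq_abs, sq_abs]

lemma maxwellian_nonneg (x : Vel ι) : 0 ≤ maxwellian x :=
  Finset.prod_nonneg fun _ _ => gauss_nonneg _

lemma maxwellian_le_one (x : Vel ι) : maxwellian x ≤ 1 :=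
  Finset.prod_le_one (fun _ _ => gauss_nonneg _) fun _ _ => gauss_le_one _

lemma fourier_maxwellian (ζ : Vel ι) :
    𝓕 (fun v : Vel ι => (maxwellian v : ℂ)) ζ = maxwellian ζ := by
  have hpi : (π : ℂ) ≠ 0 := Complex.ofReal_ne_zero.2 Real.pi_ne_zero
  have hgaussian := fourier_gaussian_innerProductSpace (V := Vel ι) (b := (π : ℂ))
    (by simpa using Real.pi_pos) ζ
  rw [div_self hpi, Complex.one_cpow, one_mul, neg_mul, ← mul_neg, mul_div_right_comm, pow_two,
    mul_div_cancel_right₀ _ hpi] at hgaussian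
  simpa only [maxwellian_eq_exp_norm_sq, Complex.ofReal_exp, Complex.ofReal_mul,
    Complex.ofReal_neg, Complex.ofReal_pow, mul_neg, neg_mul] using hgaussian

lemma integral_exp_mul_gauss (s : ℝ) :
    ∫ w : ℝ, Complex.exp (((2 * π * w * s : ℝ) : ℂ) * Complex.I) * (gauss w : ℂ) = gauss s := by
  have hpi : (π : ℂ) ≠ 0 := Complex.ofReal_ne_zero.2 Real.pi_ne_zero
  have hgaussian := fourierIntegral_gaussian (b := (π : ℂ)) (by simpa using Real.pi_pos)
    (2 * π * s : ℂ)
  rw [div_self hpi, Complex.one_cpow, one_mul] at hgaussian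
  calc ∫ w : ℝ, Complex.exp (((2 * π * w * s : ℝ) : ℂ) * Complex.I) * (gauss w : ℂ)
      = ∫ w : ℝ, Complex.exp (Complex.I * (2 * π * s) * w) * Complex.exp (-π * w ^ 2) := by
        refine integral_congr_ae (.of_forall fun w => ?_)
        simp only [gauss]
        push_cast
        ring_nf
    _ = gauss s := by
        rw [hgaussian, gauss]
        push_cast
        congr 1
        field_simp
        ring

variable [DecidableEq ι]

lemma inner_collide_neg {a b : ι} (hab : a ≠ b) (θ : ℝ) (x ζ : Vel ι) :
    inner ℝ (collide a b (-θ) x) ζ = inner ℝ x (collide a b θ ζ) := by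
  have hinner : ∀ u v : Vel ι, inner ℝ u v = u a * v a + (u b * v b +
      ∑ i ∈ (Finset.univ.erase a).erase b, u i * v i) := fun u v => by
    rw [PiLp.inner_apply, ← Finset.add_sum_erase _ _ (Finset.mem_univ a),
      ← Finset.add_sum_erase _ _ (Finset.mem_erase.2 ⟨hab.symm, Finset.mem_univ b⟩)]
    simp [mul_comm]
  have hrest : ∑ i ∈ (Finset.univ.erase a).erase b, collide a b (-θ) x i * ζ i
      = ∑ i ∈ (Finset.univ.erase a).erase b, x i * collide a b θ ζ i :=
    Finset.sum_congr rfl fun i hi => by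
      have hib : i ≠ b := Finset.ne_of_mem_erase hi
      have hia : i ≠ a := Finset.ne_of_mem_erase (Finset.mem_of_mem_erase hi)
      simp [collide, hib, hia]
  rw [hinner, hinner, hrest]
  simp only [collide, hab, Function.update_self, ne_eq, not_false_eq_true,
    Function.update_of_ne, Real.cos_neg, Real.sin_neg]
  ring

lemma inner_collideBath_neg (j : ι) (θ w : ℝ) (x ζ : Vel ι) :
    inner ℝ (collideBath j (-θ) w x) ζ
      = inner ℝ x (collideBath j θ 0 ζ) - w * (ζ j * Real.sin θ) := by
  have hinner : ∀ u v : Vel ι, inner ℝ u v = u j * v j +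
      ∑ i ∈ Finset.univ.erase j, u i * v i := fun u v => by
    rw [PiLp.inner_apply, ← Finset.add_sum_erase _ _ (Finset.mem_univ j)]
    simp [mul_comm]
  have hrest : ∑ i ∈ Finset.univ.erase j, collideBath j (-θ) w x i * ζ i
      = ∑ i ∈ Finset.univ.erase j, x i * collideBath j θ 0 ζ i :=
    Finset.sum_congr rfl fun i hi => by
      have hij : i ≠ j := Finset.ne_of_mem_erase hi
      simp [collideBath, hij]
  rw [hinner, hinner, hrest]
  simp only [collideBath, Function.update_self, Real.cos_neg, Real.sin_neg]
  ring

lemma fourierAt_collisionOp {a b : ι} (hab : a ≠ b) (f : Vel ι →₁[volume] ℝ) (ζ : Vel ι) :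
    fourierAt ζ (collisionOp a b hab f) = angleMean fun θ => fourierAt (collide a b θ ζ) f := by
  rw [fourierAt_apply, integral_mul_collisionOp hab f (continuous_planeWave ζ)
    fun x => (norm_planeWave ζ x).le]
  simp only [fourierAt_apply, planeWave, inner_collide_neg hab]

lemma planeWave_collideBath_neg (j : ι) (θ w : ℝ) (x ζ : Vel ι) :
    planeWave ζ (collideBath j (-θ) w x) = planeWave (collideBath j θ 0 ζ) x *
      Complex.exp (((2 * π * w * (ζ j * Real.sin θ) : ℝ) : ℂ) * Complex.I) := by
  rw [planeWave, planeWave, inner_collideBath_neg, ← Complex.exp_add]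
  push_cast
  ring_nf

-- Integrating the bath velocity out turns its Maxwellian into the Gaussian of the frequency
-- that the rotation moves into the bath.
lemma fourierAt_thermostatOp (j : ι) (f : Vel ι →₁[volume] ℝ) (ζ : Vel ι) :
    fourierAt ζ (thermostatOp j f) = angleMean fun θ =>
      (gauss (ζ j * Real.sin θ) : ℂ) * fourierAt (collideBath j θ 0 ζ) f := by
  rw [fourierAt_apply, integral_mul_thermostatOp j f (continuous_planeWave ζ)
    fun x => (norm_planeWave ζ x).le]
  congr 1 with θ
  rw [fourierAt_apply, ← integral_exp_mul_gauss, mul_comm, Measure.volume_eq_prod,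
    ← integral_prod_mul]
  refine integral_congr_ae (.of_forall fun q => ?_)
  simp only [planeWave_collideBath_neg, Complex.ofReal_mul]
  ring

end Fourier

/-! ### Functionals that intertwine with collisions -/

section Frequencies

variable {ι : Type*} [DecidableEq ι]

lemma collide_zero (a b : ι) (θ : ℝ) : collide a b θ (0 : Vel ι) = 0 := by
  ext i
  by_cases hb : i = b <;> by_cases ha : i = a <;> simp [collide, hb, ha]

lemma collideBath_zero_zero (j : ι) (θ : ℝ) : collideBath j θ 0 (0 : Vel ι) = 0 := by
  ext i
  by_cases hj : i = j <;> simp [collideBath, hj]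

lemma continuous_collide_angle (a b : ι) (ζ : Vel ι) : Continuous fun θ => collide a b θ ζ := by
  unfold collide
  fun_prop

lemma continuous_collideBath_angle (j : ι) (ζ : Vel ι) :
    Continuous fun θ => collideBath j θ 0 ζ := by
  unfold collideBath
  fun_prop

variable [Fintype ι]

lemma norm_collide {a b : ι} (hab : a ≠ b) (θ : ℝ) (x : Vel ι) : ‖collide a b θ x‖ = ‖x‖ := by
  refine (sq_eq_sq₀ (norm_nonneg _) (norm_nonneg _)).1 ?_
  rw [← real_inner_self_eq_norm_sq, ← inner_collide_neg hab, collide_neg_collide hab,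
    real_inner_self_eq_norm_sq]

lemma norm_sq_collideBath_zero (j : ι) (θ : ℝ) (x : Vel ι) :
    ‖collideBath j θ 0 x‖ ^ 2 = ‖x‖ ^ 2 - (x j * Real.sin θ) ^ 2 := by
  simp only [EuclideanSpace.norm_sq_eq, Real.norm_eq_abs, sq_abs]
  change ∑ i, (Function.update _ j _ i) ^ 2 = _
  rw [sum_sq_update]
  linear_combination (x j ^ 2) * Real.sin_sq_add_cos_sq θ

lemma maxwellian_collide {a b : ι} (hab : a ≠ b) (θ : ℝ) (x : Vel ι) :
    maxwellian (collide a b θ x) = maxwellian x := by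
  rw [maxwellian_eq_exp_norm_sq, maxwellian_eq_exp_norm_sq, norm_collide hab]

lemma gauss_mul_maxwellian_collideBath (j : ι) (θ : ℝ) (x : Vel ι) :
    gauss (x j * Real.sin θ) * maxwellian (collideBath j θ 0 x) = maxwellian x := by
  rw [maxwellian_eq_exp_norm_sq, maxwellian_eq_exp_norm_sq, norm_sq_collideBath_zero, gauss,
    ← Real.exp_add]
  ring_nf

end Frequencies

section Covariant

variable {ι : Type*} [Fintype ι]

/-- The Fourier transform at `ζ` of the deviation from the Maxwellian of the same mass, as a
functional on `L¹`. -/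
def deviationAt (ζ : Vel ι) : (Vel ι →₁[volume] ℝ) →L[ℝ] ℂ :=
  fourierAt ζ - maxwellian ζ • fourierAt 0

lemma deviationAt_apply (ζ : Vel ι) (f : Vel ι →₁[volume] ℝ) :
    deviationAt ζ f = fourierAt ζ f - maxwellian ζ * fourierAt 0 f := rfl

variable [DecidableEq ι]

/-- The family `ψ` of functionals intertwines the collision of `a` and `b` with the same collision
of frequencies. -/
def CollisionCovariant (ψ : Vel ι → (Vel ι →₁[volume] ℝ) →L[ℝ] ℂ) (a b : ι) (hab : a ≠ b) : Prop :=
  ∀ ζ f, ψ ζ (collisionOp a b hab f) = angleMean fun θ => ψ (collide a b θ ζ) f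

/-- The family `ψ` of functionals intertwines the thermostat acting on `j` with a rotation of the
`j`-th frequency into the bath, the bath contributing the factor `gauss`. -/
def ThermostatCovariant (ψ : Vel ι → (Vel ι →₁[volume] ℝ) →L[ℝ] ℂ) (j : ι) : Prop :=
  ∀ ζ f, ψ ζ (thermostatOp j f)
    = angleMean fun θ => (gauss (ζ j * Real.sin θ) : ℂ) * ψ (collideBath j θ 0 ζ) f

lemma collisionCovariant_fourierAt {a b : ι} (hab : a ≠ b) :
    CollisionCovariant (fourierAt : Vel ι → _) a b hab :=
  fun ζ f => fourierAt_collisionOp hab f ζ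

lemma thermostatCovariant_fourierAt (j : ι) :
    ThermostatCovariant (fourierAt : Vel ι → _) j :=
  fun ζ f => fourierAt_thermostatOp j f ζ

lemma CollisionCovariant.opLe {ψ : Vel ι → (Vel ι →₁[volume] ℝ) →L[ℝ] ℂ} {a b : ι} {hab : a ≠ b}
    (hψ : CollisionCovariant ψ a b hab) {w : Vel ι → ℝ} (hw : ∀ ζ, 0 ≤ w ζ)
    (hw_collide : ∀ ζ θ, w (collide a b θ ζ) = w ζ) :
    (functionalSeminorm ψ w).OpLe (collisionOp a b hab) 1 := by
  refine .of_forall_le_ofReal one_pos fun f C hC hf => ?_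
  rw [functionalSeminorm_le_ofReal_iff hw hC] at hf
  rw [one_mul, functionalSeminorm_le_ofReal_iff hw hC]
  intro ζ
  rw [hψ]
  exact norm_angleMean_le fun θ => hw_collide ζ θ ▸ hf _

lemma ThermostatCovariant.opLe {ψ : Vel ι → (Vel ι →₁[volume] ℝ) →L[ℝ] ℂ} {j : ι}
    (hψ : ThermostatCovariant ψ j) {w : Vel ι → ℝ} (hw : ∀ ζ, 0 ≤ w ζ)
    (hw_collide : ∀ ζ θ, w (collideBath j θ 0 ζ) ≤ w ζ) :
    (functionalSeminorm ψ w).OpLe (thermostatOp j) 1 := by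
  refine .of_forall_le_ofReal one_pos fun f C hC hf => ?_
  rw [functionalSeminorm_le_ofReal_iff hw hC] at hf
  rw [one_mul, functionalSeminorm_le_ofReal_iff hw hC]
  intro ζ
  rw [hψ]
  refine norm_angleMean_le fun θ => ?_
  rw [norm_mul, norm_ofReal_gauss]
  calc gauss (ζ j * Real.sin θ) * ‖ψ (collideBath j θ 0 ζ) f‖
      ≤ ‖ψ (collideBath j θ 0 ζ) f‖ := mul_le_of_le_one_left (norm_nonneg _) (gauss_le_one _)
    _ ≤ C * w (collideBath j θ 0 ζ) := hf _
    _ ≤ C * w ζ := by gcongr; exact hw_collide ζ θ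

lemma fourierAt_zero_collisionOp {a b : ι} (hab : a ≠ b) (f : Vel ι →₁[volume] ℝ) :
    fourierAt 0 (collisionOp a b hab f) = fourierAt 0 f := by
  rw [collisionCovariant_fourierAt hab]
  simp only [collide_zero, angleMean_const]

lemma fourierAt_zero_thermostatOp (j : ι) (f : Vel ι →₁[volume] ℝ) :
    fourierAt 0 (thermostatOp j f) = fourierAt 0 f := by
  rw [thermostatCovariant_fourierAt j]
  simp [collideBath_zero_zero, gauss, angleMean_const]

lemma collisionCovariant_deviationAt {a b : ι} (hab : a ≠ b) :
    CollisionCovariant (deviationAt : Vel ι → _) a b hab := fun ζ f => by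
  have hcont : Continuous fun θ => fourierAt (collide a b θ ζ) f :=
    (continuous_fourierAt f).comp (continuous_collide_angle a b ζ)
  simp only [deviationAt_apply, maxwellian_collide hab]
  rw [angleMean_sub hcont continuous_const, angleMean_const, fourierAt_zero_collisionOp,
    collisionCovariant_fourierAt hab]

lemma continuous_gauss_mul_fourierAt_collideBath (j : ι) (f : Vel ι →₁[volume] ℝ) (ζ : Vel ι) :
    Continuous fun θ =>
      (gauss (ζ j * Real.sin θ) : ℂ) * fourierAt (collideBath j θ 0 ζ) f :=
  (continuous_ofReal_gauss_comp (by fun_prop)).mul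
    ((continuous_fourierAt f).comp (continuous_collideBath_angle j ζ))

lemma thermostatCovariant_deviationAt (j : ι) :
    ThermostatCovariant (deviationAt : Vel ι → _) j := fun ζ f => by
  have hsplit : ∀ θ, (gauss (ζ j * Real.sin θ) : ℂ) * deviationAt (collideBath j θ 0 ζ) f
      = (gauss (ζ j * Real.sin θ) : ℂ) * fourierAt (collideBath j θ 0 ζ) f
        - maxwellian ζ * fourierAt 0 f := fun θ => by
    rw [deviationAt_apply, mul_sub, ← mul_assoc, ← Complex.ofReal_mul,
      gauss_mul_maxwellian_collideBath]
  simp only [hsplit]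
  rw [angleMean_sub (continuous_gauss_mul_fourierAt_collideBath j f ζ) continuous_const,
    angleMean_const, deviationAt_apply, fourierAt_zero_thermostatOp,
    thermostatCovariant_fourierAt j]

end Covariant

/-! ### Seminorms along the two evolutions -/

namespace LscSeminorm

variable {M N : ℕ} {p : LscSeminorm (State M N)} {lamS lamR mu t b : ℝ}

lemma growthLe_genS (hM : 0 < M) (hlamS : 0 ≤ lamS) (hS : ∀ (i j : Fin M) (hij : i ≠ j),
      p.OpLe (collisionOp (Sum.inl i) (Sum.inl j) (Sum.inl_injective.ne hij)) 1) :
    p.GrowthLe (genS M N lamS) 0 := by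
  have hM1 : (1 : ℝ) ≤ M := Nat.one_le_cast.2 hM
  have hsum : p.GrowthLe (∑ q : {q : Fin M × Fin M // q.1 < q.2}, (collisionOp
      (Sum.inl q.1.1) (Sum.inl q.1.2) (Sum.inl_injective.ne q.2.ne) - 1)) 0 :=
    growthLe_sum_sub_one fun q => hS q.1.1 q.1.2 q.2.ne
  simpa only [genS, mul_zero] using hsum.smul (div_nonneg hlamS (sub_nonneg.2 hM1))

lemma growthLe_genR (hN : 0 < N) (hlamR : 0 ≤ lamR) (hR : ∀ (i j : Fin N) (hij : i ≠ j),
      p.OpLe (collisionOp (Sum.inr i) (Sum.inr j) (Sum.inr_injective.ne hij)) 1) :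
    p.GrowthLe (genR M N lamR) 0 := by
  have hN1 : (1 : ℝ) ≤ N := Nat.one_le_cast.2 hN
  have hsum : p.GrowthLe (∑ q : {q : Fin N × Fin N // q.1 < q.2}, (collisionOp
      (Sum.inr q.1.1) (Sum.inr q.1.2) (Sum.inr_injective.ne q.2.ne) - 1)) 0 :=
    growthLe_sum_sub_one fun q => hR q.1.1 q.1.2 q.2.ne
  simpa only [genR, mul_zero] using hsum.smul (div_nonneg hlamR (sub_nonneg.2 hN1))

lemma growthLe_genI (hmu : 0 ≤ mu) (hI : ∀ (i : Fin M) (j : Fin N),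
      p.OpLe (collisionOp (Sum.inl i) (Sum.inr j) Sum.inl_ne_inr) 1) :
    p.GrowthLe (genI M N mu) 0 := by
  have hsum := (growthLe_sum_sub_one fun q : Fin M × Fin N => hI q.1 q.2).smul
    (div_nonneg hmu N.cast_nonneg)
  rwa [mul_zero, Fintype.sum_prod_type' (f := fun i j =>
    collisionOp (Sum.inl i) (Sum.inr j) Sum.inl_ne_inr - 1)] at hsum

lemma growthLe_genT (hmu : 0 ≤ mu) (hb : 0 ≤ b)
    (hT : p.OpLe (∑ i : Fin M, thermostatOp (Sum.inl i)) b) :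
    p.GrowthLe (genT M N mu) (mu * (b - M)) := by
  simpa only [genT, Fintype.card_fin] using (hT.growthLe_sum_sub_one hb).smul hmu

lemma thermostatEvolution_le (hM : 0 < M) (hlamS : 0 ≤ lamS) (hmu : 0 ≤ mu) (ht : 0 ≤ t)
    (hb : 0 ≤ b) (hS : ∀ (i j : Fin M) (hij : i ≠ j),
      p.OpLe (collisionOp (Sum.inl i) (Sum.inl j) (Sum.inl_injective.ne hij)) 1)
    (hT : p.OpLe (∑ i : Fin M, thermostatOp (Sum.inl i)) b) (f : State M N) :
    p (thermostatEvolution lamS mu t f)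
      ≤ ENNReal.ofReal (Real.exp (t * (mu * (b - M)))) * p f := by
  have hgrowth := (growthLe_genS hM hlamS hS).add (growthLe_genT hmu hb hT)
  rw [zero_add] at hgrowth
  exact hgrowth.exp_smul ht f

lemma finiteEvolution_le (hM : 0 < M) (hN : 0 < N) (hlamS : 0 ≤ lamS) (hlamR : 0 ≤ lamR)
    (hmu : 0 ≤ mu) (ht : 0 ≤ t) (hcollision : ∀ a b hab, p.OpLe (collisionOp a b hab) 1)
    (f : State M N) : p (finiteEvolution lamS lamR mu t f) ≤ p f := by
  have hgrowth := ((growthLe_genS hM hlamS fun _ _ _ => hcollision _ _ _).add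
    (growthLe_genR hN hlamR fun _ _ _ => hcollision _ _ _)).add
      (growthLe_genI hmu fun _ _ => hcollision _ _ _)
  simp only [add_zero] at hgrowth
  simpa only [finiteEvolution, genFinite, mul_zero, Real.exp_zero, ENNReal.ofReal_one, one_mul]
    using hgrowth.exp_smul ht f

end LscSeminorm

/-! ### The system and the reservoir -/

section Split

variable {M N : ℕ}

/-- The vector `ζ` with its reservoir entries set to zero. -/
def sysOnly (ζ : Vel (Fin M ⊕ Fin N)) : Vel (Fin M ⊕ Fin N) :=
  WithLp.toLp 2 (Sum.elim (fun i => ζ (Sum.inl i)) fun _ => 0)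

@[simp] lemma sysOnly_inl (ζ : Vel (Fin M ⊕ Fin N)) (i : Fin M) :
    sysOnly ζ (Sum.inl i) = ζ (Sum.inl i) := rfl

@[simp] lemma sysOnly_inr (ζ : Vel (Fin M ⊕ Fin N)) (j : Fin N) :
    sysOnly ζ (Sum.inr j) = 0 := rfl

@[simp] lemma sysPart_apply (ζ : Vel (Fin M ⊕ Fin N)) (i : Fin M) :
    sysPart ζ i = ζ (Sum.inl i) := rfl

@[simp] lemma resPart_apply (ζ : Vel (Fin M ⊕ Fin N)) (j : Fin N) :
    resPart ζ j = ζ (Sum.inr j) := rfl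

lemma sysPart_sysOnly (ζ : Vel (Fin M ⊕ Fin N)) : sysPart (sysOnly ζ) = sysPart ζ := rfl

lemma resPart_sysOnly (ζ : Vel (Fin M ⊕ Fin N)) : resPart (sysOnly ζ) = 0 := rfl

lemma sysPart_collide (i j : Fin M) (θ : ℝ) (ζ : Vel (Fin M ⊕ Fin N)) :
    sysPart (collide (Sum.inl i) (Sum.inl j) θ ζ) = collide i j θ (sysPart ζ) := by
  ext k
  simp only [sysPart_apply, collide, Function.update_apply, Sum.inl.injEq]

lemma resPart_collide (i j : Fin M) (θ : ℝ) (ζ : Vel (Fin M ⊕ Fin N)) :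
    resPart (collide (Sum.inl i) (Sum.inl j) θ ζ) = resPart ζ := by
  ext k
  simp [collide]

lemma sysOnly_collide (i j : Fin M) (θ : ℝ) (ζ : Vel (Fin M ⊕ Fin N)) :
    sysOnly (collide (Sum.inl i) (Sum.inl j) θ ζ)
      = collide (Sum.inl i) (Sum.inl j) θ (sysOnly ζ) := by
  ext k
  rcases k with k | k
  · simp only [sysOnly_inl, collide, Function.update_apply]
  · simp [collide]

lemma sysPart_collideBath (i : Fin M) (θ : ℝ) (ζ : Vel (Fin M ⊕ Fin N)) :
    sysPart (collideBath (Sum.inl i) θ 0 ζ) = collideBath i θ 0 (sysPart ζ) := by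
  ext k
  simp only [sysPart_apply, collideBath, Function.update_apply, Sum.inl.injEq]

lemma resPart_collideBath (i : Fin M) (θ : ℝ) (ζ : Vel (Fin M ⊕ Fin N)) :
    resPart (collideBath (Sum.inl i) θ 0 ζ) = resPart ζ := by
  ext k
  simp [collideBath]

lemma sysOnly_collideBath (i : Fin M) (θ : ℝ) (ζ : Vel (Fin M ⊕ Fin N)) :
    sysOnly (collideBath (Sum.inl i) θ 0 ζ) = collideBath (Sum.inl i) θ 0 (sysOnly ζ) := by
  ext k
  rcases k with k | k
  · simp only [sysOnly_inl, collideBath, Function.update_apply]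
  · simp [collideBath]

lemma maxwellian_split (ζ : Vel (Fin M ⊕ Fin N)) :
    maxwellian ζ = maxwellian (sysPart ζ) * maxwellian (resPart ζ) :=
  Fintype.prod_sum_type _

lemma norm_sq_split (ζ : Vel (Fin M ⊕ Fin N)) :
    ‖ζ‖ ^ 2 = ‖sysPart ζ‖ ^ 2 + ‖resPart ζ‖ ^ 2 := by
  simp only [EuclideanSpace.norm_sq_eq, Fintype.sum_sum_type, sysPart_apply, resPart_apply]

lemma planeWave_split (ζ x : Vel (Fin M ⊕ Fin N)) :
    planeWave ζ x = planeWave (sysPart ζ) (sysPart x) * planeWave (resPart ζ) (resPart x) := by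
  have hinner : inner ℝ x ζ
      = inner ℝ (sysPart x) (sysPart ζ) + inner ℝ (resPart x) (resPart ζ) := by
    simp only [PiLp.inner_apply, Fintype.sum_sum_type, sysPart_apply, resPart_apply]
  rw [planeWave, planeWave, planeWave, ← Complex.exp_add, hinner]
  congr 1
  push_cast
  ring

/-- The Fourier transform at `ζ` of the difference between a state and the product of its system
marginal with a Maxwellian reservoir, as a functional on `L¹`. -/
def correlationAt (ζ : Vel (Fin M ⊕ Fin N)) : State M N →L[ℝ] ℂ :=
  fourierAt ζ - maxwellian (resPart ζ) • fourierAt (sysOnly ζ)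

lemma correlationAt_apply (ζ : Vel (Fin M ⊕ Fin N)) (f : State M N) :
    correlationAt ζ f = fourierAt ζ f - maxwellian (resPart ζ) * fourierAt (sysOnly ζ) f := rfl

lemma collisionCovariant_correlationAt {i j : Fin M} (hij : i ≠ j) :
    CollisionCovariant (correlationAt : Vel (Fin M ⊕ Fin N) → _) (Sum.inl i) (Sum.inl j)
      (Sum.inl_injective.ne hij) := fun ζ f => by
  have hcont : ∀ ζ : Vel (Fin M ⊕ Fin N), Continuous fun θ =>
      fourierAt (collide (Sum.inl i) (Sum.inl j) θ ζ) f := fun ζ =>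
    (continuous_fourierAt f).comp (continuous_collide_angle _ _ ζ)
  simp only [correlationAt_apply, resPart_collide, sysOnly_collide]
  rw [angleMean_sub (hcont ζ) ((hcont (sysOnly ζ)).const_mul _), angleMean_const_mul,
    collisionCovariant_fourierAt, collisionCovariant_fourierAt]

lemma thermostatCovariant_correlationAt (i : Fin M) :
    ThermostatCovariant (correlationAt : Vel (Fin M ⊕ Fin N) → _) (Sum.inl i) := fun ζ f => by
  have hcont := continuous_gauss_mul_fourierAt_collideBath (Sum.inl i) f
  have hcont_sys := hcont (sysOnly ζ)
  rw [sysOnly_inl] at hcont_sys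
  simp only [correlationAt_apply, resPart_collideBath, sysOnly_collideBath, mul_sub,
    mul_left_comm _ ((maxwellian (resPart ζ) : ℝ) : ℂ)]
  rw [angleMean_sub (hcont ζ) (hcont_sys.const_mul _), angleMean_const_mul,
    thermostatCovariant_fourierAt, thermostatCovariant_fourierAt, sysOnly_inl]

lemma fourierAt_initialState {l : Vel (Fin M) → ℝ} (hl : Integrable l)
    (ζ : Vel (Fin M ⊕ Fin N)) :
    fourierAt ζ (initialState N hl)
      = 𝓕 (fun v => (l v : ℂ)) (sysPart ζ) * maxwellian (resPart ζ) := by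
  have hsplit := measurePreserving_split M N
  have hint : Integrable fun p : Vel (Fin M) × Vel (Fin N) =>
      (planeWave (sysPart ζ) p.1 * (l p.1 : ℂ)) * (planeWave (resPart ζ) p.2 * maxwellian p.2) :=
    (integrable_planeWave_mul _ hl).mul_prod (integrable_planeWave_mul _ integrable_maxwellian)
  calc fourierAt ζ (initialState N hl)
      = ∫ p : Vel (Fin M) × Vel (Fin N), (planeWave (sysPart ζ) p.1 * (l p.1 : ℂ)) *
          (planeWave (resPart ζ) p.2 * maxwellian p.2) := by
        rw [← hsplit.map_eq, integral_map hsplit.aemeasurable (by rw [hsplit.map_eq]; exact hint.1),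
          fourierAt_apply]
        refine integral_congr_ae ?_
        filter_upwards [(integrable_initial (N := N) hl).coeFn_toL1] with x hx
        rw [initialState, hx, planeWave_split]
        push_cast
        ring
    _ = 𝓕 (fun v => (l v : ℂ)) (sysPart ζ) * maxwellian (resPart ζ) := by
        rw [← fourier_maxwellian, fourier_eq_integral_planeWave, fourier_eq_integral_planeWave]
        exact integral_prod_mul (fun v => planeWave (sysPart ζ) v * (l v : ℂ))
          (fun w => planeWave (resPart ζ) w * (maxwellian w : ℂ))

lemma maxwellian_zero {ι : Type*} [Fintype ι] : maxwellian (0 : Vel ι) = 1 := by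
  simp [maxwellian_eq_exp_norm_sq]

lemma fourier_zero_eq_integral {ι : Type*} [Fintype ι] (f : Vel ι → ℝ) :
    𝓕 (fun v => (f v : ℂ)) 0 = ((∫ v, f v : ℝ) : ℂ) := by
  rw [fourier_eq_integral_planeWave, ← integral_complex_ofReal]
  simp [planeWave]

lemma integral_maxwellian {ι : Type*} [Fintype ι] : ∫ v : Vel ι, maxwellian v = 1 := by
  have hzero := fourier_maxwellian (0 : Vel ι)
  rw [fourier_zero_eq_integral, maxwellian_zero] at hzero
  exact Complex.ofReal_injective hzero

lemma correlationAt_initialState {l : Vel (Fin M) → ℝ} (hl : Integrable l)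
    (ζ : Vel (Fin M ⊕ Fin N)) : correlationAt ζ (initialState N hl) = 0 := by
  rw [correlationAt_apply, fourierAt_initialState, fourierAt_initialState, sysPart_sysOnly,
    resPart_sysOnly, maxwellian_zero]
  push_cast
  ring

lemma fourierAt_zero_initialState {l : Vel (Fin M) → ℝ} (hl : Integrable l)
    (hl_mass : ∫ v, l v = 1) : fourierAt 0 (initialState N hl) = 1 := by
  have hsys : sysPart (0 : Vel (Fin M ⊕ Fin N)) = 0 := rfl
  have hres : resPart (0 : Vel (Fin M ⊕ Fin N)) = 0 := rfl
  rw [fourierAt_initialState, hsys, hres, maxwellian_zero, fourier_zero_eq_integral, hl_mass,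
    Complex.ofReal_one, one_mul]

lemma norm_deviationAt_initialState_le {l : Vel (Fin M) → ℝ} (hl : Integrable l)
    (hl_mass : ∫ v, l v = 1) {D : ℝ}
    (hD : ∀ ξ, ‖𝓕 (fun v => (l v : ℂ)) ξ
      - 𝓕 (fun v : Vel (Fin M) => (maxwellian v : ℂ)) ξ‖ ≤ D * ‖ξ‖ ^ 2)
    (ζ : Vel (Fin M ⊕ Fin N)) :
    ‖deviationAt ζ (initialState N hl)‖ ≤ D * ‖sysPart ζ‖ ^ 2 := by
  have hfactor : deviationAt ζ (initialState N hl)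
      = (𝓕 (fun v => (l v : ℂ)) (sysPart ζ)
        - 𝓕 (fun v : Vel (Fin M) => (maxwellian v : ℂ)) (sysPart ζ))
        * maxwellian (resPart ζ) := by
    rw [deviationAt_apply, fourierAt_zero_initialState hl hl_mass, fourierAt_initialState,
      maxwellian_split, fourier_maxwellian]
    push_cast
    ring
  rw [hfactor, norm_mul, Complex.norm_real, Real.norm_of_nonneg (maxwellian_nonneg _)]
  exact (mul_le_of_le_one_right (norm_nonneg _) (maxwellian_le_one _)).trans (hD _)

lemma norm_sysPart_sq (ζ : Vel (Fin M ⊕ Fin N)) : ‖sysPart ζ‖ ^ 2 = ∑ i, ζ (Sum.inl i) ^ 2 := by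
  simp [EuclideanSpace.norm_sq_eq]

variable (M N) in
/-- The distance of a state to the Maxwellian of the same mass, as in `gtwDist` but weighted with
the system frequencies only. -/
def deviationSeminorm : LscSeminorm (State M N) :=
  functionalSeminorm deviationAt fun ζ => ‖sysPart ζ‖ ^ 2

lemma deviationSeminorm_le_ofReal_iff {f : State M N} {C : ℝ} (hC : 0 ≤ C) :
    deviationSeminorm M N f ≤ ENNReal.ofReal C
      ↔ ∀ ζ, ‖deviationAt ζ f‖ ≤ C * ‖sysPart ζ‖ ^ 2 :=
  functionalSeminorm_le_ofReal_iff (fun _ => sq_nonneg _) hC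

lemma norm_deviationAt_thermostatOp_le {f : State M N} {C : ℝ}
    (hf : ∀ ζ, ‖deviationAt ζ f‖ ≤ C * ‖sysPart ζ‖ ^ 2) (i : Fin M)
    (ζ : Vel (Fin M ⊕ Fin N)) :
    ‖deviationAt ζ (thermostatOp (Sum.inl i) f)‖
      ≤ C * ‖sysPart ζ‖ ^ 2 - C / 2 * ζ (Sum.inl i) ^ 2 := by
  rw [thermostatCovariant_deviationAt]
  calc ‖angleMean fun θ => (gauss (ζ (Sum.inl i) * Real.sin θ) : ℂ)
          * deviationAt (collideBath (Sum.inl i) θ 0 ζ) f‖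
      ≤ angleMean fun θ => C * ‖sysPart ζ‖ ^ 2 * Real.cos θ ^ 2 + 0 * (Real.cos θ * Real.sin θ)
          + (C * ‖sysPart ζ‖ ^ 2 - C * ζ (Sum.inl i) ^ 2) * Real.sin θ ^ 2 := by
        refine norm_angleMean_le_angleMean (by fun_prop) fun θ => ?_
        rw [norm_mul, norm_ofReal_gauss]
        refine (mul_le_of_le_one_left (norm_nonneg _) (gauss_le_one _)).trans
          ((hf _).trans_eq ?_)
        rw [sysPart_collideBath, norm_sq_collideBath_zero, sysPart_apply]
        linear_combination -C * ‖sysPart ζ‖ ^ 2 * Real.sin_sq_add_cos_sq θ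
    _ = C * ‖sysPart ζ‖ ^ 2 - C / 2 * ζ (Sum.inl i) ^ 2 := by
        rw [angleMean_quadratic]
        ring

lemma opLe_deviationSeminorm_sum_thermostatOp (hM : 0 < M) :
    (deviationSeminorm M N).OpLe (∑ i : Fin M, thermostatOp (Sum.inl i)) (M - 1 / 2) := by
  have hM1 : (1 : ℝ) ≤ M := Nat.one_le_cast.2 hM
  refine .of_forall_le_ofReal (by linarith) fun f C hC hf => ?_
  rw [deviationSeminorm_le_ofReal_iff hC] at hf
  rw [deviationSeminorm_le_ofReal_iff (mul_nonneg (by linarith) hC)]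
  intro ζ
  have hsum : (∑ i : Fin M, thermostatOp (Sum.inl i) : State M N →L[ℝ] State M N) f
      = ∑ i : Fin M, thermostatOp (Sum.inl i) f := sum_apply _ _ _
  rw [hsum, map_sum]
  calc ‖∑ i : Fin M, deviationAt ζ (thermostatOp (Sum.inl i) f)‖
      ≤ ∑ i : Fin M, (C * ‖sysPart ζ‖ ^ 2 - C / 2 * ζ (Sum.inl i) ^ 2) :=
        (norm_sum_le _ _).trans (Finset.sum_le_sum fun i _ =>
          norm_deviationAt_thermostatOp_le hf i ζ)
    _ = (M - 1 / 2) * C * ‖sysPart ζ‖ ^ 2 := by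
        rw [Finset.sum_sub_distrib, ← Finset.mul_sum (a := C / 2), ← norm_sysPart_sq,
          Finset.sum_const, Finset.card_univ, Fintype.card_fin, nsmul_eq_mul]
        ring

lemma norm_deviationAt_thermostatEvolution_le (hM : 0 < M) {lamS mu t D : ℝ} (hlamS : 0 ≤ lamS)
    (hmu : 0 ≤ mu) (ht : 0 ≤ t) (hD : 0 ≤ D) {f : State M N}
    (hf : ∀ ζ, ‖deviationAt ζ f‖ ≤ D * ‖sysPart ζ‖ ^ 2) (ζ : Vel (Fin M ⊕ Fin N)) :
    ‖deviationAt ζ (thermostatEvolution lamS mu t f)‖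
      ≤ Real.exp (-(mu / 2) * t) * D * ‖sysPart ζ‖ ^ 2 := by
  have hM1 : (1 : ℝ) ≤ M := Nat.one_le_cast.2 hM
  have hcollision : ∀ (i j : Fin M) (hij : i ≠ j), (deviationSeminorm M N).OpLe
      (collisionOp (Sum.inl i) (Sum.inl j) (Sum.inl_injective.ne hij)) 1 := fun i j hij =>
    (collisionCovariant_deviationAt _).opLe (fun _ => sq_nonneg _) fun ζ θ => by
      rw [sysPart_collide, norm_collide hij]
  have hdecay := LscSeminorm.thermostatEvolution_le hM hlamS hmu ht (by linarith) hcollision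
    (opLe_deviationSeminorm_sum_thermostatOp hM) f
  have hrate : t * (mu * ((M : ℝ) - 1 / 2 - M)) = -(mu / 2) * t := by ring
  refine (deviationSeminorm_le_ofReal_iff (by positivity)).1 ?_ ζ
  rw [ENNReal.ofReal_mul (Real.exp_nonneg _), ← hrate]
  exact hdecay.trans (by gcongr; exact (deviationSeminorm_le_ofReal_iff hD).2 hf)

lemma fourierAt_thermostatEvolution_initialState (hM : 0 < M) {lamS mu t : ℝ} (hlamS : 0 ≤ lamS)
    (hmu : 0 ≤ mu) (ht : 0 ≤ t) {l : Vel (Fin M) → ℝ} (hl : Integrable l)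
    (ζ : Vel (Fin M ⊕ Fin N)) :
    fourierAt ζ (thermostatEvolution lamS mu t (initialState N hl))
      = maxwellian (resPart ζ) *
        fourierAt (sysOnly ζ) (thermostatEvolution lamS mu t (initialState N hl)) := by
  let p : LscSeminorm (State M N) := functionalSeminorm correlationAt fun _ => 1
  have hp_eq_zero : ∀ f, p f = 0 ↔ ∀ ζ, correlationAt ζ f = 0 := fun f => by
    have hiff := functionalSeminorm_le_ofReal_iff (ψ := correlationAt)
      (fun _ : Vel (Fin M ⊕ Fin N) => zero_le_one) (x := f) le_rfl
    simpa only [ENNReal.ofReal_zero, nonpos_iff_eq_zero, zero_mul, norm_le_zero_iff] using hiff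
  have hthermostat : p.OpLe (∑ i : Fin M, thermostatOp (Sum.inl i))
      (Finset.univ : Finset (Fin M)).card :=
    LscSeminorm.OpLe.sum fun i _ =>
      (thermostatCovariant_correlationAt i).opLe (fun _ => zero_le_one) fun _ _ => le_rfl
  have hgrowth := LscSeminorm.thermostatEvolution_le hM hlamS hmu ht (Nat.cast_nonneg _)
    (fun i j hij => (collisionCovariant_correlationAt hij).opLe (fun _ => zero_le_one)
      fun _ _ => rfl) hthermostat (initialState N hl)
  rw [(hp_eq_zero _).2 (correlationAt_initialState hl), mul_zero, nonpos_iff_eq_zero,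
    hp_eq_zero] at hgrowth
  exact sub_eq_zero.1 ((correlationAt_apply _ _).symm.trans (hgrowth ζ))

end Split

/-! ### Propagation of moments -/

section Entries

variable {ι : Type*} [DecidableEq ι]

lemma collide_apply_of_ne {a b k : ι} (ha : k ≠ a) (hb : k ≠ b) (θ : ℝ) (x : Vel ι) :
    collide a b θ x k = x k := by
  simp [collide, ha, hb]

lemma collide_neg_apply_left {a b : ι} (hab : a ≠ b) (θ : ℝ) (x : Vel ι) :
    collide a b (-θ) x a = x a * Real.cos θ + -x b * Real.sin θ := by
  simp [collide, hab]

lemma collide_neg_apply_right (a b : ι) (θ : ℝ) (x : Vel ι) :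
    collide a b (-θ) x b = x b * Real.cos θ + x a * Real.sin θ := by
  simp [collide, add_comm]

lemma collideBath_apply_of_ne {j k : ι} (hk : k ≠ j) (θ w : ℝ) (x : Vel ι) :
    collideBath j θ w x k = x k := by
  simp [collideBath, hk]

lemma collideBath_neg_apply_self (j : ι) (θ w : ℝ) (x : Vel ι) :
    collideBath j (-θ) w x j = x j * Real.cos θ + -Real.sin θ * w := by
  simp [collideBath, mul_comm]

lemma exists_collide_neg_apply_eq {a b k : ι} (hab : a ≠ b) (hk : k = a ∨ k = b) (x : Vel ι) :
    ∃ p q : ℝ, p ^ 2 + q ^ 2 = x a ^ 2 + x b ^ 2 ∧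
      ∀ θ, collide a b (-θ) x k = p * Real.cos θ + q * Real.sin θ := by
  rcases hk with rfl | rfl
  · exact ⟨x k, -x b, by ring, fun θ => collide_neg_apply_left hab θ x⟩
  · exact ⟨x k, x a, by ring, fun θ => collide_neg_apply_right a k θ x⟩

lemma angleMean_collide_neg_sq {a b k : ι} (hab : a ≠ b) (hk : k = a ∨ k = b) (x : Vel ι) :
    angleMean (fun θ => collide a b (-θ) x k ^ 2) = (x a ^ 2 + x b ^ 2) / 2 := by
  obtain ⟨p, q, hpq, hentry⟩ := exists_collide_neg_apply_eq hab hk x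
  simp only [hentry]
  rw [← hpq, ← angleMean_quadratic (p ^ 2) (2 * p * q) (q ^ 2)]
  congr 1
  ext θ
  ring

lemma angleMean_collide_neg_fourth {a b k : ι} (hab : a ≠ b) (hk : k = a ∨ k = b) (x : Vel ι) :
    angleMean (fun θ => collide a b (-θ) x k ^ 4) = 3 / 8 * (x a ^ 2 + x b ^ 2) ^ 2 := by
  obtain ⟨p, q, hpq, hentry⟩ := exists_collide_neg_apply_eq hab hk x
  simp only [hentry]
  calc angleMean (fun θ => (p * Real.cos θ + q * Real.sin θ) ^ 4)
      = angleMean (fun θ => p ^ 4 * Real.cos θ ^ 4 + 4 * p ^ 3 * q * (Real.cos θ ^ 3 * Real.sin θ)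
          + 6 * p ^ 2 * q ^ 2 * (Real.cos θ ^ 2 * Real.sin θ ^ 2)
          + 4 * p * q ^ 3 * (Real.cos θ * Real.sin θ ^ 3) + q ^ 4 * Real.sin θ ^ 4) := by
        congr 1
        ext θ
        ring
    _ = 3 / 8 * (x a ^ 2 + x b ^ 2) ^ 2 := by
        rw [angleMean_quartic, ← hpq]
        ring

lemma angleMean_collide_neg_sq_mul_sq {a b : ι} (hab : a ≠ b) (x : Vel ι) :
    angleMean (fun θ => collide a b (-θ) x a ^ 2 * collide a b (-θ) x b ^ 2)
      = (x a ^ 2 + x b ^ 2) ^ 2 / 8 := by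
  simp only [collide_neg_apply_left hab, collide_neg_apply_right]
  set p := x a
  set q := x b
  calc angleMean (fun θ => (p * Real.cos θ + -q * Real.sin θ) ^ 2
          * (q * Real.cos θ + p * Real.sin θ) ^ 2)
      = angleMean (fun θ => p ^ 2 * q ^ 2 * Real.cos θ ^ 4
          + (2 * p ^ 3 * q - 2 * p * q ^ 3) * (Real.cos θ ^ 3 * Real.sin θ)
          + (p ^ 4 + q ^ 4 - 4 * p ^ 2 * q ^ 2) * (Real.cos θ ^ 2 * Real.sin θ ^ 2)
          + (2 * p * q ^ 3 - 2 * p ^ 3 * q) * (Real.cos θ * Real.sin θ ^ 3)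
          + p ^ 2 * q ^ 2 * Real.sin θ ^ 4) := by
        congr 1
        ext θ
        ring
    _ = (p ^ 2 + q ^ 2) ^ 2 / 8 := by
        rw [angleMean_quartic]
        ring

end Entries

section BathMoments

lemma integrable_add_mul_pow_mul_gauss (p s : ℝ) (n : ℕ) :
    Integrable fun w => (p + s * w) ^ n * gauss w := by
  simp only [add_pow, Finset.sum_mul, mul_pow]
  refine integrable_finsetSum _ fun k _ => ?_
  refine ((integrable_pow_mul_gauss (n - k)).const_mul (p ^ k * s ^ (n - k) * n.choose k)).congr
    (.of_forall fun w => ?_)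
  ring

lemma integral_add_mul_sq_mul_gauss (p s : ℝ) :
    ∫ w, (p + s * w) ^ 2 * gauss w = p ^ 2 + s ^ 2 * (2 * π)⁻¹ := by
  have hmom := fun (k : ℕ) (c : ℝ) => (integrable_pow_mul_gauss k).const_mul c
  calc ∫ w, (p + s * w) ^ 2 * gauss w
      = ∫ w, p ^ 2 * (w ^ 0 * gauss w) + (2 * p * s) * (w ^ 1 * gauss w)
          + s ^ 2 * (w ^ 2 * gauss w) := by congr 1; ext w; ring
    _ = p ^ 2 + s ^ 2 * (2 * π)⁻¹ := by
        rw [integral_add ((hmom 0 _).fun_add (hmom 1 _)) (hmom 2 _),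
          integral_add (hmom 0 _) (hmom 1 _)]
        simp only [integral_const_mul, pow_zero, one_mul, pow_one, integral_gauss,
          integral_id_mul_gauss, integral_sq_mul_gauss, mul_one, mul_zero, add_zero]

lemma integral_add_mul_fourth_mul_gauss (p s : ℝ) :
    ∫ w, (p + s * w) ^ 4 * gauss w
      = p ^ 4 + 6 * p ^ 2 * s ^ 2 * (2 * π)⁻¹ + 3 * s ^ 4 * (2 * π)⁻¹ ^ 2 := by
  have hmom := fun (k : ℕ) (c : ℝ) => (integrable_pow_mul_gauss k).const_mul c
  calc ∫ w, (p + s * w) ^ 4 * gauss w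
      = ∫ w, p ^ 4 * (w ^ 0 * gauss w) + (4 * p ^ 3 * s) * (w ^ 1 * gauss w)
          + (6 * p ^ 2 * s ^ 2) * (w ^ 2 * gauss w) + (4 * p * s ^ 3) * (w ^ 3 * gauss w)
          + s ^ 4 * (w ^ 4 * gauss w) := by congr 1; ext w; ring
    _ = p ^ 4 + 6 * p ^ 2 * s ^ 2 * (2 * π)⁻¹ + 3 * s ^ 4 * (2 * π)⁻¹ ^ 2 := by
        rw [integral_add ((((hmom 0 _).fun_add (hmom 1 _)).fun_add (hmom 2 _)).fun_add (hmom 3 _))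
            (hmom 4 _),
          integral_add (((hmom 0 _).fun_add (hmom 1 _)).fun_add (hmom 2 _)) (hmom 3 _),
          integral_add ((hmom 0 _).fun_add (hmom 1 _)) (hmom 2 _),
          integral_add (hmom 0 _) (hmom 1 _)]
        simp only [integral_const_mul, pow_zero, one_mul, pow_one, integral_gauss,
          integral_id_mul_gauss, integral_sq_mul_gauss, integral_cube_mul_gauss,
          integral_fourth_mul_gauss]
        ring

variable {ι : Type*} [Fintype ι] [DecidableEq ι] {j : ι} {W : Vel ι → ℝ}

lemma lintegral_mul_thermostatOp_le_of_invariant (f : Vel ι →₁[volume] ℝ) (hW : Continuous W)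
    (hW_nonneg : ∀ x, 0 ≤ W x) (hW_bath : ∀ θ w x, W (collideBath j (-θ) w x) = W x) :
    ∫⁻ x, ENNReal.ofReal (W x) * ‖thermostatOp j f x‖ₑ ≤ ∫⁻ x, ENNReal.ofReal (W x) * ‖f x‖ₑ := by
  refine lintegral_mul_thermostatOp_le f (U := fun _ x => W x) hW hW_nonneg (fun θ x => ?_)
    (fun θ x => ?_) (fun _ => continuous_const) fun x => (angleMean_const _).le
  · simpa only [hW_bath] using integrable_gauss.const_mul (W x)
  · simp only [hW_bath, integral_const_mul, integral_gauss, mul_one]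

lemma lintegral_mul_thermostatOp_le_of_sq (f : Vel ι →₁[volume] ℝ) (hW : Continuous W)
    (hW_nonneg : ∀ x, 0 ≤ W x) {r : Vel ι → ℝ}
    (hW_bath : ∀ θ w x, W (collideBath j (-θ) w x) = r x * collideBath j (-θ) w x j ^ 2) :
    ∫⁻ x, ENNReal.ofReal (W x) * ‖thermostatOp j f x‖ₑ
      ≤ ∫⁻ x, ENNReal.ofReal (r x * (x j ^ 2 + (2 * π)⁻¹) / 2) * ‖f x‖ₑ := by
  simp only [collideBath_neg_apply_self] at hW_bath
  refine lintegral_mul_thermostatOp_le f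
    (U := fun θ x => r x * ((x j * Real.cos θ) ^ 2 + (-Real.sin θ) ^ 2 * (2 * π)⁻¹)) hW hW_nonneg
    (fun θ x => ?_) (fun θ x => ?_) (fun x => by fun_prop) fun x => le_of_eq ?_
  · simpa only [hW_bath, mul_assoc] using (integrable_add_mul_pow_mul_gauss _ _ 2).const_mul (r x)
  · simp only [hW_bath, mul_assoc (r x), integral_const_mul, integral_add_mul_sq_mul_gauss]
  · rw [mul_add, ← angleMean_quadratic _ 0]
    congr 1
    ext θ
    ring

lemma lintegral_mul_thermostatOp_le_of_fourth (f : Vel ι →₁[volume] ℝ) (hW : Continuous W)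
    (hW_nonneg : ∀ x, 0 ≤ W x) {c : ℝ}
    (hW_bath : ∀ θ w x, W (collideBath j (-θ) w x) = c * collideBath j (-θ) w x j ^ 4) :
    ∫⁻ x, ENNReal.ofReal (W x) * ‖thermostatOp j f x‖ₑ
      ≤ ∫⁻ x, ENNReal.ofReal (c * (3 * x j ^ 4 + 6 * x j ^ 2 * (2 * π)⁻¹
          + 9 * (2 * π)⁻¹ ^ 2) / 8) * ‖f x‖ₑ := by
  simp only [collideBath_neg_apply_self] at hW_bath
  refine lintegral_mul_thermostatOp_le f
    (U := fun θ x => c * ((x j * Real.cos θ) ^ 4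
      + 6 * (x j * Real.cos θ) ^ 2 * (-Real.sin θ) ^ 2 * (2 * π)⁻¹
      + 3 * (-Real.sin θ) ^ 4 * (2 * π)⁻¹ ^ 2)) hW hW_nonneg
    (fun θ x => ?_) (fun θ x => ?_) (fun x => by fun_prop) fun x => le_of_eq ?_
  · simpa only [hW_bath, mul_assoc] using (integrable_add_mul_pow_mul_gauss _ _ 4).const_mul c
  · simp only [hW_bath, mul_assoc c, integral_const_mul, integral_add_mul_fourth_mul_gauss]
  · calc _ = angleMean (fun θ => c * x j ^ 4 * Real.cos θ ^ 4 + 0 * (Real.cos θ ^ 3 * Real.sin θ)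
            + c * 6 * x j ^ 2 * (2 * π)⁻¹ * (Real.cos θ ^ 2 * Real.sin θ ^ 2)
            + 0 * (Real.cos θ * Real.sin θ ^ 3) + c * 3 * (2 * π)⁻¹ ^ 2 * Real.sin θ ^ 4) := by
          congr 1
          ext θ
          ring
      _ = _ := by
          rw [angleMean_quartic]
          ring

end BathMoments

section Moments

variable {M N : ℕ} {A : ℝ}

/-- Labels of the moments that are propagated together: the mass, the second and fourth moments of
one particle, and the mixed moments `E[v_i² v_j²]`. -/
inductive MomentIndex (M : ℕ)
  | mass : MomentIndex M
  | sq (i : Fin M) : MomentIndex M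
  | fourth (i : Fin M) : MomentIndex M
  | mixed (i j : Fin M) (hij : i ≠ j) : MomentIndex M

/-- The weights whose integrals are the moments. They are normalized so that the image of a weight
under a collision is a convex combination of weights; at `A = (2π)⁻²` the Maxwellian has all
moments equal. -/
def momentWeight (A : ℝ) : MomentIndex M → Vel (Fin M ⊕ Fin N) → ℝ
  | .mass, _ => A
  | .sq i, x => (2 * π)⁻¹ * x (Sum.inl i) ^ 2
  | .fourth i, x => 3⁻¹ * x (Sum.inl i) ^ 4
  | .mixed i j _, x => x (Sum.inl i) ^ 2 * x (Sum.inl j) ^ 2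

lemma momentWeight_mixed_comm {i j : Fin M} (hij : i ≠ j) :
    (momentWeight A (.mixed i j hij) : Vel (Fin M ⊕ Fin N) → ℝ)
      = momentWeight A (.mixed j i hij.symm) :=
  funext fun _ => mul_comm _ _

lemma continuous_momentWeight (A : ℝ) (k : MomentIndex M) :
    Continuous (momentWeight A k : Vel (Fin M ⊕ Fin N) → ℝ) := by
  cases k <;> unfold momentWeight <;> fun_prop

lemma momentWeight_nonneg (hA : 0 ≤ A) (k : MomentIndex M) (x : Vel (Fin M ⊕ Fin N)) :
    0 ≤ momentWeight A k x := by
  cases k <;> unfold momentWeight <;> positivity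

variable (M N) in
/-- The largest of the moments of the system up to order four. -/
def momentSeminorm (A : ℝ) : LscSeminorm (State M N) :=
  weightSeminorm volume (momentWeight A) fun k => (continuous_momentWeight A k).measurable

lemma momentSeminorm_le_iff {C : ℝ≥0∞} {f : State M N} :
    momentSeminorm M N A f ≤ C ↔ ∀ k, ∫⁻ x, ENNReal.ofReal (momentWeight A k x) * ‖f x‖ₑ ≤ C :=
  weightSeminorm_le_iff

/-- `V` is dominated by a convex combination of moment weights. -/
def DominatedByMoments (A : ℝ) (V : Vel (Fin M ⊕ Fin N) → ℝ) : Prop :=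
  ∃ U ∈ convexHull ℝ (range (momentWeight A)), ∀ x, V x ≤ U x

lemma dominatedByMoments_momentWeight (k : MomentIndex M) :
    DominatedByMoments A (momentWeight A k : Vel (Fin M ⊕ Fin N) → ℝ) :=
  ⟨_, subset_convexHull ℝ _ (mem_range_self k), fun _ => le_rfl⟩

lemma DominatedByMoments.of_le_add {V U₁ U₂ : Vel (Fin M ⊕ Fin N) → ℝ} {c₁ c₂ : ℝ}
    (hU₁ : DominatedByMoments A U₁) (hU₂ : DominatedByMoments A U₂) (hc₁ : 0 ≤ c₁) (hc₂ : 0 ≤ c₂)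
    (hc : c₁ + c₂ = 1) (hV : ∀ x, V x ≤ c₁ * U₁ x + c₂ * U₂ x) : DominatedByMoments A V := by
  obtain ⟨W₁, hW₁, hU₁⟩ := hU₁
  obtain ⟨W₂, hW₂, hU₂⟩ := hU₂
  refine ⟨c₁ • W₁ + c₂ • W₂, convex_convexHull ℝ _ hW₁ hW₂ hc₁ hc₂ hc, fun x => (hV x).trans ?_⟩
  simp only [Pi.add_apply, Pi.smul_apply, smul_eq_mul]
  gcongr
  exacts [hU₁ x, hU₂ x]

lemma DominatedByMoments.lintegral_le {V : Vel (Fin M ⊕ Fin N) → ℝ} (hV : DominatedByMoments A V)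
    (f : State M N) : ∫⁻ x, ENNReal.ofReal (V x) * ‖f x‖ₑ ≤ momentSeminorm M N A f := by
  obtain ⟨U, hU, hVU⟩ := hV
  refine (lintegral_mono fun x => ?_).trans (lintegral_le_weightSeminorm_of_mem_convexHull _ hU f)
  gcongr
  exact hVU x

lemma dominatedByMoments_sq_add_sq_sq {a b : Fin M} (hab : a ≠ b) :
    DominatedByMoments A fun x : Vel (Fin M ⊕ Fin N) =>
      (x (Sum.inl a) ^ 2 + x (Sum.inl b) ^ 2) ^ 2 / 8 := by
  have hfourth : DominatedByMoments A fun x : Vel (Fin M ⊕ Fin N) =>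
      (x (Sum.inl a) ^ 4 + x (Sum.inl b) ^ 4) / 6 :=
    (dominatedByMoments_momentWeight (.fourth a)).of_le_add
      (dominatedByMoments_momentWeight (.fourth b)) one_half_pos.le one_half_pos.le (by norm_num)
      fun x => le_of_eq (by simp only [momentWeight]; ring)
  exact hfourth.of_le_add (dominatedByMoments_momentWeight (.mixed a b hab)) (c₁ := 3 / 4)
    (c₂ := 1 / 4) (by norm_num) (by norm_num) (by norm_num)
    fun x => le_of_eq (by simp only [momentWeight]; ring)

lemma dominatedByMoments_angleMean_mixed_collide {a b k l : Fin M} (hab : a ≠ b) (hkl : k ≠ l)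
    (hk : k = a ∨ k = b) :
    DominatedByMoments A fun x : Vel (Fin M ⊕ Fin N) => angleMean fun θ =>
      momentWeight A (.mixed k l hkl) (collide (Sum.inl a) (Sum.inl b) (-θ) x) := by
  have hab' : (Sum.inl a : Fin M ⊕ Fin N) ≠ Sum.inl b := Sum.inl_injective.ne hab
  by_cases hl : l = a ∨ l = b
  · have hpair := dominatedByMoments_sq_add_sq_sq (N := N) (A := A) hab
    simp only [← angleMean_collide_neg_sq_mul_sq hab'] at hpair
    rcases hk with rfl | rfl <;> rcases hl with rfl | rfl
    · exact absurd rfl hkl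
    · exact hpair
    · rwa [momentWeight_mixed_comm]
    · exact absurd rfl hkl
  · push Not at hl
    have hk' : (Sum.inl k : Fin M ⊕ Fin N) = Sum.inl a ∨ (Sum.inl k : Fin M ⊕ Fin N) = Sum.inl b :=
      hk.imp (congrArg _) (congrArg _)
    refine (dominatedByMoments_momentWeight (.mixed a l hl.1.symm)).of_le_add
      (dominatedByMoments_momentWeight (.mixed b l hl.2.symm)) one_half_pos.le one_half_pos.le
      (by norm_num) fun x => le_of_eq ?_
    simp only [momentWeight, collide_apply_of_ne (Sum.inl_injective.ne hl.1)
      (Sum.inl_injective.ne hl.2), angleMean_mul_const, angleMean_collide_neg_sq hab' hk']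
    ring

lemma dominatedByMoments_angleMean_collide {a b : Fin M} (hab : a ≠ b) (k : MomentIndex M) :
    DominatedByMoments A fun x : Vel (Fin M ⊕ Fin N) => angleMean fun θ =>
      momentWeight A k (collide (Sum.inl a) (Sum.inl b) (-θ) x) := by
  have hab' : (Sum.inl a : Fin M ⊕ Fin N) ≠ Sum.inl b := Sum.inl_injective.ne hab
  have hunchanged : ∀ i : Fin M, ¬(i = a ∨ i = b) → ∀ θ (x : Vel (Fin M ⊕ Fin N)),
      collide (Sum.inl a) (Sum.inl b) θ x (Sum.inl i) = x (Sum.inl i) := fun i hi θ x =>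
    collide_apply_of_ne (Sum.inl_injective.ne (not_or.1 hi).1)
      (Sum.inl_injective.ne (not_or.1 hi).2) θ x
  have hchanged : ∀ i : Fin M, i = a ∨ i = b →
      (Sum.inl i : Fin M ⊕ Fin N) = Sum.inl a ∨ (Sum.inl i : Fin M ⊕ Fin N) = Sum.inl b :=
    fun i hi => hi.imp (congrArg _) (congrArg _)
  cases k with
  | mass =>
    simp only [momentWeight, angleMean_const]
    exact dominatedByMoments_momentWeight .mass
  | sq i =>
    by_cases hi : i = a ∨ i = b
    · refine (dominatedByMoments_momentWeight (.sq a)).of_le_add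
        (dominatedByMoments_momentWeight (.sq b)) one_half_pos.le one_half_pos.le (by norm_num)
        fun x => le_of_eq ?_
      simp only [momentWeight, angleMean_const_mul,
        angleMean_collide_neg_sq hab' (hchanged i hi)]
      ring
    · simp only [momentWeight, hunchanged i hi, angleMean_const]
      exact dominatedByMoments_momentWeight (.sq i)
  | fourth i =>
    by_cases hi : i = a ∨ i = b
    · convert dominatedByMoments_sq_add_sq_sq (N := N) (A := A) hab using 2 with x
      simp only [momentWeight, angleMean_const_mul,
        angleMean_collide_neg_fourth hab' (hchanged i hi)]
      ring
    · simp only [momentWeight, hunchanged i hi, angleMean_const]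
      exact dominatedByMoments_momentWeight (.fourth i)
  | mixed i j hij =>
    by_cases hi : i = a ∨ i = b
    · exact dominatedByMoments_angleMean_mixed_collide hab hij hi
    by_cases hj : j = a ∨ j = b
    · rw [momentWeight_mixed_comm hij]
      exact dominatedByMoments_angleMean_mixed_collide hab hij.symm hj
    · simp only [momentWeight, hunchanged i hi, hunchanged j hj, angleMean_const]
      exact dominatedByMoments_momentWeight (.mixed i j hij)

lemma opLe_momentSeminorm_collisionOp {a b : Fin M} (hab : a ≠ b) (hA : 0 ≤ A) :
    (momentSeminorm M N A).OpLe
      (collisionOp (Sum.inl a) (Sum.inl b) (Sum.inl_injective.ne hab)) 1 := fun f => by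
  rw [ENNReal.ofReal_one, one_mul, momentSeminorm_le_iff]
  exact fun k => (lintegral_mul_collisionOp_le _ f (continuous_momentWeight A k)
    (momentWeight_nonneg hA k) fun x => le_rfl).trans
    ((dominatedByMoments_angleMean_collide hab k).lintegral_le f)

lemma lintegral_mixed_mul_thermostatOp_le (hA : 0 ≤ A) (f : State M N) {a l : Fin M}
    (hal : a ≠ l) :
    ∫⁻ x, ENNReal.ofReal (momentWeight A (.mixed a l hal) x) * ‖thermostatOp (Sum.inl a) f x‖ₑ
      ≤ momentSeminorm M N A f := by
  have hdom : DominatedByMoments A fun x : Vel (Fin M ⊕ Fin N) =>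
      x (Sum.inl l) ^ 2 * (x (Sum.inl a) ^ 2 + (2 * π)⁻¹) / 2 :=
    (dominatedByMoments_momentWeight (.mixed a l hal)).of_le_add
      (dominatedByMoments_momentWeight (.sq l)) one_half_pos.le one_half_pos.le (by norm_num)
      fun x => le_of_eq (by simp only [momentWeight]; ring)
  refine (lintegral_mul_thermostatOp_le_of_sq f (continuous_momentWeight A _)
    (momentWeight_nonneg hA _) fun θ w x => ?_).trans (hdom.lintegral_le f)
  rw [momentWeight, collideBath_apply_of_ne (Sum.inl_injective.ne hal.symm), mul_comm]

lemma lintegral_sq_mul_thermostatOp_le (hA : (2 * π)⁻¹ ^ 2 ≤ A) (f : State M N) (a : Fin M) :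
    ∫⁻ x, ENNReal.ofReal (momentWeight A (.sq a) x) * ‖thermostatOp (Sum.inl a) f x‖ₑ
      ≤ momentSeminorm M N A f := by
  have hdom : DominatedByMoments A fun x : Vel (Fin M ⊕ Fin N) =>
      (2 * π)⁻¹ * (x (Sum.inl a) ^ 2 + (2 * π)⁻¹) / 2 :=
    (dominatedByMoments_momentWeight (.sq a)).of_le_add (dominatedByMoments_momentWeight .mass)
      one_half_pos.le one_half_pos.le (by norm_num)
      fun x => by simp only [momentWeight]; linarith
  exact (lintegral_mul_thermostatOp_le_of_sq f (continuous_momentWeight A _)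
    (momentWeight_nonneg ((sq_nonneg _).trans hA) _) fun θ w x => rfl).trans (hdom.lintegral_le f)

lemma lintegral_fourth_mul_thermostatOp_le (hA : (2 * π)⁻¹ ^ 2 ≤ A) (f : State M N) (a : Fin M) :
    ∫⁻ x, ENNReal.ofReal (momentWeight A (.fourth a) x) * ‖thermostatOp (Sum.inl a) f x‖ₑ
      ≤ momentSeminorm M N A f := by
  have hlow : DominatedByMoments A fun x : Vel (Fin M ⊕ Fin N) =>
      2 / 5 * ((2 * π)⁻¹ * x (Sum.inl a) ^ 2) + 3 / 5 * A :=
    (dominatedByMoments_momentWeight (.sq a)).of_le_add (dominatedByMoments_momentWeight .mass)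
      (by norm_num) (by norm_num) (by norm_num) fun x => le_rfl
  have hdom : DominatedByMoments A fun x : Vel (Fin M ⊕ Fin N) =>
      3⁻¹ * (3 * x (Sum.inl a) ^ 4 + 6 * x (Sum.inl a) ^ 2 * (2 * π)⁻¹
        + 9 * (2 * π)⁻¹ ^ 2) / 8 :=
    (dominatedByMoments_momentWeight (.fourth a)).of_le_add hlow (c₁ := 3 / 8) (c₂ := 5 / 8)
      (by norm_num) (by norm_num) (by norm_num)
      fun x => by simp only [momentWeight]; linarith
  exact (lintegral_mul_thermostatOp_le_of_fourth f (continuous_momentWeight A _)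
    (momentWeight_nonneg ((sq_nonneg _).trans hA) _) fun θ w x => rfl).trans (hdom.lintegral_le f)

lemma opLe_momentSeminorm_thermostatOp (hA : (2 * π)⁻¹ ^ 2 ≤ A) (a : Fin M) :
    (momentSeminorm M N A).OpLe (thermostatOp (Sum.inl a)) 1 := fun f => by
  have hA_nonneg : 0 ≤ A := (sq_nonneg _).trans hA
  have hunchanged : ∀ i : Fin M, i ≠ a → ∀ θ w (x : Vel (Fin M ⊕ Fin N)),
      collideBath (Sum.inl a) θ w x (Sum.inl i) = x (Sum.inl i) := fun i hi =>
    collideBath_apply_of_ne (Sum.inl_injective.ne hi)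
  have hinvariant : ∀ k : MomentIndex M, (∀ θ w (x : Vel (Fin M ⊕ Fin N)),
      momentWeight A k (collideBath (Sum.inl a) (-θ) w x) = momentWeight A k x) →
      ∫⁻ x, ENNReal.ofReal (momentWeight A k x) * ‖thermostatOp (Sum.inl a) f x‖ₑ
        ≤ momentSeminorm M N A f := fun k hk =>
    (lintegral_mul_thermostatOp_le_of_invariant f (continuous_momentWeight A k)
      (momentWeight_nonneg hA_nonneg k) hk).trans (momentSeminorm_le_iff.1 le_rfl k)
  rw [ENNReal.ofReal_one, one_mul, momentSeminorm_le_iff]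
  intro k
  cases k with
  | mass => exact hinvariant _ fun _ _ _ => rfl
  | sq i =>
    rcases eq_or_ne i a with rfl | hi
    · exact lintegral_sq_mul_thermostatOp_le hA f i
    · exact hinvariant _ fun θ w x => by simp only [momentWeight, hunchanged i hi]
  | fourth i =>
    rcases eq_or_ne i a with rfl | hi
    · exact lintegral_fourth_mul_thermostatOp_le hA f i
    · exact hinvariant _ fun θ w x => by simp only [momentWeight, hunchanged i hi]
  | mixed i j hij =>
    rcases eq_or_ne i a with rfl | hi
    · exact lintegral_mixed_mul_thermostatOp_le hA_nonneg f hij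
    rcases eq_or_ne j a with rfl | hj
    · rw [momentWeight_mixed_comm]
      exact lintegral_mixed_mul_thermostatOp_le hA_nonneg f hij.symm
    · exact hinvariant _ fun θ w x => by simp only [momentWeight, hunchanged i hi, hunchanged j hj]

lemma momentSeminorm_thermostatEvolution_le (hM : 0 < M) {lamS mu t : ℝ} (hlamS : 0 ≤ lamS)
    (hmu : 0 ≤ mu) (ht : 0 ≤ t) (hA : (2 * π)⁻¹ ^ 2 ≤ A) (f : State M N) :
    momentSeminorm M N A (thermostatEvolution lamS mu t f) ≤ momentSeminorm M N A f := by
  have hthermostat : (momentSeminorm M N A).OpLe (∑ i : Fin M, thermostatOp (Sum.inl i))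
      (Finset.univ : Finset (Fin M)).card :=
    LscSeminorm.OpLe.sum fun i _ => opLe_momentSeminorm_thermostatOp hA i
  simpa using LscSeminorm.thermostatEvolution_le hM hlamS hmu ht (Nat.cast_nonneg _)
    (fun i j hij => opLe_momentSeminorm_collisionOp hij ((sq_nonneg _).trans hA)) hthermostat f

lemma lintegral_ofReal_mul_initialState {l : Vel (Fin M) → ℝ} (hl : Integrable l)
    {w : Vel (Fin M) → ℝ} (hw : Measurable w) :
    ∫⁻ x : Vel (Fin M ⊕ Fin N), ENNReal.ofReal (w (sysPart x)) * ‖initialState N hl x‖ₑ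
      = ∫⁻ v, ENNReal.ofReal (w v) * ‖l v‖ₑ := by
  have hsplit := measurePreserving_split M N
  have hsys : AEMeasurable (fun v => ENNReal.ofReal (w v) * ‖l v‖ₑ) volume :=
    hw.ennreal_ofReal.aemeasurable.mul hl.1.enorm
  have hres : AEMeasurable (fun v : Vel (Fin N) => ENNReal.ofReal (maxwellian v)) volume :=
    integrable_maxwellian.1.aemeasurable.ennreal_ofReal
  have hprod : AEMeasurable (fun p : Vel (Fin M) × Vel (Fin N) =>
      (ENNReal.ofReal (w p.1) * ‖l p.1‖ₑ) * ENNReal.ofReal (maxwellian p.2)) volume :=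
    (hsys.comp_quasiMeasurePreserving Measure.quasiMeasurePreserving_fst).mul
      (hres.comp_quasiMeasurePreserving Measure.quasiMeasurePreserving_snd)
  calc ∫⁻ x : Vel (Fin M ⊕ Fin N), ENNReal.ofReal (w (sysPart x)) * ‖initialState N hl x‖ₑ
      = ∫⁻ p : Vel (Fin M) × Vel (Fin N),
          (ENNReal.ofReal (w p.1) * ‖l p.1‖ₑ) * ENNReal.ofReal (maxwellian p.2) := by
        rw [← hsplit.map_eq,
          lintegral_map' (by rw [hsplit.map_eq]; exact hprod) hsplit.aemeasurable]
        refine lintegral_congr_ae ?_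
        filter_upwards [(integrable_initial (N := N) hl).coeFn_toL1] with x hx
        rw [initialState, hx, enorm_mul, Real.enorm_of_nonneg (maxwellian_nonneg _), mul_assoc]
    _ = (∫⁻ v, ENNReal.ofReal (w v) * ‖l v‖ₑ)
          * ∫⁻ v : Vel (Fin N), ENNReal.ofReal (maxwellian v) := lintegral_prod_mul hsys hres
    _ = ∫⁻ v, ENNReal.ofReal (w v) * ‖l v‖ₑ := by
        rw [← ofReal_integral_eq_lintegral_ofReal integrable_maxwellian
          (.of_forall maxwellian_nonneg), integral_maxwellian, ENNReal.ofReal_one, mul_one]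

lemma lintegral_ofReal_mul_enorm_le_of_le_fourth {l : Vel (Fin M) → ℝ} (hl : Integrable l)
    (hl_nonneg : 0 ≤ᵐ[volume] l) (hl_mass : ∫ v, l v = 1) {E₄ : ℝ}
    (hl_fourth : ∀ i, Integrable fun v => v i ^ 4 * l v) (hE₄ : ∀ i, ∫ v, v i ^ 4 * l v ≤ E₄)
    {w : Vel (Fin M) → ℝ} (i j : Fin M) {α β γ : ℝ} (hα : 0 ≤ α) (hβ : 0 ≤ β) (hγ : 0 ≤ γ)
    (hw : ∀ v, w v ≤ α * v i ^ 4 + β * v j ^ 4 + γ) :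
    ∫⁻ v, ENNReal.ofReal (w v) * ‖l v‖ₑ ≤ ENNReal.ofReal ((α + β) * E₄ + γ) := by
  have hi := (hl_fourth i).const_mul α
  have hj := (hl_fourth j).const_mul β
  calc ∫⁻ v, ENNReal.ofReal (w v) * ‖l v‖ₑ
      ≤ ∫⁻ v, ENNReal.ofReal (α * (v i ^ 4 * l v) + β * (v j ^ 4 * l v) + γ * l v) := by
        refine lintegral_mono_ae ?_
        filter_upwards [hl_nonneg] with v hv
        rw [Real.enorm_of_nonneg hv, ← ENNReal.ofReal_mul' hv]
        refine ENNReal.ofReal_le_ofReal ((mul_le_mul_of_nonneg_right (hw v) hv).trans_eq ?_)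
        ring
    _ = ENNReal.ofReal (∫ v, α * (v i ^ 4 * l v) + β * (v j ^ 4 * l v) + γ * l v) := by
        rw [ofReal_integral_eq_lintegral_ofReal ((hi.fun_add hj).fun_add (hl.const_mul γ))]
        filter_upwards [hl_nonneg] with v (hv : 0 ≤ l v)
        simp only [Pi.zero_apply]
        positivity
    _ ≤ ENNReal.ofReal ((α + β) * E₄ + γ) := by
        rw [integral_add (hi.fun_add hj) (hl.const_mul γ), integral_add hi hj, integral_const_mul,
          integral_const_mul, integral_const_mul, hl_mass, mul_one, add_mul]
        gcongr
        exacts [hE₄ i, hE₄ j]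

lemma momentSeminorm_initialState_le {l : Vel (Fin M) → ℝ} (hl : Integrable l)
    (hl_nonneg : 0 ≤ᵐ[volume] l) (hl_mass : ∫ v, l v = 1) {E₄ : ℝ} (hE₄_nonneg : 0 ≤ E₄)
    (hl_fourth : ∀ i, Integrable fun v => v i ^ 4 * l v) (hE₄ : ∀ i, ∫ v, v i ^ 4 * l v ≤ E₄) :
    momentSeminorm M N (E₄ + 1 / 2) (initialState N hl) ≤ ENNReal.ofReal (E₄ + 1 / 2) := by
  have hbound := @lintegral_ofReal_mul_enorm_le_of_le_fourth M l hl hl_nonneg hl_mass E₄ hl_fourth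
    hE₄
  have hσ : (2 * π)⁻¹ ≤ 1 := inv_le_one_of_one_le₀ (by linarith [Real.pi_gt_three])
  rw [momentSeminorm_le_iff]
  intro k
  cases k with
  | mass =>
    refine (lintegral_ofReal_mul_initialState hl (w := fun _ => E₄ + 1 / 2)
      measurable_const).trans_le ?_
    rw [lintegral_const_mul'' _ hl.1.enorm, ← ofReal_integral_norm_eq_lintegral_enorm hl,
      integral_congr_ae (hl_nonneg.mono fun v hv => Real.norm_of_nonneg hv), hl_mass,
      ENNReal.ofReal_one, mul_one]
  | sq i =>
    refine (lintegral_ofReal_mul_initialState hl (w := fun v => (2 * π)⁻¹ * v i ^ 2)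
      (by fun_prop)).trans_le ((hbound i i one_half_pos.le le_rfl one_half_pos.le
        fun v => ?_).trans (ENNReal.ofReal_le_ofReal (by linarith)))
    nlinarith [sq_nonneg (v i ^ 2 - 1), sq_nonneg (v i)]
  | fourth i =>
    exact (lintegral_ofReal_mul_initialState hl (w := fun v => 3⁻¹ * v i ^ 4)
      (by fun_prop)).trans_le ((hbound i i (inv_nonneg.2 zero_le_three) le_rfl le_rfl
        fun v => by linarith).trans (ENNReal.ofReal_le_ofReal (by linarith)))
  | mixed i j hij =>
    refine (lintegral_ofReal_mul_initialState hl (w := fun v => v i ^ 2 * v j ^ 2)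
      (by fun_prop)).trans_le ((hbound i j one_half_pos.le one_half_pos.le le_rfl
        fun v => ?_).trans (ENNReal.ofReal_le_ofReal (by linarith)))
    nlinarith [sq_nonneg (v i ^ 2 - v j ^ 2)]

end Moments

/-! ### Dependence of the deviation on one frequency -/

section SecondDifference

/-- `κ` is twice differentiable and its symmetric second difference agrees with the second
derivative up to an error `F h ^ 4`, as if `κ` had a fourth derivative bounded by `12 F`. -/
structure SecondDifferenceLe (κ : ℝ → ℂ) (F : ℝ) : Prop where
  differentiable : Differentiable ℝ κ
  differentiable_deriv : Differentiable ℝ (deriv κ)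
  norm_le : ∀ z h : ℝ,
    ‖κ (z + h) + κ (z - h) - 2 * κ z - h ^ 2 * deriv (deriv κ) z‖ ≤ F * h ^ 4

namespace SecondDifferenceLe

variable {κ κ' : ℝ → ℂ} {F F' : ℝ}

lemma mono (hκ : SecondDifferenceLe κ F) (hF : F ≤ F') : SecondDifferenceLe κ F' where
  differentiable := hκ.differentiable
  differentiable_deriv := hκ.differentiable_deriv
  norm_le z h := (hκ.norm_le z h).trans (by gcongr)

lemma sub (hκ : SecondDifferenceLe κ F) (hκ' : SecondDifferenceLe κ' F') :
    SecondDifferenceLe (fun z => κ z - κ' z) (F + F') := by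
  have hderiv : deriv (fun z => κ z - κ' z) = fun z => deriv κ z - deriv κ' z :=
    funext fun z => deriv_fun_sub (hκ.differentiable z) (hκ'.differentiable z)
  refine ⟨hκ.differentiable.sub hκ'.differentiable, ?_, fun z h => ?_⟩
  · rw [hderiv]
    exact hκ.differentiable_deriv.sub hκ'.differentiable_deriv
  · rw [hderiv, deriv_fun_sub (hκ.differentiable_deriv z) (hκ'.differentiable_deriv z), add_mul]
    refine (congrArg norm ?_).trans_le
      ((norm_sub_le _ _).trans (add_le_add (hκ.norm_le z h) (hκ'.norm_le z h)))
    ring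

lemma const_mul (hκ : SecondDifferenceLe κ F) (c : ℂ) :
    SecondDifferenceLe (fun z => c * κ z) (‖c‖ * F) := by
  have hderiv : deriv (fun z => c * κ z) = fun z => c * deriv κ z :=
    funext fun z => deriv_const_mul c (hκ.differentiable z)
  refine ⟨hκ.differentiable.const_mul c, ?_, fun z h => ?_⟩
  · rw [hderiv]
    exact hκ.differentiable_deriv.const_mul c
  · rw [hderiv, deriv_const_mul c (hκ.differentiable_deriv z), mul_assoc]
    refine (congrArg norm ?_).trans_le
      ((norm_mul _ _).trans_le (mul_le_mul_of_nonneg_left (hκ.norm_le z h) (norm_nonneg c)))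
    ring

lemma quadraticGrowth {D L ρ : ℝ} (hκ : SecondDifferenceLe κ F) (hD : 0 ≤ D) (hF : 0 ≤ F)
    (hL : F + D ≤ L) (hρ : 0 ≤ ρ) (hκ_le : ∀ z, ‖κ z‖ ≤ D * (ρ + z ^ 2)) :
    QuadraticGrowth κ √(D * L) ρ where
  scale_nonneg := Real.sqrt_nonneg _
  offset_nonneg := hρ
  differentiable := hκ.differentiable
  differentiable_deriv := hκ.differentiable_deriv
  norm_le z := (hκ_le z).trans <| by
    gcongr
    exact Real.le_sqrt_of_sq_le (by nlinarith)
  norm_deriv_deriv_le := norm_le_of_second_difference hD hF hL hκ_le hκ.norm_le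

end SecondDifferenceLe

variable {X : Type*} [MeasurableSpace X] {μ : Measure X} {a : X → ℝ} {F : X → ℂ}

lemma integrable_abs_pow_mul_norm_of_le (ha : Measurable a) (hF : Integrable F μ) {k n : ℕ}
    (hkn : k ≤ n) (hn : Integrable (fun x => |a x| ^ n * ‖F x‖) μ) :
    Integrable (fun x => |a x| ^ k * ‖F x‖) μ := by
  refine (hF.norm.fun_add hn).mono'
    (((measurable_norm.comp ha).pow_const k).aestronglyMeasurable.mul hF.1.norm)
    (.of_forall fun x => ?_)
  rw [Real.norm_of_nonneg (by positivity), ← one_add_mul]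
  gcongr
  rcases le_total |a x| 1 with hle | hge
  · linarith [pow_le_one₀ (n := k) (abs_nonneg (a x)) hle, pow_nonneg (abs_nonneg (a x)) n]
  · linarith [pow_le_pow_right₀ hge hkn]

lemma secondDifferenceLe_oscIntegral (ha : Measurable a) (hF : Integrable F μ)
    (hfourth : Integrable (fun x => |a x| ^ 4 * ‖F x‖) μ) :
    SecondDifferenceLe (oscIntegral μ a F 0) ((2 * π) ^ 4 * ∫ x, |a x| ^ 4 * ‖F x‖ ∂μ) := by
  have hmoment : ∀ k ≤ 4, Integrable (fun x => |a x| ^ k * ‖F x‖) μ := fun k hk =>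
    integrable_abs_pow_mul_norm_of_le ha hF hk hfourth
  have hasDeriv : ∀ k ≤ 3, ∀ z,
      HasDerivAt (oscIntegral μ a F k) (oscIntegral μ a F (k + 1) z) z := fun k hk z =>
    hasDerivAt_oscIntegral ha hF.1 (hmoment k (by lia)) (hmoment (k + 1) (by lia)) z
  have hderiv : deriv (oscIntegral μ a F 0) = oscIntegral μ a F 1 :=
    funext fun z => (hasDeriv 0 (by lia) z).deriv
  refine ⟨fun z => (hasDeriv 0 (by lia) z).differentiableAt, ?_, fun z h => ?_⟩
  · rw [hderiv]
    exact fun z => (hasDeriv 1 (by lia) z).differentiableAt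
  · rw [hderiv, (hasDeriv 1 (by lia) z).deriv]
    exact norm_second_difference_oscIntegral_le ha hF (hmoment 2 (by lia)) hfourth z h

lemma gauss_eq_oscIntegral (z : ℝ) :
    (gauss z : ℂ) = oscIntegral volume (fun w : ℝ => w) (fun w => (gauss w : ℂ)) 0 z := by
  rw [← gauss_neg, ← integral_exp_mul_gauss, oscIntegral]
  congr 1
  ext w
  rw [oscIntegrand, pow_zero, one_mul]
  congr 2
  push_cast
  ring

lemma secondDifferenceLe_gauss :
    SecondDifferenceLe (fun z => (gauss z : ℂ)) ((2 * π) ^ 4 * (3 * (2 * π)⁻¹ ^ 2)) := by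
  have hnorm : ∀ w : ℝ, |w| ^ 4 * ‖(gauss w : ℂ)‖ = w ^ 4 * gauss w := fun w => by
    rw [norm_ofReal_gauss, Even.pow_abs (by decide)]
  have hbound := secondDifferenceLe_oscIntegral (μ := volume) (F := fun w => (gauss w : ℂ))
    measurable_id' integrable_gauss.ofReal
    (by simpa only [hnorm] using integrable_pow_mul_gauss 4)
  simp only [hnorm, integral_fourth_mul_gauss] at hbound
  rwa [funext gauss_eq_oscIntegral]

end SecondDifference

section Entry

variable {ι : Type*} [DecidableEq ι]

/-- The vector `ζ` with its entry at `a` replaced by `z`. -/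
def withEntry (a : ι) (z : ℝ) (ζ : Vel ι) : Vel ι :=
  WithLp.toLp 2 (Function.update (fun i => ζ i) a z)

variable [Fintype ι]

lemma inner_withEntry (a : ι) (z : ℝ) (x ζ : Vel ι) :
    inner ℝ x (withEntry a z ζ) = z * x a + inner ℝ x (withEntry a 0 ζ) := by
  simp only [PiLp.inner_apply, ← Finset.add_sum_erase _ _ (Finset.mem_univ a)]
  have hrest : ∀ i ∈ Finset.univ.erase a, withEntry a z ζ i = withEntry a 0 ζ i := fun i hi => by
    simp [withEntry, Finset.ne_of_mem_erase hi]
  rw [Finset.sum_congr rfl fun i hi => by rw [hrest i hi]]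
  simp [withEntry]

lemma norm_sq_withEntry (a : ι) (z : ℝ) (ζ : Vel ι) :
    ‖withEntry a z ζ‖ ^ 2 = ‖ζ‖ ^ 2 - ζ a ^ 2 + z ^ 2 := by
  simp only [EuclideanSpace.norm_sq_eq, Real.norm_eq_abs, sq_abs]
  exact sum_sq_update

lemma maxwellian_withEntry (a : ι) (z : ℝ) (ζ : Vel ι) :
    maxwellian (withEntry a z ζ) = maxwellian (withEntry a 0 ζ) * gauss z := by
  rw [maxwellian_eq_exp_norm_sq, maxwellian_eq_exp_norm_sq, gauss, ← Real.exp_add,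
    norm_sq_withEntry, norm_sq_withEntry]
  ring_nf

lemma fourierAt_withEntry (a : ι) (z : ℝ) (ζ : Vel ι) (f : Vel ι →₁[volume] ℝ) :
    fourierAt (withEntry a z ζ) f
      = oscIntegral volume (fun x : Vel ι => x a)
        (fun x => planeWave (withEntry a 0 ζ) x * (f x : ℂ)) 0 z := by
  rw [fourierAt_apply, oscIntegral]
  congr 1
  ext x
  rw [oscIntegrand, pow_zero, one_mul, ← mul_assoc, planeWave, planeWave, ← Complex.exp_add,
    inner_withEntry]
  congr 2
  push_cast
  ring

lemma secondDifferenceLe_fourierAt_withEntry (a : ι) (ζ : Vel ι) {f : Vel ι →₁[volume] ℝ}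
    (hfourth : Integrable fun x : Vel ι => x a ^ 4 * ‖f x‖) :
    SecondDifferenceLe (fun z => fourierAt (withEntry a z ζ) f)
      ((2 * π) ^ 4 * ∫ x : Vel ι, x a ^ 4 * ‖f x‖) := by
  have hnorm : ∀ x : Vel ι, |x a| ^ 4 * ‖planeWave (withEntry a 0 ζ) x * (f x : ℂ)‖
      = x a ^ 4 * ‖f x‖ := fun x => by
    rw [norm_mul, norm_planeWave, one_mul, Complex.norm_real, Even.pow_abs (by decide)]
  have hbound := secondDifferenceLe_oscIntegral (a := fun x : Vel ι => x a) (by fun_prop)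
    (integrable_planeWave_mul (withEntry a 0 ζ) (L1.integrable_coeFn f))
    (by simpa only [hnorm] using hfourth)
  simp only [hnorm] at hbound
  simpa only [fourierAt_withEntry] using hbound

lemma secondDifferenceLe_deviationAt_withEntry (a : ι) (ζ : Vel ι) {f : Vel ι →₁[volume] ℝ}
    {m₄ : ℝ} (hf : ‖f‖ ≤ 1) (hfourth : Integrable fun x : Vel ι => x a ^ 4 * ‖f x‖)
    (hm₄ : ∫ x : Vel ι, x a ^ 4 * ‖f x‖ ≤ m₄) :
    SecondDifferenceLe (fun z => deviationAt (withEntry a z ζ) f)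
      ((2 * π) ^ 4 * (m₄ + 3 * (2 * π)⁻¹ ^ 2)) := by
  set m : ℂ := maxwellian (withEntry a 0 ζ) * fourierAt 0 f with hm
  have hm_le : ‖m‖ ≤ 1 := by
    rw [hm, norm_mul, Complex.norm_real, Real.norm_of_nonneg (maxwellian_nonneg _)]
    exact mul_le_one₀ (maxwellian_le_one _) (norm_nonneg _) ((norm_fourierAt_le _ _).trans hf)
  have heq : (fun z => deviationAt (withEntry a z ζ) f)
      = fun z => fourierAt (withEntry a z ζ) f - m * gauss z := by
    ext z
    rw [deviationAt_apply, maxwellian_withEntry, Complex.ofReal_mul, hm]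
    ring
  rw [heq]
  refine ((secondDifferenceLe_fourierAt_withEntry a ζ hfourth).sub
    (secondDifferenceLe_gauss.const_mul m)).mono ?_
  rw [mul_add]
  exact add_le_add (mul_le_mul_of_nonneg_left hm₄ (by positivity))
    (mul_le_of_le_one_left (by positivity) hm_le)

end Entry

/-! ### Comparison of the two generators -/

section MomentBounds

section WeightedIntegral

variable {X : Type*} [MeasurableSpace X] {μ : Measure X} {W : X → ℝ} {f : X →₁[μ] ℝ} {C : ℝ}

lemma integrable_mul_norm_of_lintegral_le (hW : Measurable W) (hW_nonneg : ∀ x, 0 ≤ W x)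
    (hf : ∫⁻ x, ENNReal.ofReal (W x) * ‖f x‖ₑ ∂μ ≤ ENNReal.ofReal C) :
    Integrable (fun x => W x * ‖f x‖) μ := by
  refine ⟨hW.aestronglyMeasurable.mul (Lp.aestronglyMeasurable f).norm, ?_⟩
  simp only [hasFiniteIntegral_iff_enorm, enorm_mul, enorm_norm,
    Real.enorm_of_nonneg (hW_nonneg _)]
  exact hf.trans_lt ENNReal.ofReal_lt_top

lemma integral_mul_norm_le_of_lintegral_le (hW : Measurable W) (hW_nonneg : ∀ x, 0 ≤ W x)
    (hC : 0 ≤ C) (hf : ∫⁻ x, ENNReal.ofReal (W x) * ‖f x‖ₑ ∂μ ≤ ENNReal.ofReal C) :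
    ∫ x, W x * ‖f x‖ ∂μ ≤ C := by
  rw [integral_eq_lintegral_of_nonneg_ae
    (.of_forall fun x => mul_nonneg (hW_nonneg x) (norm_nonneg _))
    (integrable_mul_norm_of_lintegral_le hW hW_nonneg hf).1]
  simp only [ENNReal.ofReal_mul (hW_nonneg _), ofReal_norm]
  exact ENNReal.toReal_le_of_le_ofReal hC hf

end WeightedIntegral

variable {M N : ℕ} {A : ℝ} {f : State M N}

lemma norm_le_one_of_momentSeminorm_le (hA : 0 < A)
    (hf : momentSeminorm M N A f ≤ ENNReal.ofReal A) : ‖f‖ ≤ 1 := by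
  have hmass := integral_mul_norm_le_of_lintegral_le (continuous_momentWeight A .mass).measurable
    (momentWeight_nonneg hA.le .mass) hA.le (momentSeminorm_le_iff.1 hf .mass)
  simp only [momentWeight, integral_const_mul] at hmass
  rw [L1.norm_eq_integral_norm]
  exact le_of_mul_le_mul_left (hmass.trans_eq (mul_one A).symm) hA

lemma fourth_pow_eq_three_mul_momentWeight (A : ℝ) (i : Fin M) (x : Vel (Fin M ⊕ Fin N)) :
    x (Sum.inl i) ^ 4 = 3 * momentWeight A (.fourth i) x := by
  simp only [momentWeight]
  ring

lemma integrable_fourth_mul_norm_of_momentSeminorm_le (hA : 0 ≤ A)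
    (hf : momentSeminorm M N A f ≤ ENNReal.ofReal A) (i : Fin M) :
    Integrable fun x : Vel (Fin M ⊕ Fin N) => x (Sum.inl i) ^ 4 * ‖f x‖ := by
  simp only [fourth_pow_eq_three_mul_momentWeight A, mul_assoc]
  exact (integrable_mul_norm_of_lintegral_le (continuous_momentWeight A (.fourth i)).measurable
    (momentWeight_nonneg hA _) (momentSeminorm_le_iff.1 hf (.fourth i))).const_mul 3

lemma integral_fourth_mul_norm_le_of_momentSeminorm_le (hA : 0 ≤ A)
    (hf : momentSeminorm M N A f ≤ ENNReal.ofReal A) (i : Fin M) :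
    ∫ x : Vel (Fin M ⊕ Fin N), x (Sum.inl i) ^ 4 * ‖f x‖ ≤ 3 * A := by
  simp only [fourth_pow_eq_three_mul_momentWeight A, mul_assoc, integral_const_mul]
  gcongr
  exact integral_mul_norm_le_of_lintegral_le (continuous_momentWeight A (.fourth i)).measurable
    (momentWeight_nonneg hA _) hA (momentSeminorm_le_iff.1 hf (.fourth i))

end MomentBounds

section Generators

variable {M N : ℕ}

lemma sysPart_withEntry (i : Fin M) (z : ℝ) (ζ : Vel (Fin M ⊕ Fin N)) :
    sysPart (withEntry (Sum.inl i) z ζ) = withEntry i z (sysPart ζ) := by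
  ext k
  simp only [sysPart_apply, withEntry, Function.update_apply, Sum.inl.injEq]

lemma sysOnly_collideBath_eq_withEntry (i : Fin M) (θ : ℝ) (ζ : Vel (Fin M ⊕ Fin N)) :
    sysOnly (collideBath (Sum.inl i) θ 0 ζ)
      = withEntry (Sum.inl i) (ζ (Sum.inl i) * Real.cos θ) (sysOnly ζ) := by
  ext k
  rcases k with k | k
  · simp [collideBath, withEntry, Function.update_apply]
  · simp [withEntry]

lemma sysOnly_collide_eq_withEntry (i : Fin M) (j : Fin N) (θ : ℝ) (ζ : Vel (Fin M ⊕ Fin N)) :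
    sysOnly (collide (Sum.inl i) (Sum.inr j) θ ζ)
      = withEntry (Sum.inl i) (ζ (Sum.inl i) * Real.cos θ + ζ (Sum.inr j) * Real.sin θ)
        (sysOnly ζ) := by
  ext k
  rcases k with k | k
  · simp [collide, withEntry, Function.update_apply]
  · simp [withEntry]

lemma sysOnly_collide_inr (i j : Fin N) (θ : ℝ) (ζ : Vel (Fin M ⊕ Fin N)) :
    sysOnly (collide (Sum.inr i) (Sum.inr j) θ ζ) = sysOnly ζ := by
  ext k
  rcases k with k | k <;> simp [collide]

lemma resPart_collide_inr (i j : Fin N) (θ : ℝ) (ζ : Vel (Fin M ⊕ Fin N)) :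
    resPart (collide (Sum.inr i) (Sum.inr j) θ ζ) = collide i j θ (resPart ζ) := by
  ext k
  simp only [resPart_apply, collide, Function.update_apply, Sum.inr.injEq]

lemma maxwellian_resPart_eq (j : Fin N) (ζ : Vel (Fin M ⊕ Fin N)) :
    maxwellian (resPart ζ)
      = (∏ k ∈ Finset.univ.erase j, gauss (ζ (Sum.inr k))) * gauss (ζ (Sum.inr j)) :=
  (Finset.prod_erase_mul _ _ (Finset.mem_univ j)).symm

lemma maxwellian_resPart_collide (i : Fin M) (j : Fin N) (θ : ℝ) (ζ : Vel (Fin M ⊕ Fin N)) :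
    maxwellian (resPart (collide (Sum.inl i) (Sum.inr j) θ ζ))
      = (∏ k ∈ Finset.univ.erase j, gauss (ζ (Sum.inr k))) *
        gauss (-ζ (Sum.inl i) * Real.sin θ + ζ (Sum.inr j) * Real.cos θ) := by
  rw [maxwellian_resPart_eq j]
  congr 1
  · refine Finset.prod_congr rfl fun k hk => ?_
    simp [collide, Finset.ne_of_mem_erase hk]
  · simp [collide]

/-- The reservoir is Maxwellian and independent of the system, as seen on Fourier transforms. -/
def ReservoirAtEquilibrium (f : State M N) : Prop :=
  ∀ ζ, fourierAt ζ f = maxwellian (resPart ζ) * fourierAt (sysOnly ζ) f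

namespace ReservoirAtEquilibrium

variable {f : State M N}

lemma deviationAt_eq (hf : ReservoirAtEquilibrium f) (ζ : Vel (Fin M ⊕ Fin N)) :
    deviationAt ζ f = maxwellian (resPart ζ) * deviationAt (sysOnly ζ) f := by
  rw [deviationAt_apply, deviationAt_apply, hf ζ, maxwellian_split ζ, maxwellian_split (sysOnly ζ),
    sysPart_sysOnly, resPart_sysOnly, maxwellian_zero]
  push_cast
  ring

lemma fourierAt_collisionOp_inr (hf : ReservoirAtEquilibrium f) {i j : Fin N} (hij : i ≠ j)
    (ζ : Vel (Fin M ⊕ Fin N)) :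
    fourierAt ζ (collisionOp (Sum.inr i) (Sum.inr j) (Sum.inr_injective.ne hij) f)
      = fourierAt ζ f := by
  have hinvariant : ∀ θ, fourierAt (collide (Sum.inr i) (Sum.inr j) θ ζ) f = fourierAt ζ f :=
    fun θ => by
      rw [hf, resPart_collide_inr, sysOnly_collide_inr, maxwellian_collide hij, ← hf]
  rw [collisionCovariant_fourierAt]
  simp only [hinvariant, angleMean_const]

lemma fourierAt_thermostatOp_sub_collisionOp (hf : ReservoirAtEquilibrium f) (i : Fin M)
    (j : Fin N) (ζ : Vel (Fin M ⊕ Fin N)) :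
    fourierAt ζ (thermostatOp (Sum.inl i) f)
      - fourierAt ζ (collisionOp (Sum.inl i) (Sum.inr j) Sum.inl_ne_inr f)
      = ((∏ k ∈ Finset.univ.erase j, gauss (ζ (Sum.inr k)) : ℝ) : ℂ) *
        (angleMean (fun θ => deviationAt (withEntry (Sum.inl i) (ζ (Sum.inl i) * Real.cos θ)
          (sysOnly ζ)) f * gauss (ζ (Sum.inl i) * Real.sin θ)) * gauss (ζ (Sum.inr j))
        - angleMean (fun θ => deviationAt (withEntry (Sum.inl i)
          (ζ (Sum.inl i) * Real.cos θ + ζ (Sum.inr j) * Real.sin θ) (sysOnly ζ)) f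
          * gauss (-ζ (Sum.inl i) * Real.sin θ + ζ (Sum.inr j) * Real.cos θ))) := by
  have hmass : fourierAt ζ (thermostatOp (Sum.inl i) f)
      - fourierAt ζ (collisionOp (Sum.inl i) (Sum.inr j) Sum.inl_ne_inr f)
      = deviationAt ζ (thermostatOp (Sum.inl i) f)
        - deviationAt ζ (collisionOp (Sum.inl i) (Sum.inr j) Sum.inl_ne_inr f) := by
    rw [deviationAt_apply, deviationAt_apply, fourierAt_zero_collisionOp,
      fourierAt_zero_thermostatOp]
    ring
  rw [hmass, thermostatCovariant_deviationAt, collisionCovariant_deviationAt, mul_sub,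
    ← angleMean_const_mul, mul_comm (angleMean _) (gauss _ : ℂ), ← mul_assoc,
    ← angleMean_const_mul]
  congr 2
  · ext θ
    rw [hf.deviationAt_eq, resPart_collideBath, sysOnly_collideBath_eq_withEntry,
      maxwellian_resPart_eq j, Complex.ofReal_mul]
    ring
  · ext θ
    rw [hf.deviationAt_eq, maxwellian_resPart_collide, sysOnly_collide_eq_withEntry,
      Complex.ofReal_mul]
    ring

end ReservoirAtEquilibrium

/-- The bounds on a state that control the difference of the two generators on it. -/
structure CloseToEquilibrium (f : State M N) (A D : ℝ) : Prop where
  reservoir : ReservoirAtEquilibrium f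
  deviation : ∀ ζ, ‖deviationAt ζ f‖ ≤ D * ‖sysPart ζ‖ ^ 2
  moments : momentSeminorm M N A f ≤ ENNReal.ofReal A

lemma norm_sq_sub_sq_nonneg {ι : Type*} [Fintype ι] (ζ : Vel ι) (i : ι) :
    0 ≤ ‖ζ‖ ^ 2 - ζ i ^ 2 := by
  have hentry := pow_le_pow_left₀ (norm_nonneg _) (PiLp.norm_apply_le ζ i) 2
  rw [Real.norm_eq_abs, sq_abs] at hentry
  exact sub_nonneg.2 hentry

namespace CloseToEquilibrium

variable {f : State M N} {A D L : ℝ}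

lemma quadraticGrowth (hf : CloseToEquilibrium f A D) (hA : 0 < A) (hD : 0 ≤ D)
    (hL : (2 * π) ^ 4 * (3 * A + 3 * (2 * π)⁻¹ ^ 2) + D ≤ L) (i : Fin M)
    (ζ : Vel (Fin M ⊕ Fin N)) :
    QuadraticGrowth (fun z => deviationAt (withEntry (Sum.inl i) z (sysOnly ζ)) f) √(D * L)
      (‖sysPart ζ‖ ^ 2 - ζ (Sum.inl i) ^ 2) := by
  refine (secondDifferenceLe_deviationAt_withEntry (Sum.inl i) (sysOnly ζ)
    (norm_le_one_of_momentSeminorm_le hA hf.moments)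
    (integrable_fourth_mul_norm_of_momentSeminorm_le hA.le hf.moments i)
    (integral_fourth_mul_norm_le_of_momentSeminorm_le hA.le hf.moments i)).quadraticGrowth
    hD (by positivity) hL (norm_sq_sub_sq_nonneg (sysPart ζ) i) fun z => ?_
  refine (hf.deviation _).trans_eq ?_
  rw [sysPart_withEntry, sysPart_sysOnly, norm_sq_withEntry, sysPart_apply]

lemma norm_thermostatOp_sub_collisionOp_le (hf : CloseToEquilibrium f A D) (hA : 0 < A)
    (hD : 0 ≤ D) (hL : (2 * π) ^ 4 * (3 * A + 3 * (2 * π)⁻¹ ^ 2) + D ≤ L) (i : Fin M) (j : Fin N)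
    (ζ : Vel (Fin M ⊕ Fin N)) :
    ‖fourierAt ζ (thermostatOp (Sum.inl i) f)
      - fourierAt ζ (collisionOp (Sum.inl i) (Sum.inr j) Sum.inl_ne_inr f)‖
      ≤ 5 * √(D * L) * (((1 - gauss (ζ (Sum.inr j))) *
        ∏ k ∈ Finset.univ.erase j, gauss (ζ (Sum.inr k))) * ‖sysPart ζ‖ ^ 2
        + ζ (Sum.inr j) ^ 2) := by
  set P := ∏ k ∈ Finset.univ.erase j, gauss (ζ (Sum.inr k))
  have hP : 0 ≤ P := Finset.prod_nonneg fun k _ => gauss_nonneg _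
  have hP_le : P ≤ 1 := Finset.prod_le_one (fun k _ => gauss_nonneg _) fun k _ => gauss_le_one _
  have hradial := (hf.quadraticGrowth hA hD hL i ζ).norm_angleMean_sub_le (ζ (Sum.inl i))
    (ζ (Sum.inr j))
  rw [sub_add_cancel] at hradial
  calc ‖fourierAt ζ (thermostatOp (Sum.inl i) f)
        - fourierAt ζ (collisionOp (Sum.inl i) (Sum.inr j) Sum.inl_ne_inr f)‖
      ≤ P * (5 * √(D * L) * ((1 - gauss (ζ (Sum.inr j))) * ‖sysPart ζ‖ ^ 2
          + ζ (Sum.inr j) ^ 2)) := by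
        rw [hf.reservoir.fourierAt_thermostatOp_sub_collisionOp i j ζ, norm_mul,
          Complex.norm_real, Real.norm_of_nonneg hP]
        exact mul_le_mul_of_nonneg_left hradial hP
    _ = 5 * √(D * L) * ((1 - gauss (ζ (Sum.inr j))) * P * ‖sysPart ζ‖ ^ 2
          + P * ζ (Sum.inr j) ^ 2) := by ring
    _ ≤ 5 * √(D * L) * ((1 - gauss (ζ (Sum.inr j))) * P * ‖sysPart ζ‖ ^ 2
          + ζ (Sum.inr j) ^ 2) := by
        gcongr
        exact mul_le_of_le_one_left (sq_nonneg _) hP_le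

lemma sum_norm_thermostatOp_sub_collisionOp_le (hf : CloseToEquilibrium f A D) (hA : 0 < A)
    (hD : 0 ≤ D) (hL : (2 * π) ^ 4 * (3 * A + 3 * (2 * π)⁻¹ ^ 2) + D ≤ L) (i : Fin M)
    (ζ : Vel (Fin M ⊕ Fin N)) :
    ∑ j : Fin N, ‖fourierAt ζ (thermostatOp (Sum.inl i) f)
      - fourierAt ζ (collisionOp (Sum.inl i) (Sum.inr j) Sum.inl_ne_inr f)‖
      ≤ 5 * √(D * L) * ‖ζ‖ ^ 2 := by
  refine (Finset.sum_le_sum fun j _ =>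
    hf.norm_thermostatOp_sub_collisionOp_le hA hD hL i j ζ).trans ?_
  have hres : ‖resPart ζ‖ ^ 2 = ∑ j, ζ (Sum.inr j) ^ 2 := by
    simp only [EuclideanSpace.norm_sq_eq, resPart_apply, Real.norm_eq_abs, sq_abs]
  rw [← Finset.mul_sum, Finset.sum_add_distrib, ← Finset.sum_mul, norm_sq_split, hres]
  gcongr
  exact mul_le_of_le_one_left (sq_nonneg _) (sum_one_sub_mul_prod_erase_le_one Finset.univ
    (fun _ => gauss_nonneg _) fun _ => gauss_le_one _)

end CloseToEquilibrium

lemma map_generator_sub {E : Type*} [NormedAddCommGroup E] [NormedSpace ℝ E] {α β γ : Type*}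
    [Fintype α] [Fintype β] [Fintype γ] [Nonempty γ] (χ : E →L[ℝ] ℂ) (S : E →L[ℝ] E)
    (R : α → E →L[ℝ] E) (T : β → E →L[ℝ] E) (I : β → γ → E →L[ℝ] E) {r m : ℝ} {x : E}
    (hR : ∀ p, χ (R p x) = χ x) :
    χ ((S + m • ∑ i, (T i - 1)) x
      - (S + r • ∑ p, (R p - 1) + (m / Fintype.card γ) • ∑ i, ∑ j, (I i j - 1)) x)
      = ((m / Fintype.card γ : ℝ) : ℂ) * ∑ i, ∑ j, (χ (T i x) - χ (I i j x)) := by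
  have hcard : (Fintype.card γ : ℂ) ≠ 0 := Nat.cast_ne_zero.2 Fintype.card_ne_zero
  have hsub : ∀ P : E →L[ℝ] E, χ ((P - 1) x) = χ (P x) - χ x := fun P => by
    rw [sub_apply, one_apply_eq_self, map_sub]
  simp only [add_apply, smul_apply, sum_apply, map_sub, map_add, map_smul, map_sum, hsub, hR,
    sub_self, Finset.sum_const_zero, smul_zero, Complex.real_smul]
  simp only [Finset.sum_sub_distrib, Finset.sum_const, Finset.card_univ, nsmul_eq_mul,
    ← Finset.mul_sum]
  push_cast
  field_simp
  ring

lemma ReservoirAtEquilibrium.fourierAt_genThermostat_sub_genFinite (hN : 0 < N) {f : State M N}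
    (hf : ReservoirAtEquilibrium f) (lamS lamR mu : ℝ) (ζ : Vel (Fin M ⊕ Fin N)) :
    fourierAt ζ (genThermostat M N lamS mu f - genFinite M N lamS lamR mu f)
      = ((mu / N : ℝ) : ℂ) * ∑ i : Fin M, ∑ j : Fin N, (fourierAt ζ (thermostatOp (Sum.inl i) f)
        - fourierAt ζ (collisionOp (Sum.inl i) (Sum.inr j) Sum.inl_ne_inr f)) := by
  have : Nonempty (Fin N) := ⟨⟨0, hN⟩⟩
  have hsub := map_generator_sub (fourierAt ζ) (genS M N lamS)
    (fun p : {p : Fin N × Fin N // p.1 < p.2} =>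
      collisionOp (Sum.inr p.1.1) (Sum.inr p.1.2) (Sum.inr_injective.ne p.2.ne))
    (fun i : Fin M => thermostatOp (Sum.inl i))
    (fun (i : Fin M) (j : Fin N) => collisionOp (Sum.inl i) (Sum.inr j) Sum.inl_ne_inr)
    (r := lamR / ((N : ℝ) - 1)) (m := mu) (x := f)
    (fun p => hf.fourierAt_collisionOp_inr p.2.ne ζ)
  rwa [Fintype.card_fin] at hsub

lemma CloseToEquilibrium.norm_genThermostat_sub_genFinite_le (hN : 0 < N) {f : State M N}
    {A D L : ℝ} (hf : CloseToEquilibrium f A D) (hA : 0 < A) (hD : 0 ≤ D)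
    (hL : (2 * π) ^ 4 * (3 * A + 3 * (2 * π)⁻¹ ^ 2) + D ≤ L) (lamS lamR : ℝ) {mu : ℝ}
    (hmu : 0 ≤ mu) (ζ : Vel (Fin M ⊕ Fin N)) :
    ‖fourierAt ζ (genThermostat M N lamS mu f - genFinite M N lamS lamR mu f)‖
      ≤ mu / N * (M * (5 * √(D * L))) * ‖ζ‖ ^ 2 := by
  rw [hf.reservoir.fourierAt_genThermostat_sub_genFinite hN, norm_mul, Complex.norm_real,
    Real.norm_of_nonneg (by positivity), mul_assoc, mul_assoc (M : ℝ)]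
  gcongr
  calc ‖∑ i : Fin M, ∑ j : Fin N, (fourierAt ζ (thermostatOp (Sum.inl i) f)
        - fourierAt ζ (collisionOp (Sum.inl i) (Sum.inr j) Sum.inl_ne_inr f))‖
      ≤ ∑ _i : Fin M, 5 * √(D * L) * ‖ζ‖ ^ 2 :=
        norm_sum_le_of_le _ fun i _ => (norm_sum_le _ _).trans
          (hf.sum_norm_thermostatOp_sub_collisionOp_le hA hD hL i ζ)
    _ = M * (5 * √(D * L) * ‖ζ‖ ^ 2) := by
        rw [Finset.sum_const, Finset.card_univ, Fintype.card_fin, nsmul_eq_mul]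

end Generators

/-! ### Finiteness of the initial distance -/

lemma norm_exp_mul_I_sub_one_sub_le (u : ℝ) :
    ‖Complex.exp (u * Complex.I) - 1 - u * Complex.I‖ ≤ 3 * u ^ 2 := by
  have hnorm : ‖(u : ℂ) * Complex.I‖ = |u| := by simp
  rcases le_total |u| 1 with hle | hge
  · have htaylor := Complex.norm_exp_sub_one_sub_id_le (hnorm.le.trans hle)
    rw [hnorm, sq_abs] at htaylor
    linarith [sq_nonneg u]
  · calc ‖Complex.exp (u * Complex.I) - 1 - u * Complex.I‖
        ≤ ‖Complex.exp (u * Complex.I)‖ + ‖(1 : ℂ)‖ + ‖(u : ℂ) * Complex.I‖ :=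
          norm_sub_le_of_le (norm_sub_le _ _) le_rfl
      _ = 2 + |u| := by rw [Complex.norm_exp_ofReal_mul_I, norm_one, hnorm, one_add_one_eq_two]
      _ ≤ 3 * u ^ 2 := by nlinarith [sq_abs u]

section FiniteDistance

variable {ι : Type*} [Fintype ι] {l : Vel ι → ℝ}

lemma norm_planeWave_sub_one_sub_le (ξ v : Vel ι) :
    ‖planeWave ξ v - 1 - ((-2 * π * inner ℝ v ξ : ℝ) : ℂ) * Complex.I‖
      ≤ 3 * (2 * π) ^ 2 * ‖ξ‖ ^ 2 * ‖v‖ ^ 2 := by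
  have hinner : inner ℝ v ξ ^ 2 ≤ (‖v‖ * ‖ξ‖) ^ 2 :=
    sq_le_sq.2 ((abs_real_inner_le_norm v ξ).trans (le_abs_self _))
  calc ‖planeWave ξ v - 1 - ((-2 * π * inner ℝ v ξ : ℝ) : ℂ) * Complex.I‖
      ≤ 3 * (-2 * π * inner ℝ v ξ) ^ 2 := norm_exp_mul_I_sub_one_sub_le _
    _ = 3 * (2 * π) ^ 2 * inner ℝ v ξ ^ 2 := by ring
    _ ≤ 3 * (2 * π) ^ 2 * (‖v‖ * ‖ξ‖) ^ 2 := by gcongr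
    _ = 3 * (2 * π) ^ 2 * ‖ξ‖ ^ 2 * ‖v‖ ^ 2 := by ring

lemma integrable_entry_pow_mul_of_le (hl : Integrable l) {i : ι} {k n : ℕ} (hkn : k ≤ n)
    (hn : Integrable fun v => v i ^ n * l v) : Integrable fun v => v i ^ k * l v := by
  have hentry : Continuous fun v : Vel ι => v i := by fun_prop
  have habs_n : Integrable fun v : Vel ι => |v i| ^ n * ‖(l v : ℂ)‖ := by simpa using hn.norm
  have habs_k := integrable_abs_pow_mul_norm_of_le hentry.measurable hl.ofReal hkn habs_n
  refine habs_k.mono' ((hentry.pow k).aestronglyMeasurable.mul hl.1) (.of_forall fun v => ?_)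
  simp

lemma inner_mul_eq_sum (v ξ : Vel ι) (c : ℝ) : inner ℝ v ξ * c = ∑ i, ξ i * (v i * c) := by
  simp only [PiLp.inner_apply, Finset.sum_mul, Real.inner_apply, mul_assoc, mul_left_comm]

lemma integrable_inner_mul (hl_first : ∀ i, Integrable fun v => v i * l v) (ξ : Vel ι) :
    Integrable fun v => inner ℝ v ξ * l v := by
  simp only [inner_mul_eq_sum]
  exact integrable_finsetSum _ fun i _ => (hl_first i).const_mul _

lemma integral_inner_mul_eq_zero (hl_first : ∀ i, Integrable fun v => v i * l v)
    (hl_mean : ∀ i, ∫ v, v i * l v = 0) (ξ : Vel ι) : ∫ v, inner ℝ v ξ * l v = 0 := by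
  simp only [inner_mul_eq_sum]
  rw [integral_finsetSum _ fun i _ => (hl_first i).const_mul _]
  simp only [integral_const_mul, hl_mean, mul_zero, Finset.sum_const_zero]

lemma integrable_norm_sq_mul_norm (hl_second : ∀ i, Integrable fun v => v i ^ 2 * l v) :
    Integrable fun v => ‖v‖ ^ 2 * ‖l v‖ := by
  simpa [EuclideanSpace.norm_sq_eq, Finset.sum_mul] using
    integrable_finsetSum Finset.univ fun i _ => (hl_second i).norm

lemma fourier_sub_one_eq_integral (hl : Integrable l) (hl_mass : ∫ v, l v = 1)
    (hl_first : ∀ i, Integrable fun v => v i * l v) (hl_mean : ∀ i, ∫ v, v i * l v = 0)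
    (ξ : Vel ι) :
    𝓕 (fun v => (l v : ℂ)) ξ - 1
      = ∫ v, (planeWave ξ v - 1 - ((-2 * π * inner ℝ v ξ : ℝ) : ℂ) * Complex.I) * (l v : ℂ) := by
  have hlinear : Integrable fun v => (-2 * π * Complex.I) * ((inner ℝ v ξ * l v : ℝ) : ℂ) :=
    (integrable_inner_mul hl_first ξ).ofReal.const_mul _
  have hlinear_zero : ∫ v, (-2 * π * Complex.I) * ((inner ℝ v ξ * l v : ℝ) : ℂ) = 0 := by
    rw [integral_const_mul, integral_complex_ofReal, integral_inner_mul_eq_zero hl_first hl_mean,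
      Complex.ofReal_zero, mul_zero]
  have hl_complex : Integrable fun v => (l v : ℂ) := hl.ofReal
  have hdifference : Integrable fun v => planeWave ξ v * (l v : ℂ) - (l v : ℂ) :=
    (integrable_planeWave_mul ξ hl).sub hl_complex
  have hmass : ∫ v, (l v : ℂ) = 1 := by rw [integral_complex_ofReal, hl_mass, Complex.ofReal_one]
  calc 𝓕 (fun v => (l v : ℂ)) ξ - 1
      = (∫ v, planeWave ξ v * (l v : ℂ)) - (∫ v, (l v : ℂ))
          - ∫ v, (-2 * π * Complex.I) * ((inner ℝ v ξ * l v : ℝ) : ℂ) := by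
        rw [fourier_eq_integral_planeWave, hmass, hlinear_zero, sub_zero]
    _ = ∫ v, (planeWave ξ v * (l v : ℂ) - (l v : ℂ)
          - (-2 * π * Complex.I) * ((inner ℝ v ξ * l v : ℝ) : ℂ)) := by
        rw [← integral_sub (integrable_planeWave_mul ξ hl) hl_complex,
          ← integral_sub hdifference hlinear]
    _ = ∫ v, (planeWave ξ v - 1 - ((-2 * π * inner ℝ v ξ : ℝ) : ℂ) * Complex.I) * (l v : ℂ) :=
        integral_congr_ae (.of_forall fun v => by push_cast; ring)

lemma norm_fourier_sub_one_le (hl : Integrable l) (hl_mass : ∫ v, l v = 1)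
    (hl_mean : ∀ i, ∫ v, v i * l v = 0) (hl_second : ∀ i, Integrable fun v => v i ^ 2 * l v)
    (ξ : Vel ι) :
    ‖𝓕 (fun v => (l v : ℂ)) ξ - 1‖
      ≤ 3 * (2 * π) ^ 2 * (∫ v, ‖v‖ ^ 2 * ‖l v‖) * ‖ξ‖ ^ 2 := by
  have hl_first : ∀ i, Integrable fun v => v i * l v := fun i => by
    simpa only [pow_one] using integrable_entry_pow_mul_of_le hl one_le_two (hl_second i)
  rw [fourier_sub_one_eq_integral hl hl_mass hl_first hl_mean]
  refine (norm_integral_le_of_norm_le (g := fun v => 3 * (2 * π) ^ 2 * ‖ξ‖ ^ 2 * (‖v‖ ^ 2 * ‖l v‖))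
    ((integrable_norm_sq_mul_norm hl_second).const_mul _) (.of_forall fun v => ?_)).trans_eq ?_
  · rw [norm_mul, Complex.norm_real, ← mul_assoc]
    gcongr
    exact norm_planeWave_sub_one_sub_le ξ v
  · rw [integral_const_mul]
    ring

lemma norm_one_sub_maxwellian_le (ξ : Vel ι) : ‖(1 : ℂ) - (maxwellian ξ : ℂ)‖ ≤ π * ‖ξ‖ ^ 2 := by
  rw [← Complex.ofReal_one, ← Complex.ofReal_sub, Complex.norm_real,
    Real.norm_of_nonneg (sub_nonneg.2 (maxwellian_le_one ξ)), maxwellian_eq_exp_norm_sq]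
  linarith [Real.add_one_le_exp (-π * ‖ξ‖ ^ 2)]

lemma gtwDist_le {f g : Vel ι → ℝ} {C : ℝ}
    (hC : ∀ ξ, ‖𝓕 (fun v => (f v : ℂ)) ξ - 𝓕 (fun v => (g v : ℂ)) ξ‖ ≤ C * ‖ξ‖ ^ 2) :
    gtwDist f g ≤ ENNReal.ofReal C :=
  iSup₂_le fun ξ hξ => ENNReal.ofReal_le_ofReal
    ((div_le_iff₀ (pow_pos (norm_pos_iff.2 hξ) 2)).2 (hC ξ))

lemma norm_fourier_sub_le_gtwDist {f g : Vel ι → ℝ} (hfg : gtwDist f g ≠ ⊤)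
    (hmass : ∫ v, f v = ∫ v, g v) (ξ : Vel ι) :
    ‖𝓕 (fun v => (f v : ℂ)) ξ - 𝓕 (fun v => (g v : ℂ)) ξ‖ ≤ (gtwDist f g).toReal * ‖ξ‖ ^ 2 := by
  rcases eq_or_ne ξ 0 with rfl | hξ
  · rw [fourier_zero_eq_integral, fourier_zero_eq_integral, hmass, sub_self, norm_zero]
    positivity
  · rw [← div_le_iff₀ (pow_pos (norm_pos_iff.2 hξ) 2), ← ENNReal.ofReal_le_iff_le_toReal hfg]
    exact le_iSup₂ (f := fun (ξ : Vel ι) (_ : ξ ≠ 0) => ENNReal.ofReal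
      (‖𝓕 (fun v => (f v : ℂ)) ξ - 𝓕 (fun v => (g v : ℂ)) ξ‖ / ‖ξ‖ ^ 2)) ξ hξ

lemma gtwDist_maxwellian_ne_top (hl : Integrable l) (hl_mass : ∫ v, l v = 1)
    (hl_mean : ∀ i, ∫ v, v i * l v = 0) (hl_second : ∀ i, Integrable fun v => v i ^ 2 * l v) :
    gtwDist l maxwellian ≠ ⊤ := by
  refine ne_top_of_le_ne_top ENNReal.ofReal_ne_top (gtwDist_le
    (C := 3 * (2 * π) ^ 2 * (∫ v, ‖v‖ ^ 2 * ‖l v‖) + π) fun ξ => ?_)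
  rw [fourier_maxwellian, add_mul, ← sub_add_sub_cancel _ (1 : ℂ)]
  exact norm_add_le_of_le (norm_fourier_sub_one_le hl hl_mass hl_mean hl_second ξ)
    (norm_one_sub_maxwellian_le ξ)

end FiniteDistance

/-! ### Comparison of the two evolutions -/

section Evolutions

variable {M N : ℕ} {lamS lamR mu t A D : ℝ} {l : Vel (Fin M) → ℝ}

lemma closeToEquilibrium_thermostatEvolution (hM : 0 < M) (hlamS : 0 ≤ lamS) (hmu : 0 ≤ mu)
    (hA : (2 * π)⁻¹ ^ 2 ≤ A) (hD : 0 ≤ D) (hl : Integrable l) (hl_mass : ∫ v, l v = 1)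
    (hl_deviation : ∀ ξ, ‖𝓕 (fun v => (l v : ℂ)) ξ
      - 𝓕 (fun v : Vel (Fin M) => (maxwellian v : ℂ)) ξ‖ ≤ D * ‖ξ‖ ^ 2)
    (hl_moments : momentSeminorm M N A (initialState N hl) ≤ ENNReal.ofReal A) (ht : 0 ≤ t) :
    CloseToEquilibrium (thermostatEvolution lamS mu t (initialState N hl)) A
      (Real.exp (-(mu / 2) * t) * D) where
  reservoir := fourierAt_thermostatEvolution_initialState hM hlamS hmu ht hl
  deviation := norm_deviationAt_thermostatEvolution_le hM hlamS hmu ht hD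
    (norm_deviationAt_initialState_le hl hl_mass hl_deviation)
  moments := (momentSeminorm_thermostatEvolution_le hM hlamS hmu ht hA _).trans hl_moments

lemma norm_fourierAt_finiteEvolution_le (hM : 0 < M) (hN : 0 < N) (hlamS : 0 ≤ lamS)
    (hlamR : 0 ≤ lamR) (hmu : 0 ≤ mu) (ht : 0 ≤ t) {C : ℝ} (hC : 0 ≤ C) {f : State M N}
    (hf : ∀ ζ, ‖fourierAt ζ f‖ ≤ C * ‖ζ‖ ^ 2) (ζ : Vel (Fin M ⊕ Fin N)) :
    ‖fourierAt ζ (finiteEvolution lamS lamR mu t f)‖ ≤ C * ‖ζ‖ ^ 2 := by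
  have hsq_nonneg : ∀ ζ : Vel (Fin M ⊕ Fin N), 0 ≤ ‖ζ‖ ^ 2 := fun ζ => sq_nonneg ‖ζ‖
  have hcontract := LscSeminorm.finiteEvolution_le
    (p := functionalSeminorm fourierAt fun ζ => ‖ζ‖ ^ 2) hM hN hlamS hlamR hmu ht
    (fun a b hab => (collisionCovariant_fourierAt hab).opLe hsq_nonneg fun ζ θ => by
      rw [norm_collide hab]) f
  exact (functionalSeminorm_le_ofReal_iff hsq_nonneg hC).1
    (hcontract.trans ((functionalSeminorm_le_ofReal_iff hsq_nonneg hC).2 hf)) ζ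

lemma sqrt_exp_half_mul (k s B : ℝ) :
    √(Real.exp (-(k / 2) * s) * B) = Real.exp (-(k / 4) * s) * √B := by
  rw [Real.sqrt_mul (Real.exp_pos _).le, Real.sqrt_eq_rpow, ← Real.exp_mul]
  ring_nf

lemma norm_fourierAt_finiteEvolution_generator_sub_le (hM : 0 < M) (hN : 0 < N)
    (hlamS : 0 ≤ lamS) (hlamR : 0 ≤ lamR) (hmu : 0 ≤ mu) (hA : (2 * π)⁻¹ ^ 2 ≤ A) (hD : 0 ≤ D)
    {L : ℝ} (hL : (2 * π) ^ 4 * (3 * A + 3 * (2 * π)⁻¹ ^ 2) + D ≤ L)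
    (hl : Integrable l) (hl_mass : ∫ v, l v = 1)
    (hl_deviation : ∀ ξ, ‖𝓕 (fun v => (l v : ℂ)) ξ
      - 𝓕 (fun v : Vel (Fin M) => (maxwellian v : ℂ)) ξ‖ ≤ D * ‖ξ‖ ^ 2)
    (hl_moments : momentSeminorm M N A (initialState N hl) ≤ ENNReal.ofReal A)
    {s : ℝ} (hs : 0 ≤ s) (ht : 0 ≤ t) (ζ : Vel (Fin M ⊕ Fin N)) :
    ‖fourierAt ζ (finiteEvolution lamS lamR mu t
        (genThermostat M N lamS mu (thermostatEvolution lamS mu s (initialState N hl))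
          - genFinite M N lamS lamR mu (thermostatEvolution lamS mu s (initialState N hl))))‖
      ≤ mu / N * (M * (5 * √(D * L))) * ‖ζ‖ ^ 2 * Real.exp (-(mu / 4) * s) := by
  have hA_pos : 0 < A := lt_of_lt_of_le (by positivity) hA
  have hclose := closeToEquilibrium_thermostatEvolution hM hlamS hmu hA hD hl hl_mass
    hl_deviation hl_moments hs
  have hdecay : Real.exp (-(mu / 2) * s) * D ≤ D :=
    mul_le_of_le_one_left hD (Real.exp_le_one_iff.2 (by nlinarith))
  refine (norm_fourierAt_finiteEvolution_le hM hN hlamS hlamR hmu ht (by positivity)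
    (fun ζ => hclose.norm_genThermostat_sub_genFinite_le hN hA_pos (by positivity)
      ((add_le_add_right hdecay _).trans hL) lamS lamR hmu ζ) ζ).trans_eq ?_
  rw [mul_assoc (Real.exp _), sqrt_exp_half_mul]
  ring

lemma norm_fourierAt_evolution_sub_le (hM : 0 < M) (hN : 0 < N) (hlamS : 0 ≤ lamS)
    (hlamR : 0 ≤ lamR) (hmu : 0 < mu) (hA : (2 * π)⁻¹ ^ 2 ≤ A) (hD : 0 ≤ D)
    {L : ℝ} (hL : (2 * π) ^ 4 * (3 * A + 3 * (2 * π)⁻¹ ^ 2) + D ≤ L)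
    (hl : Integrable l) (hl_mass : ∫ v, l v = 1)
    (hl_deviation : ∀ ξ, ‖𝓕 (fun v => (l v : ℂ)) ξ
      - 𝓕 (fun v : Vel (Fin M) => (maxwellian v : ℂ)) ξ‖ ≤ D * ‖ξ‖ ^ 2)
    (hl_moments : momentSeminorm M N A (initialState N hl) ≤ ENNReal.ofReal A) (ht : 0 ≤ t)
    (ζ : Vel (Fin M ⊕ Fin N)) :
    ‖fourierAt ζ (thermostatEvolution lamS mu t (initialState N hl))
        - fourierAt ζ (finiteEvolution lamS lamR mu t (initialState N hl))‖
      ≤ 20 * M / N * (1 - Real.exp (-(mu / 4) * t)) * √(D * L) * ‖ζ‖ ^ 2 := by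
  refine (norm_exp_smul_sub_exp_smul_le (genThermostat M N lamS mu) (genFinite M N lamS lamR mu)
    (fourierAt ζ) (initialState N hl) ht (by positivity : mu / 4 ≠ 0) fun s hs =>
      norm_fourierAt_finiteEvolution_generator_sub_le hM hN hlamS hlamR hmu.le hA hD hL hl hl_mass
        hl_deviation hl_moments hs.1 (sub_nonneg.2 hs.2.le) ζ).trans_eq ?_
  field_simp
  ring

lemma inv_two_pi_sq_le_half : (2 * π)⁻¹ ^ 2 ≤ 1 / 2 := by
  have hinv : (2 * π)⁻¹ ≤ 1 / 2 :=
    inv_le_of_inv_le₀ (by norm_num) (by linarith [Real.pi_gt_three])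
  nlinarith [inv_pos.2 Real.two_pi_pos]

lemma fourth_derivative_constant_le (E : ℝ) :
    (2 * π) ^ 4 * (3 * (E + 1 / 2) + 3 * (2 * π)⁻¹ ^ 2) ≤ 48 * π ^ 4 * (E + 1) := by
  have hexpand : (2 * π) ^ 4 * (3 * (E + 1 / 2) + 3 * (2 * π)⁻¹ ^ 2)
      = 48 * π ^ 4 * E + 24 * π ^ 4 + 12 * π ^ 2 := by
    field_simp
    ring
  rw [hexpand]
  nlinarith [Real.pi_gt_three, sq_nonneg (π ^ 2 - 1)]

lemma twenty_le_sixteen_mul_sqrt_two : (20 : ℝ) ≤ 16 * √2 := by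
  have hsqrt : (5 / 4 : ℝ) ≤ √2 := Real.le_sqrt_of_sq_le (by norm_num)
  linarith

lemma gtwDist_evolution_le (hM : 0 < M) (hN : 0 < N) (hlamS : 0 ≤ lamS) (hlamR : 0 ≤ lamR)
    (hmu : 0 < mu) (hl : Integrable l) (hl_nonneg : 0 ≤ᵐ[volume] l) (hl_mass : ∫ v, l v = 1)
    {E₄ : ℝ} (hl_fourth : ∀ i, Integrable fun v => v i ^ 4 * l v)
    (hE₄ : ∀ i, ∫ v, v i ^ 4 * l v ≤ E₄) (hfinite : gtwDist l maxwellian ≠ ⊤) (ht : 0 ≤ t) :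
    gtwDist (thermostatEvolution lamS mu t (initialState N hl))
        (finiteEvolution lamS lamR mu t (initialState N hl)) ≤
      ENNReal.ofReal (16 * √2 * M / N * (1 - Real.exp (-(mu / 4) * t)) *
        √((gtwDist l maxwellian).toReal *
          (48 * π ^ 4 * (E₄ + 1) + (gtwDist l maxwellian).toReal))) := by
  have hE₄_nonneg : 0 ≤ E₄ := (integral_nonneg_of_ae <| by
    filter_upwards [hl_nonneg] with v hv using mul_nonneg (by positivity) hv).trans (hE₄ ⟨0, hM⟩)
  have hA : (2 * π)⁻¹ ^ 2 ≤ E₄ + 1 / 2 := inv_two_pi_sq_le_half.trans (by linarith)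
  have hdecay : 0 ≤ 1 - Real.exp (-(mu / 4) * t) :=
    sub_nonneg.2 (Real.exp_le_one_iff.2 (by nlinarith))
  refine gtwDist_le fun ζ => ?_
  rw [fourier_coe, fourier_coe]
  refine (norm_fourierAt_evolution_sub_le hM hN hlamS hlamR hmu hA ENNReal.toReal_nonneg
    (add_le_add_left (fourth_derivative_constant_le E₄) _) hl hl_mass
    (norm_fourier_sub_le_gtwDist hfinite (hl_mass.trans integral_maxwellian.symm))
    (momentSeminorm_initialState_le hl hl_nonneg hl_mass hE₄_nonneg hl_fourth hE₄) ht ζ).trans ?_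
  gcongr
  exact twenty_le_sixteen_mul_sqrt_two

end Evolutions

end KacReservoir

end

theorem mainTheorem2_general (M N : ℕ) (hM : 0 < M) (hN : 0 < N)
    (lamS lamR mu : ℝ) (hlamS : 0 ≤ lamS) (hlamR : 0 ≤ lamR) (hmu : 0 < mu)
    (l₀ : Vel (Fin M) → ℝ) (hl₀ : Integrable l₀) (hl₀_nonneg : 0 ≤ᵐ[volume] l₀)
    (hl₀_one : ∫ v, l₀ v = 1) (hl₀_mean : ∀ i, ∫ v, v i * l₀ v = 0)
    (E₄ : ℝ) (hl₀_fourth : ∀ i, Integrable fun v => v i ^ 4 * l₀ v)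
    (hE₄ : ∀ i, ∫ v, v i ^ 4 * l₀ v ≤ E₄) :
    gtwDist l₀ maxwellian ≠ ⊤ ∧
    ∀ t : ℝ, 0 < t →
      gtwDist (thermostatEvolution lamS mu t (initialState N hl₀))
          (finiteEvolution lamS lamR mu t (initialState N hl₀)) ≤
        ENNReal.ofReal (16 * √2 * M / N * (1 - Real.exp (-(mu / 4) * t)) *
          √((gtwDist l₀ maxwellian).toReal *
            (48 * π ^ 4 * (E₄ + 1) + (gtwDist l₀ maxwellian).toReal))) := by
  have hl₀_second : ∀ i, Integrable fun v => v i ^ 2 * l₀ v := fun i =>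
    integrable_entry_pow_mul_of_le hl₀ (by norm_num) (hl₀_fourth i)
  have hfinite := gtwDist_maxwellian_ne_top hl₀ hl₀_one hl₀_mean hl₀_second
  exact ⟨hfinite, fun t ht => gtwDist_evolution_le hM hN hlamS hlamR hmu hl₀ hl₀_nonneg hl₀_one
    hl₀_fourth hE₄ hfinite ht.le⟩

theorem mainTheorem2 (M N : ℕ) (hM : 0 < M) (hN : 0 < N)
    (lamS lamR mu : ℝ) (hlamS : 0 ≤ lamS) (hlamR : 0 ≤ lamR) (hmu : 0 < mu)
    (l₀ : Vel (Fin M) → ℝ) (hl₀ : Integrable l₀) (hl₀_nonneg : 0 ≤ᵐ[volume] l₀)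
    (hl₀_one : ∫ v, l₀ v = 1)
    (hl₀_symm : ∀ σ : Equiv.Perm (Fin M),
      (fun v : Vel (Fin M) => l₀ (WithLp.toLp 2 fun i => v (σ i))) =ᵐ[volume] l₀)
    (hl₀_mean : ∀ i, ∫ v, v i * l₀ v = 0)
    (hl₀_second : ∀ i, Integrable fun v => v i ^ 2 * l₀ v)
    (E₄ : ℝ) (hl₀_fourth : ∀ i, Integrable fun v => v i ^ 4 * l₀ v)
    (hE₄ : ∀ i, ∫ v, v i ^ 4 * l₀ v = E₄) :
    gtwDist l₀ maxwellian ≠ ⊤ ∧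
    ∀ t : ℝ, 0 < t →
      gtwDist (thermostatEvolution lamS mu t (initialState N hl₀))
          (finiteEvolution lamS lamR mu t (initialState N hl₀)) ≤
        ENNReal.ofReal (16 * √2 * M / N * (1 - Real.exp (-(mu / 4) * t)) *
          √((gtwDist l₀ maxwellian).toReal *
            (48 * π ^ 4 * (E₄ + 1) + (gtwDist l₀ maxwellian).toReal))) :=
  mainTheorem2_general M N hM hN lamS lamR mu hlamS hlamR hmu l₀ hl₀ hl₀_nonneg hl₀_one hl₀_mean
    E₄ hl₀_fourth fun i => (hE₄ i).le
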